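/- Let $\xi^\perp=(-\xi_2,\xi_1)$ for $\xi=(\xi_1,\xi_2)\in\mathbb R^2$, and set $$G(\xi)=\frac1{4\pi}e^{-|\xi|^2/4},\qquad v^G(\xi)=\frac1{2\pi}\frac{\xi^\perp}{|\xi|^2}\bigl(1-e^{-|\xi|^2/4}\bigr)\quad(v^G(0)=0).$$ Let $Y=\{w\in L^2(\mathbb R^2)\,:\,\int_{\mathbb R^2}|w(\xi)|^2e^{|\xi|^2/4}\,d\xi<\infty\}$ (real-valued functions), and for $n\in\mathbb N$ let $Y_n=P_nY$, where $P_n$ is the orthogonal projection given in polar coordinates by $$(P_nw)(r\cos\theta,r\sin\theta)=\frac{2-\delta_{n,0}}{2\pi}\int_0^{2\pi}w(r\cos\theta',r\sin\theta')\cos(n(\theta-\theta'))\,d\theta'.$$ Let $Z$ be the set of all $w:\mathbb R^2\to\mathbb R$ such that $e^{|\xi|^2/8}w$ belongs to the Schwartz space $\mathcal S(\mathbb R^2)$. For $w\in D(\Lambda)=\{w\in Y: v^G\cdot\nabla w\in Y\}$ let $$\Lambda w=v^G\cdot\nabla w+v\cdot\nabla G,\qquad v(\xi)=\frac1{2\pi}\int_{\mathbb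 R^2}\frac{(\xi-\eta)^\perp}{|\xi-\eta|^2}\,w(\eta)\,d\eta .$$ For $r>0$ let $$g(r)=\frac1{4\pi}e^{-r^2/4},\qquad \phi(r)=\frac1{2\pi r^2}\bigl(1-e^{-r^2/4}\bigr),\qquad h(r)=\frac{g(r)}{2\phi(r)}=\frac{r^2/4}{e^{r^2/4}-1}.$$ **Lemma.** If $z\in Y_n\cap Z$ for some $n\ge2$, there exists a unique $w\in Y_n\cap Z$ such that $\Lambda w=z$. In particular, if $z=a(r)\sin(n\theta)$, then $w=-\omega(r)\cos(n\theta)$, where $$\omega(r)=h(r)\,\Omega(r)+\frac{a(r)}{n\,\phi(r)},\qquad r>0,$$ and $\Omega:(0,\infty)\to\mathbb R$ is the unique solution of the differential equation $$-\frac1r\bigl(r\,\Omega'(r)\bigr)'+\Bigl(\frac{n^2}{r^2}-h(r)\Bigr)\Omega(r)=\frac{a(r)}{n\,\phi(r)},\qquad r>0,$$ such that $\Omega(r)=\mathcal O(r^n)$ as $r\to0$ and $\Omega(r)=\mathcal O(r^{-n})$ as $r\to\infty$. -/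

import Mathlib

open Filter Topology MeasureTheory Asymptotics
open scoped SchwartzMap

namespace OseenVortex

noncomputable section

/-- The Euclidean plane. -/
abbrev Plane : Type := EuclideanSpace ℝ (Fin 2)

/-- The rotated vector `x^⊥ = (-x₂, x₁)`. -/
def perp (x : Plane) : Plane := !₂[-(x 1), x 0]

/-- The point with polar coordinates `(r, θ)`. -/
def polar (r θ : ℝ) : Plane := !₂[r * Real.cos θ, r * Real.sin θ]

/-- A polar angle of `ξ` (the principal one; its value at the origin is irrelevant). -/
def angle (ξ : Plane) : ℝ := Complex.arg ⟨ξ 0, ξ 1⟩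

/-- The Gaussian vorticity profile `G(ξ) = (1/4π) exp(-|ξ|²/4)`. -/
def G (ξ : Plane) : ℝ := 1 / (4 * Real.pi) * Real.exp (-‖ξ‖ ^ 2 / 4)

/-- The velocity field of the Oseen vortex,
`v^G(ξ) = (1/2π) (ξ^⊥/|ξ|²) (1 - exp(-|ξ|²/4))`; at the origin this evaluates to `0`,
which is the continuous extension. -/
def vG (ξ : Plane) : Plane :=
  (1 / (2 * Real.pi) * (1 - Real.exp (-‖ξ‖ ^ 2 / 4)) / ‖ξ‖ ^ 2) • perp ξ

/-- The velocity field obtained from the vorticity `w` by the two-dimensional Biot-Savart law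
`v(x) = (1/2π) ∫ (x - y)^⊥ / |x - y|² w(y) dy`. -/
def biotSavart (w : Plane → ℝ) (x : Plane) : Plane :=
  (1 / (2 * Real.pi)) • ∫ y : Plane, (w y / ‖x - y‖ ^ 2) • perp (x - y)

/-- The weighted space `Y` of all `w ∈ L²(ℝ²)` with `∫ |w(ξ)|² exp(|ξ|²/4) dξ < ∞`
(its elements are represented by functions). -/
def Y : Set (Plane → ℝ) :=
  {w | MemLp w 2 volume ∧
    Integrable (fun ξ : Plane => |w ξ| ^ 2 * Real.exp (‖ξ‖ ^ 2 / 4)) volume}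

/-- The angular projection `P_n`, in polar coordinates
`(P_n w)(r, θ) = (2 - δ_{n,0})/(2π) ∫_0^{2π} w(r, θ') cos(n(θ - θ')) dθ'`. -/
def angularProj (n : ℕ) (w : Plane → ℝ) (ξ : Plane) : ℝ :=
  (if n = 0 then 1 else 2) / (2 * Real.pi) *
    ∫ t in (0 : ℝ)..(2 * Real.pi), w (polar ‖ξ‖ t) * Real.cos (n * (angle ξ - t))

/-- The subspace `Y_n = P_n Y`: the range of the projection `P_n` in `Y`, that is, the elements
of `Y` that are fixed by `P_n` (as classes modulo null sets). -/
def Yn (n : ℕ) : Set (Plane → ℝ) := {w | w ∈ Y ∧ angularProj n w =ᵐ[volume] w}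

/-- The space `Z` of all `w : ℝ² → ℝ` such that `exp(|ξ|²/8) w` is a Schwartz function. -/
def Z : Set (Plane → ℝ) :=
  {w | ∃ f : 𝓢(Plane, ℝ), ∀ ξ, f ξ = Real.exp (‖ξ‖ ^ 2 / 8) * w ξ}

/-- The derivative `u · ∇ w` of `w` along the vector field `u` (for differentiable `w`). -/
def advect (u : Plane → Plane) (w : Plane → ℝ) (ξ : Plane) : ℝ := fderiv ℝ w ξ (u ξ)

/-- The continuously differentiable elements of the domain
`D(Λ) = {w ∈ Y | v^G · ∇ w ∈ Y}`. -/
def LamDomain : Set (Plane → ℝ) := {w | w ∈ Y ∧ ContDiff ℝ 1 w ∧ advect vG w ∈ Y}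

/-- The operator `Λ w = v^G · ∇ w + v · ∇ G`, with `v` the Biot-Savart velocity field of `w`
(for continuously differentiable `w`). -/
def Lam (w : Plane → ℝ) (ξ : Plane) : ℝ := advect vG w ξ + advect (biotSavart w) G ξ

/-- `g(r) = (1/4π) exp(-r²/4)`. -/
def g (r : ℝ) : ℝ := 1 / (4 * Real.pi) * Real.exp (-r ^ 2 / 4)

/-- `φ(r) = (1 - exp(-r²/4)) / (2π r²)`, used for `r > 0`. -/
def phi (r : ℝ) : ℝ := 1 / (2 * Real.pi * r ^ 2) * (1 - Real.exp (-r ^ 2 / 4))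

/-- `h(r) = g(r) / (2 φ(r))`, used for `r > 0`. -/
def h (r : ℝ) : ℝ := g r / (2 * phi r)

/-- `Ω` is a (classical, twice differentiable) solution on `(0, ∞)` of
`-(1/r) (r Ω')' + (n²/r² - h) Ω = a / (n φ)`
with `Ω(r) = O(r^n)` as `r → 0` and `Ω(r) = O(r^{-n})` as `r → ∞`. -/
structure IsRadialSolution (n : ℕ) (a Ω : ℝ → ℝ) : Prop where
  diff : ∀ r : ℝ, 0 < r → DifferentiableAt ℝ Ω r
  diff_two : ∀ r : ℝ, 0 < r → DifferentiableAt ℝ (deriv Ω) r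
  eqn : ∀ r : ℝ, 0 < r →
    -(1 / r) * deriv (fun s : ℝ => s * deriv Ω s) r + ((n : ℝ) ^ 2 / r ^ 2 - h r) * Ω r
      = a r / (n * phi r)
  bound_zero : Ω =O[𝓝[>] (0 : ℝ)] (fun r : ℝ => r ^ n)
  bound_infty : Ω =O[atTop] (fun r : ℝ => (r ^ n)⁻¹)

end

end OseenVortex

open OseenVortex

/-! In angular frequency `n` the equation is one-dimensional. A continuous function fixed by the
projection has the form `Re (W(r) e^{inθ})` with complex amplitude `W = amp n w`. Its velocity has
the stream function `ψ = Re (Ψ(r) e^{inθ})`, where `Ψ = radPot n W` is the decaying solution of `Ψ''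
+ Ψ'/r - n²Ψ/r² = W` (`hasFDerivAt_stream`). As `v^G` is angular and `G` is radial, `Λ w = φ ∂_θ w +
(G/2) ∂_θ ψ`. If `A` denotes the amplitude of `z`, then `Λ w = z` says exactly `W = -(hΨ + iA/(nφ))`
(`Lam_eq_iff`), that is, `-Ψ'' - Ψ'/r + (n²/r² - h)Ψ = iA/(nφ)`.

Everything rests on `r² h(r) ≤ 16/5 < 4 ≤ n²` (`sq_mul_hReg_le`). It makes the integrated equation a
contraction on bounded continuous functions, which gives existence (`exists_radial_fixedPoint`). It
also makes `n²/r² - h` positive, so that the maximum principle gives uniqueness among solutions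
vanishing at both ends (`SolvesRadial.eq`).

Smoothness comes from a bootstrap (`exists_Lam_eq`): with `f` the source, `w = -(hψ + f)` is as
regular as `ψ`, while `∇ψ` is a Cauchy transform of `w`, so `ψ` has one derivative more than `w`.
The Gaussian factor in `h` absorbs the weight `e^{|ξ|²/8}`. The rate `O(r^n)` at the origin comes
from the vanishing of high Fourier modes of smooth functions (`norm_amp_le`), the rate `O(r^{-n})`
at infinity from finite moments of `W`. For sine data the radial equation is real, hence so are `Ψ`
and `W`. -/

open Filter Topology MeasureTheory Asymptotics
open scoped SchwartzMap ContDiff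
namespace OseenVortex
noncomputable section

/-! ### Calculus of functions of polynomial growth and of rapid decay, to finite order. -/

section Growth

variable {V F F₁ F₂ : Type*} [NormedAddCommGroup V] [NormedSpace ℝ V]
  [NormedAddCommGroup F] [NormedSpace ℝ F] [NormedAddCommGroup F₁] [NormedSpace ℝ F₁]
  [NormedAddCommGroup F₂] [NormedSpace ℝ F₂]

/-- `f` is `C^k` and its derivatives of order at most `k` grow at most polynomially. -/
def TempGrowth (k : ℕ) (f : V → F) : Prop :=
  ContDiff ℝ k f ∧
    ∃ N : ℕ, ∃ C : ℝ, 0 ≤ C ∧ ∀ j ≤ k, ∀ x, ‖iteratedFDeriv ℝ j f x‖ ≤ C * (1 + ‖x‖) ^ N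

/-- `f` is `C^k` and its derivatives of order at most `k` decay rapidly. -/
def RapidDecay (k : ℕ) (f : V → F) : Prop :=
  ContDiff ℝ k f ∧
    ∀ N : ℕ, ∃ C : ℝ, 0 ≤ C ∧ ∀ j ≤ k, ∀ x, (1 + ‖x‖) ^ N * ‖iteratedFDeriv ℝ j f x‖ ≤ C

/-- Leibniz rule: the degrees add up and `2 ^ k` bounds the sum of the binomial coefficients. The
product and composition rules below are instances of this lemma and of its companion for decay. -/
theorem TempGrowth.bilin {k : ℕ} {f : V → F} {g : V → F₁} (hf : TempGrowth k f)
    (hg : TempGrowth k g) (B : F →L[ℝ] F₁ →L[ℝ] F₂) :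
    TempGrowth k (fun x => B (f x) (g x)) := by
  obtain ⟨hf, N, C, hC, hN⟩ := hf
  obtain ⟨hg, M, D, hD, hM⟩ := hg
  refine ⟨(B.isBoundedBilinearMap.contDiff (n := k)).comp (hf.prodMk hg), N + M,
    ‖B‖ * (2 ^ k * (C * D)), by positivity, fun j hj x => ?_⟩
  refine (B.norm_iteratedFDeriv_le_of_bilinear hf hg x (by exact_mod_cast hj)).trans ?_
  rw [mul_assoc]
  gcongr
  calc _ ≤ ∑ i ∈ Finset.range (j + 1), (j.choose i : ℝ) * (C * D * (1 + ‖x‖) ^ (N + M)) := by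
        refine Finset.sum_le_sum fun i hi => ?_
        have h1 := hN i (by simp at hi; omega) x
        have h2 := hM (j - i) (by omega) x
        rw [mul_assoc]
        refine mul_le_mul_of_nonneg_left ?_ (by positivity)
        calc _ ≤ (C * (1 + ‖x‖) ^ N) * (D * (1 + ‖x‖) ^ M) := by gcongr
          _ = _ := by ring
    _ = 2 ^ j * (C * D * (1 + ‖x‖) ^ (N + M)) := by
        rw [← Finset.sum_mul]
        congr 1
        exact_mod_cast Nat.sum_range_choose j
    _ ≤ _ := by
        rw [← mul_assoc]
        gcongr
        norm_num

theorem RapidDecay.bilin {k : ℕ} {f : V → F} {g : V → F₁} (hf : RapidDecay k f)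
    (hg : TempGrowth k g) (B : F →L[ℝ] F₁ →L[ℝ] F₂) :
    RapidDecay k (fun x => B (f x) (g x)) := by
  obtain ⟨hf, hN⟩ := hf
  obtain ⟨hg, M, D, hD, hM⟩ := hg
  refine ⟨(B.isBoundedBilinearMap.contDiff (n := k)).comp (hf.prodMk hg), fun N => ?_⟩
  -- `M` extra powers of decay of `f` pay for the growth of `g`.
  obtain ⟨C, hC, hN⟩ := hN (N + M)
  refine ⟨‖B‖ * (2 ^ k * (C * D)), by positivity, fun j hj x => ?_⟩
  refine (mul_le_mul_of_nonneg_left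
    (B.norm_iteratedFDeriv_le_of_bilinear hf hg x (by exact_mod_cast hj))
    (by positivity)).trans ?_
  rw [mul_left_comm]
  refine mul_le_mul_of_nonneg_left ?_ (by positivity)
  rw [Finset.mul_sum]
  calc _ ≤ ∑ i ∈ Finset.range (j + 1), (j.choose i : ℝ) * (C * D) := by
        refine Finset.sum_le_sum fun i hi => ?_
        have h1 := hN i (by simp at hi; omega) x
        have h2 := hM (j - i) (by omega) x
        rw [mul_assoc, mul_left_comm]
        refine mul_le_mul_of_nonneg_left ?_ (by positivity)
        calc (1 + ‖x‖) ^ N * (‖iteratedFDeriv ℝ i f x‖ * ‖iteratedFDeriv ℝ (j - i) g x‖)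
            ≤ (1 + ‖x‖) ^ N * (‖iteratedFDeriv ℝ i f x‖ * (D * (1 + ‖x‖) ^ M)) := by gcongr
          _ = ((1 + ‖x‖) ^ (N + M) * ‖iteratedFDeriv ℝ i f x‖) * D := by ring
          _ ≤ C * D := by gcongr
    _ = 2 ^ j * (C * D) := by
        rw [← Finset.sum_mul]
        congr 1
        exact_mod_cast Nat.sum_range_choose j
    _ ≤ _ := by
        gcongr
        norm_num

theorem RapidDecay.tempGrowth {k : ℕ} {f : V → F} (hf : RapidDecay k f) : TempGrowth k f := by
  obtain ⟨C, hC, h⟩ := hf.2 0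
  exact ⟨hf.1, 0, C, hC, fun j hj x => by simpa using h j hj x⟩

theorem RapidDecay.mono {k l : ℕ} {f : V → F} (hf : RapidDecay k f) (h : l ≤ k) :
    RapidDecay l f := by
  refine ⟨hf.1.of_le (by exact_mod_cast h), fun N => ?_⟩
  obtain ⟨C, hC, hN⟩ := hf.2 N
  exact ⟨C, hC, fun j hj => hN j (hj.trans h)⟩

theorem tempGrowth_zero_iff {f : V → F} : TempGrowth 0 f ↔
    Continuous f ∧ ∃ N : ℕ, ∃ C : ℝ, 0 ≤ C ∧ ∀ x, ‖f x‖ ≤ C * (1 + ‖x‖) ^ N := by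
  simp [TempGrowth]

theorem rapidDecay_zero_iff {f : V → F} : RapidDecay 0 f ↔
    Continuous f ∧ ∀ N : ℕ, ∃ C : ℝ, 0 ≤ C ∧ ∀ x, (1 + ‖x‖) ^ N * ‖f x‖ ≤ C := by
  simp [RapidDecay]

/-- Raises the order by one from control of the derivative; the inductions on the order rely on it.
-/
theorem TempGrowth.succ {k : ℕ} {f : V → F} (h₀ : TempGrowth 0 f) (hd : Differentiable ℝ f)
    (hf : TempGrowth k (fderiv ℝ f)) : TempGrowth (k + 1) f := by
  obtain ⟨N, C, hC, hN⟩ := (tempGrowth_zero_iff.1 h₀).2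
  obtain ⟨hf, M, D, hD, hM⟩ := hf
  -- The middle condition concerns only the analytic exponent `ω`, which is not a natural number.
  refine ⟨contDiff_succ_iff_fderiv.2 ⟨hd, fun h => (WithTop.natCast_ne_top k h).elim, by exact_mod_cast hf⟩, N + M, C + D,
    by positivity, ?_⟩
  have h1 : ∀ x : V, 1 ≤ 1 + ‖x‖ := fun x => by linarith [norm_nonneg x]
  rintro (_ | j) hj x
  · rw [norm_iteratedFDeriv_zero]
    refine (hN x).trans ?_
    gcongr
    · linarith
    · exact h1 x
    · omega
  · rw [← norm_iteratedFDeriv_fderiv]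
    refine (hM j (by omega) x).trans ?_
    gcongr
    · linarith
    · exact h1 x
    · omega

theorem RapidDecay.succ {k : ℕ} {f : V → F} (h₀ : RapidDecay 0 f) (hd : Differentiable ℝ f)
    (hf : RapidDecay k (fderiv ℝ f)) : RapidDecay (k + 1) f := by
  refine ⟨contDiff_succ_iff_fderiv.2 ⟨hd, fun h => (WithTop.natCast_ne_top k h).elim, by exact_mod_cast hf.1⟩, fun N => ?_⟩
  obtain ⟨C, hC, hN⟩ := (rapidDecay_zero_iff.1 h₀).2 N
  obtain ⟨D, hD, hM⟩ := hf.2 N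
  refine ⟨C + D, by positivity, ?_⟩
  rintro (_ | j) hj x
  · rw [norm_iteratedFDeriv_zero]
    linarith [hN x]
  · rw [← norm_iteratedFDeriv_fderiv]
    linarith [hM j (by omega) x]

theorem RapidDecay.fderiv {k : ℕ} {f : V → F} (hf : RapidDecay (k + 1) f) :
    RapidDecay k (_root_.fderiv ℝ f) := by
  refine ⟨hf.1.fderiv_right (by simp), fun N => ?_⟩
  obtain ⟨C, hC, hN⟩ := hf.2 N
  refine ⟨C, hC, fun j hj x => ?_⟩
  rw [norm_iteratedFDeriv_fderiv]
  exact hN (j + 1) (by omega) x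

theorem TempGrowth.fderiv {k : ℕ} {f : V → F} (hf : TempGrowth (k + 1) f) :
    TempGrowth k (_root_.fderiv ℝ f) := by
  obtain ⟨hf, N, C, hC, hN⟩ := hf
  refine ⟨hf.fderiv_right (by simp), N, C, hC, fun j hj x => ?_⟩
  rw [norm_iteratedFDeriv_fderiv]
  exact hN (j + 1) (by omega) x

theorem TempGrowth.const (k : ℕ) (c : F) : TempGrowth k (fun _ : V => c) := by
  refine ⟨contDiff_const, 0, ‖c‖, norm_nonneg _, fun j _ x => ?_⟩
  rcases j with _ | j
  · simp
  · simp [iteratedFDeriv_succ_const]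

theorem TempGrowth.add {k : ℕ} {f g : V → F} (hf : TempGrowth k f) (hg : TempGrowth k g) :
    TempGrowth k (fun x => f x + g x) := by
  obtain ⟨hf, N, C, hC, hN⟩ := hf
  obtain ⟨hg, M, D, hD, hM⟩ := hg
  refine ⟨hf.add hg, N + M, C + D, by positivity, fun j hj x => ?_⟩
  have h1 : 1 ≤ 1 + ‖x‖ := by linarith [norm_nonneg x]
  have hj' : (j : WithTop ℕ∞) ≤ k := by exact_mod_cast hj
  have e : iteratedFDeriv ℝ j (fun x => f x + g x) x
      = iteratedFDeriv ℝ j f x + iteratedFDeriv ℝ j g x :=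
    iteratedFDeriv_add_apply (hf.of_le hj').contDiffAt (hg.of_le hj').contDiffAt
  rw [e, add_mul]
  refine (norm_add_le _ _).trans (add_le_add ((hN j hj x).trans ?_) ((hM j hj x).trans ?_))
  · gcongr
    omega
  · gcongr
    omega

theorem RapidDecay.add {k : ℕ} {f g : V → F} (hf : RapidDecay k f) (hg : RapidDecay k g) :
    RapidDecay k (fun x => f x + g x) := by
  refine ⟨hf.1.add hg.1, fun N => ?_⟩
  obtain ⟨C, hC, hN⟩ := hf.2 N
  obtain ⟨D, hD, hM⟩ := hg.2 N
  refine ⟨C + D, by positivity, fun j hj x => ?_⟩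
  have hj' : (j : WithTop ℕ∞) ≤ k := by exact_mod_cast hj
  have e : iteratedFDeriv ℝ j (fun x => f x + g x) x
      = iteratedFDeriv ℝ j f x + iteratedFDeriv ℝ j g x :=
    iteratedFDeriv_add_apply (hf.1.of_le hj').contDiffAt (hg.1.of_le hj').contDiffAt
  rw [e]
  calc _ ≤ (1 + ‖x‖) ^ N * (‖iteratedFDeriv ℝ j f x‖ + ‖iteratedFDeriv ℝ j g x‖) := by
        gcongr
        exact norm_add_le _ _
    _ ≤ _ := by
        rw [mul_add]
        exact add_le_add (hN j hj x) (hM j hj x)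

theorem TempGrowth.clm_comp {k : ℕ} {f : V → F} (hf : TempGrowth k f) (L : F →L[ℝ] F₁) :
    TempGrowth k (fun x => L (f x)) :=
  (TempGrowth.const k L).bilin hf (ContinuousLinearMap.id ℝ (F →L[ℝ] F₁))

theorem RapidDecay.clm_comp {k : ℕ} {f : V → F} (hf : RapidDecay k f) (L : F →L[ℝ] F₁) :
    RapidDecay k (fun x => L (f x)) :=
  hf.bilin (TempGrowth.const k L) (ContinuousLinearMap.id ℝ (F →L[ℝ] F₁)).flip

theorem TempGrowth.mul {k : ℕ} {f g : V → ℝ} (hf : TempGrowth k f) (hg : TempGrowth k g) :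
    TempGrowth k (fun x => f x * g x) :=
  hf.bilin hg (ContinuousLinearMap.mul ℝ ℝ)

theorem RapidDecay.mul {k : ℕ} {f g : V → ℝ} (hf : RapidDecay k f) (hg : TempGrowth k g) :
    RapidDecay k (fun x => f x * g x) :=
  hf.bilin hg (ContinuousLinearMap.mul ℝ ℝ)

theorem TempGrowth.smul {k : ℕ} {f : V → ℝ} {g : V → F} (hf : TempGrowth k f)
    (hg : TempGrowth k g) : TempGrowth k (fun x => f x • g x) :=
  hf.bilin hg (ContinuousLinearMap.lsmul ℝ ℝ)

theorem RapidDecay.smul {k : ℕ} {f : V → ℝ} {g : V → F} (hf : RapidDecay k f)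
    (hg : TempGrowth k g) : RapidDecay k (fun x => f x • g x) :=
  hf.bilin hg (ContinuousLinearMap.lsmul ℝ ℝ)

theorem tempGrowth_clm (k : ℕ) (L : V →L[ℝ] F) : TempGrowth k (fun x => L x) := by
  have h₀ : TempGrowth 0 (fun x => L x) := by
    refine tempGrowth_zero_iff.2 ⟨L.continuous, 1, ‖L‖, norm_nonneg _, fun x => ?_⟩
    refine (L.le_opNorm x).trans ?_
    rw [pow_one]
    gcongr
    linarith
  rcases k with _ | k
  · exact h₀
  · refine TempGrowth.succ h₀ L.differentiable ?_
    have : _root_.fderiv ℝ (fun x => L x) = fun _ => L := by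
      ext1 x
      exact L.fderiv
    rw [this]
    exact TempGrowth.const k L

/-- The reciprocal of a function of temperate growth that is bounded below by an inverse
power has temperate growth. -/
theorem TempGrowth.inv {q : V → ℝ} (hq : ∀ k, TempGrowth k q) (hpos : ∀ x, 0 < q x)
    {N : ℕ} {C : ℝ} (hlow : ∀ x, (q x)⁻¹ ≤ C * (1 + ‖x‖) ^ N) (k : ℕ) :
    TempGrowth k (fun x => (q x)⁻¹) := by
  have h₀ : TempGrowth 0 (fun x => (q x)⁻¹) := by
    refine tempGrowth_zero_iff.2 ⟨(hq 0).1.continuous.inv₀ fun x => (hpos x).ne', N, |C|,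
      abs_nonneg _, fun x => ?_⟩
    rw [Real.norm_of_nonneg (inv_nonneg.2 (hpos x).le)]
    refine (hlow x).trans ?_
    gcongr
    exact le_abs_self C
  have hd : Differentiable ℝ q := (hq 1).1.differentiable (by simp)
  induction k with
  | zero => exact h₀
  | succ k ih =>
    refine TempGrowth.succ h₀ (hd.inv fun x => (hpos x).ne') ?_
    -- The derivative `-q⁻² dq` involves `q⁻¹` itself only to order `k`, so the induction closes.
    have : _root_.fderiv ℝ (fun x => (q x)⁻¹)
        = fun x => (-1 : ℝ) • (((q x)⁻¹ * (q x)⁻¹) • _root_.fderiv ℝ q x) := by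
      ext1 x
      have h1 := (hasDerivAt_inv (hpos x).ne').comp_hasFDerivAt x (hd x).hasFDerivAt
      simp only [Function.comp_def] at h1
      rw [h1.fderiv]
      ext u
      simp only [smul_apply, smul_eq_mul]
      ring
    rw [this]
    exact (TempGrowth.const k _).smul ((ih.mul ih).smul (hq (k + 1)).fderiv)

theorem RapidDecay.of_schwartz (f : 𝓢(V, F)) (k : ℕ) : RapidDecay k f := by
  refine ⟨f.smooth k, fun N => ?_⟩
  obtain ⟨C, hC⟩ : ∃ C, ∀ j ≤ k, ∀ x, (1 + ‖x‖) ^ N * ‖iteratedFDeriv ℝ j f x‖ ≤ C := by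
    exact ⟨_, fun j hj x => SchwartzMap.one_add_le_sup_seminorm_apply (𝕜 := ℝ) (m := (N, k))
      le_rfl hj f x⟩
  exact ⟨|C|, abs_nonneg _, fun j hj x => (hC j hj x).trans (le_abs_self _)⟩

/-- A function all of whose derivatives decay rapidly, as a Schwartz function. -/
def schwartzOfRapidDecay (f : V → F) (hf : ∀ k, RapidDecay k f) : 𝓢(V, F) where
  toFun := f
  smooth' := contDiff_infty.2 fun k => (hf k).1
  decay' N k := by
    obtain ⟨C, _, h⟩ := (hf k).2 N
    refine ⟨C, fun x => le_trans ?_ (h k le_rfl x)⟩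
    gcongr
    linarith [norm_nonneg x]

theorem tempGrowth_norm_sq {H : Type*} [NormedAddCommGroup H] [InnerProductSpace ℝ H] (k : ℕ) :
    TempGrowth k (fun x : H => ‖x‖ ^ 2) := by
  have : (fun x : H => ‖x‖ ^ 2) = fun x : H => innerSL ℝ x x := by
    ext x
    simp
  rw [this]
  exact (tempGrowth_clm k (ContinuousLinearMap.id ℝ H)).bilin
    (tempGrowth_clm k (ContinuousLinearMap.id ℝ H)) (innerSL ℝ)

/-- Gaussians decay rapidly. -/
theorem rapidDecay_exp {H : Type*} [NormedAddCommGroup H] [InnerProductSpace ℝ H]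
    {c : ℝ} (hc : 0 < c) (k : ℕ) : RapidDecay k (fun x : H => Real.exp (-(c * ‖x‖ ^ 2))) := by
  have h₀ : RapidDecay 0 (fun x : H => Real.exp (-(c * ‖x‖ ^ 2))) := by
    refine rapidDecay_zero_iff.2 ⟨by fun_prop, fun N => ?_⟩
    refine ⟨N.factorial * Real.exp (1 + 1 / (4 * c)), by positivity, fun x => ?_⟩
    rw [Real.norm_of_nonneg (Real.exp_pos _).le]
    have h1 : (1 + ‖x‖) ^ N / N.factorial ≤ Real.exp (1 + ‖x‖) :=
      Real.pow_div_factorial_le_exp _ (by positivity) _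
    rw [div_le_iff₀ (by positivity)] at h1
    -- Completing the square in `‖x‖` gives the constant.
    have h2 : 1 + ‖x‖ - c * ‖x‖ ^ 2 ≤ 1 + 1 / (4 * c) := by
      have : 0 ≤ c * (‖x‖ - 1 / (2 * c)) ^ 2 := by positivity
      have e : c * (‖x‖ - 1 / (2 * c)) ^ 2 = c * ‖x‖ ^ 2 - ‖x‖ + 1 / (4 * c) := by
        field_simp
        ring
      linarith
    calc _ ≤ Real.exp (1 + ‖x‖) * N.factorial * Real.exp (-(c * ‖x‖ ^ 2)) := by gcongr
      _ = N.factorial * Real.exp (1 + ‖x‖ - c * ‖x‖ ^ 2) := by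
          rw [sub_eq_add_neg, Real.exp_add (1 + ‖x‖)]
          ring
      _ ≤ _ := by gcongr
  induction k with
  | zero => exact h₀
  | succ k ih =>
    have hd : Differentiable ℝ (fun x : H => Real.exp (-(c * ‖x‖ ^ 2))) := by
      have : Differentiable ℝ (fun x : H => ‖x‖ ^ 2) :=
        (tempGrowth_norm_sq 1).1.differentiable (by simp)
      fun_prop
    refine RapidDecay.succ h₀ hd ?_
    have : _root_.fderiv ℝ (fun x : H => Real.exp (-(c * ‖x‖ ^ 2)))
        = fun x => Real.exp (-(c * ‖x‖ ^ 2)) • ((-(2 * c)) • innerSL ℝ x) := by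
      ext1 x
      have h1 : HasFDerivAt (fun x : H => ‖x‖ ^ 2) (2 • innerSL ℝ x) x :=
        (hasStrictFDerivAt_norm_sq x).hasFDerivAt
      have h2 := (h1.const_mul c).neg.exp
      simp only [Pi.neg_apply] at h2
      rw [h2.fderiv]
      ext u
      simp
      ring
    rw [this]
    exact ih.smul ((TempGrowth.const k _).smul (tempGrowth_clm k (innerSL ℝ)))

end Growth

/-! ### Convolution with kernels bounded by `1/|y|`. -/

section Convolution

variable {F : Type*} [NormedAddCommGroup F] [NormedSpace ℝ F]

/-- The polar Jacobian `r` cancels the singularity and leaves `(1 + r)^{-2}`. This function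
dominates all kernel integrals below. -/
theorem integrable_inv_norm_mul :
    Integrable (fun y : Plane => ‖y‖⁻¹ * ((1 + ‖y‖) ^ 2)⁻¹) := by
  have h := integrable_fun_norm_addHaar (volume : Measure Plane)
    (f := fun r : ℝ => r⁻¹ * ((1 + r) ^ 2)⁻¹)
  refine h.2 ?_
  have h1 : Integrable (fun r : ℝ => (1 + ‖r‖) ^ (-2 : ℝ)) :=
    integrable_one_add_norm (by simp)
  refine (h1.integrableOn (s := Set.Ioi 0)).congr_fun (fun r hr => ?_) measurableSet_Ioi
  have hr : 0 < r := hr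
  simp only [finrank_euclideanSpace, Fintype.card_fin, smul_eq_mul, Real.norm_of_nonneg hr.le]
  rw [Real.rpow_neg (by positivity)]
  norm_cast
  field_simp
  norm_num

/-- A measurable kernel on the plane that is bounded by `1 / |y|`. -/
structure IsNewtonKernel (κ : Plane → ℝ) : Prop where
  measurable : Measurable κ
  bound : ∀ y, ‖κ y‖ ≤ ‖y‖⁻¹

/-- The convolution of a scalar kernel with a vector-valued function. -/
def kernelConv (κ : Plane → ℝ) (w : Plane → F) (x : Plane) : F := ∫ y, κ y • w (x - y)

/-- The inequality `1 + |y| ≤ (1 + |x - y|)(1 + |x|)` separates the variables, so a single function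
of `y` dominates for all `x` in a bounded set. -/
theorem RapidDecay.exists_bound {w : Plane → F} (hw : RapidDecay 0 w) :
    ∃ C : ℝ, 0 ≤ C ∧ ∀ x y, ‖w (x - y)‖ ≤ C * (1 + ‖x‖) ^ 2 * ((1 + ‖y‖) ^ 2)⁻¹ := by
  obtain ⟨C, hC, h⟩ := (rapidDecay_zero_iff.1 hw).2 2
  refine ⟨C, hC, fun x y => ?_⟩
  rw [← div_eq_mul_inv, le_div_iff₀ (by positivity)]
  have h1 : 1 + ‖y‖ ≤ (1 + ‖x - y‖) * (1 + ‖x‖) := by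
    have : ‖y‖ ≤ ‖x - y‖ + ‖x‖ := by
      calc ‖y‖ = ‖x - (x - y)‖ := by simp
        _ ≤ ‖x‖ + ‖x - y‖ := norm_sub_le _ _
        _ = _ := add_comm _ _
    nlinarith [norm_nonneg x, norm_nonneg (x - y)]
  calc ‖w (x - y)‖ * (1 + ‖y‖) ^ 2 ≤ ‖w (x - y)‖ * ((1 + ‖x - y‖) * (1 + ‖x‖)) ^ 2 := by gcongr
    _ = (1 + ‖x - y‖) ^ 2 * ‖w (x - y)‖ * (1 + ‖x‖) ^ 2 := by ring
    _ ≤ C * (1 + ‖x‖) ^ 2 := by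
      gcongr
      exact h _

variable {κ : Plane → ℝ} (hκ : IsNewtonKernel κ)
include hκ

theorem IsNewtonKernel.norm_smul_le {w : Plane → F} {C : ℝ} {x y : Plane}
    (h : ‖w (x - y)‖ ≤ C * (1 + ‖x‖) ^ 2 * ((1 + ‖y‖) ^ 2)⁻¹) :
    ‖κ y • w (x - y)‖ ≤ C * (1 + ‖x‖) ^ 2 * (‖y‖⁻¹ * ((1 + ‖y‖) ^ 2)⁻¹) := by
  rw [norm_smul]
  calc _ ≤ ‖y‖⁻¹ * (C * (1 + ‖x‖) ^ 2 * ((1 + ‖y‖) ^ 2)⁻¹) :=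
        mul_le_mul (hκ.bound y) h (norm_nonneg _) (by positivity)
    _ = _ := by ring

theorem IsNewtonKernel.aestronglyMeasurable {w : Plane → F} (hw : Continuous w) (x : Plane) :
    AEStronglyMeasurable (fun y => κ y • w (x - y)) := by
  refine hκ.measurable.aestronglyMeasurable.smul ?_
  exact (hw.comp (continuous_const.sub continuous_id)).aestronglyMeasurable

theorem IsNewtonKernel.integrable {w : Plane → F} (hw : RapidDecay 0 w) (x : Plane) :
    Integrable (fun y => κ y • w (x - y)) := by
  obtain ⟨C, hC, h⟩ := hw.exists_bound
  exact (integrable_inv_norm_mul.const_mul (C * (1 + ‖x‖) ^ 2)).mono'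
    (hκ.aestronglyMeasurable hw.1.continuous x)
    (Eventually.of_forall fun y => hκ.norm_smul_le (h x y))

theorem IsNewtonKernel.tempGrowth_zero {w : Plane → F} (hw : RapidDecay 0 w) :
    TempGrowth 0 (kernelConv κ w) := by
  obtain ⟨C, hC, h⟩ := hw.exists_bound
  have hwc := hw.1.continuous
  refine tempGrowth_zero_iff.2 ⟨?_, 2, C * ∫ y : Plane, ‖y‖⁻¹ * ((1 + ‖y‖) ^ 2)⁻¹,
    mul_nonneg hC (integral_nonneg fun y => by positivity), fun x => ?_⟩
  · refine continuous_iff_continuousAt.2 fun x₀ => ?_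
    refine continuousAt_of_dominated
      (bound := fun y => C * (1 + (‖x₀‖ + 1)) ^ 2 * (‖y‖⁻¹ * ((1 + ‖y‖) ^ 2)⁻¹))
      (Eventually.of_forall fun x => hκ.aestronglyMeasurable hwc x) ?_
      (integrable_inv_norm_mul.const_mul _) ?_
    · filter_upwards [Metric.ball_mem_nhds x₀ one_pos] with x hx
      refine Eventually.of_forall fun y => (hκ.norm_smul_le (h x y)).trans ?_
      have : ‖x‖ ≤ ‖x₀‖ + 1 := by
        have := norm_le_norm_add_norm_sub' x x₀
        rw [← dist_eq_norm] at this
        linarith [Metric.mem_ball.1 hx]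
      gcongr
    · refine Eventually.of_forall fun y => Continuous.continuousAt ?_
      exact continuous_const.smul (hwc.comp (continuous_id.sub continuous_const))
  · calc _ ≤ ∫ y : Plane, C * (1 + ‖x‖) ^ 2 * (‖y‖⁻¹ * ((1 + ‖y‖) ^ 2)⁻¹) :=
          norm_integral_le_of_norm_le (integrable_inv_norm_mul.const_mul _)
            (Eventually.of_forall fun y => hκ.norm_smul_le (h x y))
      _ = _ := by
          rw [integral_const_mul]
          ring

/-- The derivative falls on `w`; the kernel need only be measurable. -/
theorem IsNewtonKernel.hasFDerivAt {w : Plane → F} (hw : RapidDecay 1 w) (x₀ : Plane) :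
    HasFDerivAt (kernelConv κ w) (kernelConv κ (fderiv ℝ w) x₀) x₀ := by
  have hw' : RapidDecay 0 (fderiv ℝ w) := RapidDecay.fderiv hw
  obtain ⟨C, hC, h⟩ := hw'.exists_bound
  have hwc := hw.1.continuous
  have hd : Differentiable ℝ w := hw.1.differentiable (by simp)
  refine hasFDerivAt_integral_of_dominated_of_fderiv_le
    (bound := fun y => C * (1 + (‖x₀‖ + 1)) ^ 2 * (‖y‖⁻¹ * ((1 + ‖y‖) ^ 2)⁻¹))
    (F' := fun x y => κ y • fderiv ℝ w (x - y))
    (Metric.ball_mem_nhds x₀ one_pos)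
    (Eventually.of_forall fun x => hκ.aestronglyMeasurable hwc x)
    (hκ.integrable (hw.mono (by simp)) x₀)
    (hκ.aestronglyMeasurable hw'.1.continuous x₀) ?_
    (integrable_inv_norm_mul.const_mul _) ?_
  · refine Eventually.of_forall fun y x hx => (hκ.norm_smul_le (h x y)).trans ?_
    have : ‖x‖ ≤ ‖x₀‖ + 1 := by
      have := norm_le_norm_add_norm_sub' x x₀
      rw [← dist_eq_norm] at this
      linarith [Metric.mem_ball.1 hx]
    gcongr
  · refine Eventually.of_forall fun y x _ => ?_
    have := (hd (x - y)).hasFDerivAt.comp x ((hasFDerivAt_id x).sub_const y)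
    exact this.const_smul (κ y)

/-- Convolution with a Newtonian kernel maps rapidly decaying functions to functions of
temperate growth, of the same order of differentiability. -/
theorem IsNewtonKernel.tempGrowth {F : Type} [NormedAddCommGroup F] [NormedSpace ℝ F]
    {w : Plane → F} {k : ℕ} (hw : RapidDecay k w) : TempGrowth k (kernelConv κ w) := by
  induction k generalizing F with
  | zero => exact hκ.tempGrowth_zero hw
  | succ k ih =>
    have hd := fun x => hκ.hasFDerivAt (hw.mono (by omega : 1 ≤ k + 1)) x
    refine TempGrowth.succ (hκ.tempGrowth_zero (hw.mono (by omega)))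
      (fun x => (hd x).differentiableAt) ?_
    have : fderiv ℝ (kernelConv κ w) = kernelConv κ (fderiv ℝ w) := by
      ext1 x
      exact (hd x).fderiv
    rw [this]
    exact ih hw.fderiv

end Convolution

/-! ### The plane as `ℂ`, and integration in polar coordinates. -/

section Polar

open Complex in
/-- The plane as the complex numbers. -/
def toC : Plane ≃ₗᵢ[ℝ] ℂ := Complex.orthonormalBasisOneI.repr.symm

theorem toC_apply (x : Plane) : toC x = x 0 + x 1 * Complex.I :=
  Complex.orthonormalBasisOneI_repr_symm_apply x

theorem toC_re (x : Plane) : (toC x).re = x 0 := by simp [toC_apply]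

theorem toC_im (x : Plane) : (toC x).im = x 1 := by simp [toC_apply]

theorem toC_polar (r θ : ℝ) : toC (polar r θ) = r * Complex.exp (θ * Complex.I) := by
  apply Complex.ext <;> simp [toC_re, toC_im, polar, Complex.exp_ofReal_mul_I_re,
    Complex.exp_ofReal_mul_I_im]

theorem norm_toC (x : Plane) : ‖toC x‖ = ‖x‖ := toC.norm_map x

theorem norm_polar {r : ℝ} (hr : 0 ≤ r) (θ : ℝ) : ‖polar r θ‖ = r := by
  rw [← norm_toC, toC_polar, norm_mul, Complex.norm_exp_ofReal_mul_I]
  simp [abs_of_nonneg hr]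

theorem angle_eq (x : Plane) : angle x = (toC x).arg := by
  rw [angle]
  congr 1
  apply Complex.ext <;> simp [toC_re, toC_im]

theorem polar_norm_angle (x : Plane) : polar ‖x‖ (angle x) = x := by
  apply toC.injective
  rw [toC_polar, angle_eq, ← norm_toC, Complex.norm_mul_exp_arg_mul_I]

theorem toC_symm_polarCoord (p : ℝ × ℝ) :
    toC.symm (Complex.measurableEquivRealProd.symm (polarCoord.symm p)) = polar p.1 p.2 := by
  rw [LinearIsometryEquiv.symm_apply_eq, toC_polar]
  apply Complex.ext <;> simp [Complex.measurableEquivRealProd, Complex.exp_ofReal_mul_I_re,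
    Complex.exp_ofReal_mul_I_im]

variable {E : Type*} [NormedAddCommGroup E] [NormedSpace ℝ E]

theorem measurePreserving_plane :
    MeasurePreserving
      (Complex.measurableEquivRealProd.symm.trans toC.symm.toMeasurableEquiv) := by
  exact (Complex.volume_preserving_equiv_real_prod.symm).trans toC.symm.measurePreserving

theorem integrableOn_polar {f : Plane → E} (hf : Integrable f) :
    IntegrableOn (fun p : ℝ × ℝ => p.1 • f (polar p.1 p.2)) polarCoord.target := by
  set e := Complex.measurableEquivRealProd.symm.trans toC.symm.toMeasurableEquiv
  have h1 : Integrable (f ∘ e) :=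
    (measurePreserving_plane.integrable_comp_emb e.measurableEmbedding).2 hf
  have h2 : IntegrableOn (f ∘ e) (polarCoord.symm '' polarCoord.target) := h1.integrableOn
  rw [integrableOn_image_iff_integrableOn_abs_det_fderiv_smul volume
    polarCoord.open_target.measurableSet
    (fun p _ => (hasFDerivAt_polarCoord_symm p).hasFDerivWithinAt)
    polarCoord.symm.injOn] at h2
  refine h2.congr_fun (fun p hp => ?_) polarCoord.open_target.measurableSet
  have hp1 : 0 < p.1 := hp.1
  simp only [det_fderivPolarCoordSymm, abs_of_pos hp1, Function.comp_apply]
  rw [← toC_symm_polarCoord]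
  rfl

theorem integral_polar {f : Plane → E} (hf : Integrable f) :
    ∫ y, f y = ∫ r in Set.Ioi (0 : ℝ), r • ∫ θ in (-Real.pi)..Real.pi, f (polar r θ) := by
  set e := Complex.measurableEquivRealProd.symm.trans toC.symm.toMeasurableEquiv
  have h1 : ∫ y, f y = ∫ p, f (e p) :=
    (measurePreserving_plane.integral_comp e.measurableEmbedding f).symm
  have h2 := integrableOn_polar hf
  rw [h1, ← integral_comp_polarCoord_symm]
  have h3 : ∫ p in polarCoord.target, p.1 • f (e (polarCoord.symm p))
      = ∫ p in polarCoord.target, p.1 • f (polar p.1 p.2) := by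
    refine setIntegral_congr_fun polarCoord.open_target.measurableSet fun p _ => ?_
    rw [← toC_symm_polarCoord]
    rfl
  rw [h3]
  rw [polarCoord_target] at h2 ⊢
  rw [Measure.volume_eq_prod] at h2 ⊢
  rw [setIntegral_prod _ h2]
  refine setIntegral_congr_fun measurableSet_Ioi fun r _ => ?_
  rw [integral_smul, intervalIntegral.integral_of_le (by linarith [Real.pi_pos]),
    integral_Ioc_eq_integral_Ioo]

theorem integrableOn_radial {f : Plane → E} (hf : Integrable f) :
    IntegrableOn (fun r : ℝ => r • ∫ θ in (-Real.pi)..Real.pi, f (polar r θ)) (Set.Ioi 0) := by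
  have h2 := integrableOn_polar hf
  rw [polarCoord_target, Measure.volume_eq_prod, IntegrableOn, ← Measure.prod_restrict] at h2
  refine h2.integral_prod_left.congr (Eventually.of_forall fun r => ?_)
  simp only
  rw [integral_smul, intervalIntegral.integral_of_le (by linarith [Real.pi_pos]),
    integral_Ioc_eq_integral_Ioo]

end Polar

/-! ### Cauchy integrals over circles. -/

section Angular

open Complex

/-- The Cauchy integral of a monomial over the unit circle, as an integral over angles. -/
theorem integral_exp_div_sub (m : ℕ) {a : ℂ} (ha : ‖a‖ ≠ 1) :
    ∫ θ in (-Real.pi)..Real.pi, exp (θ * I) ^ (m + 1) / (exp (θ * I) - a)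
      = if ‖a‖ < 1 then 2 * Real.pi * a ^ m else 0 := by
  have hper : Function.Periodic (fun θ : ℝ => exp (θ * I) ^ (m + 1) / (exp (θ * I) - a))
      (2 * Real.pi) := by
    intro θ
    have : exp (((θ + 2 * Real.pi : ℝ) : ℂ) * I) = exp (θ * I) := by
      push_cast
      rw [add_mul, exp_add, exp_two_pi_mul_I, mul_one]
    simp only [this]
  have h1 := hper.intervalIntegral_add_eq (-Real.pi) 0
  rw [show -Real.pi + 2 * Real.pi = Real.pi by ring, zero_add] at h1
  rw [h1]
  -- On the unit circle `dz = i z dθ`, which raises the exponent from `m` to `m + 1`.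
  have h2 : (∮ z in C(0, 1), z ^ m / (z - a))
      = I * ∫ θ in (0 : ℝ)..(2 * Real.pi), exp (θ * I) ^ (m + 1) / (exp (θ * I) - a) := by
    rw [circleIntegral, ← intervalIntegral.integral_const_mul]
    congr 1
    ext θ
    simp only [deriv_circleMap, circleMap, ofReal_one, one_mul, zero_add, smul_eq_mul]
    ring
  have hI : ∫ θ in (0 : ℝ)..(2 * Real.pi), exp (θ * I) ^ (m + 1) / (exp (θ * I) - a)
      = -I * ∮ z in C(0, 1), z ^ m / (z - a) := by
    rw [h2, ← mul_assoc]
    simp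
  rw [hI]
  split_ifs with h
  · rw [circleIntegral_div_sub_of_differentiable_on_off_countable Set.countable_empty
      (by simpa using h) (by fun_prop) (fun z _ => by fun_prop)]
    linear_combination (-2 * Real.pi * a ^ m : ℂ) * I_sq
  · have hlt : 1 < ‖a‖ := lt_of_le_of_ne (not_lt.1 h) (Ne.symm ha)
    have hne : ∀ z ∈ Metric.closedBall (0 : ℂ) 1, z - a ≠ 0 := by
      intro z hz h0
      rw [sub_eq_zero] at h0
      subst h0
      simp at hz
      linarith
    rw [circleIntegral_eq_zero_of_differentiable_on_off_countable zero_le_one Set.countable_empty,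
      mul_zero]
    · exact ContinuousOn.div (by fun_prop) (by fun_prop) hne
    · intro z hz
      refine DifferentiableAt.div (by fun_prop) (by fun_prop) (hne z ?_)
      exact Metric.ball_subset_closedBall hz.1

theorem integral_exp_mul_inv_sub {n : ℕ} (hn : 1 ≤ n) {X : ℂ} {s : ℝ} (hs : 0 < s)
    (hX : ‖X‖ ≠ s) :
    ∫ θ in (-Real.pi)..Real.pi, exp (θ * I) ^ n / (X - s * exp (θ * I))
      = if s < ‖X‖ then 0 else -(2 * Real.pi * X ^ (n - 1) / s ^ n) := by
  obtain ⟨m, rfl⟩ : ∃ m, n = m + 1 := ⟨n - 1, by omega⟩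
  have hsC : (s : ℂ) ≠ 0 := by exact_mod_cast hs.ne'
  have hnorm : ‖X / s‖ = ‖X‖ / s := by simp [abs_of_pos hs]
  have ha : ‖X / s‖ ≠ 1 := by
    rw [hnorm]
    intro h
    exact hX (by field_simp at h; exact h)
  have h1 := integral_exp_div_sub m ha
  have h2 : ∀ θ : ℝ, exp (θ * I) ^ (m + 1) / (X - s * exp (θ * I))
      = -(1 / s) * (exp (θ * I) ^ (m + 1) / (exp (θ * I) - X / s)) := by
    intro θ
    rw [show X - s * exp (θ * I) = -s * (exp (θ * I) - X / s) by field_simp; ring]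
    rw [neg_mul, div_neg, neg_mul, div_mul_div_comm, one_mul]
  simp_rw [h2]
  rw [intervalIntegral.integral_const_mul, h1, hnorm]
  simp only [div_lt_one hs, Nat.add_sub_cancel]
  rcases lt_or_gt_of_ne hX with h | h
  · rw [if_pos h, if_neg h.le.not_gt, div_pow]
    field_simp
    ring
  · rw [if_neg h.le.not_gt, if_pos h]
    simp

/-- The reflection `θ ↦ -θ` turns negative powers of `e^{iθ}` into positive ones and moves the pole
from `X / s` to `s / X`. -/
theorem integral_exp_inv_mul_inv_sub (n : ℕ) {X : ℂ} {s : ℝ} (hs : 0 < s)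
    (hX : ‖X‖ ≠ s) :
    ∫ θ in (-Real.pi)..Real.pi, (exp (θ * I) ^ n)⁻¹ / (X - s * exp (θ * I))
      = if s < ‖X‖ then 2 * Real.pi * s ^ n / X ^ (n + 1) else 0 := by
  have hsC : (s : ℂ) ≠ 0 := by exact_mod_cast hs.ne'
  have hneg : ∀ θ : ℝ, exp (((-θ : ℝ) : ℂ) * I) = (exp (θ * I))⁻¹ := by
    intro θ
    rw [← exp_neg]
    push_cast
    ring_nf
  have hflip : ∫ θ in (-Real.pi)..Real.pi, (exp (θ * I) ^ n)⁻¹ / (X - s * exp (θ * I))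
      = ∫ θ in (-Real.pi)..Real.pi, exp (θ * I) ^ (n + 1) / (X * exp (θ * I) - s) := by
    have h := intervalIntegral.integral_comp_neg (a := -Real.pi) (b := Real.pi)
      (fun θ : ℝ => (exp (θ * I) ^ n)⁻¹ / (X - s * exp (θ * I)))
    rw [neg_neg] at h
    rw [← h]
    congr 1
    ext θ
    rw [hneg]
    have he := exp_ne_zero (θ * I)
    rw [show X * exp (θ * I) - s = (X - s * (exp (θ * I))⁻¹) * exp (θ * I) by field_simp]
    rw [pow_succ, mul_div_mul_right _ _ he, inv_pow, inv_inv]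
  rw [hflip]
  -- For `X = 0` there is no pole `s / X`; the integrand is a monomial of mean zero.
  rcases eq_or_ne X 0 with rfl | hX0
  · have h1 := integral_exp_div_sub (n + 1) (a := 0) (by simp)
    rw [if_neg (by simpa using hs.le)]
    have h2 : ∀ θ : ℝ, exp (θ * I) ^ (n + 1) / (0 * exp (θ * I) - s)
        = -(1 / s) * (exp (θ * I) ^ (n + 1 + 1) / (exp (θ * I) - 0)) := by
      intro θ
      rw [zero_mul, zero_sub, sub_zero, pow_succ _ (n + 1), mul_div_assoc,
        div_self (exp_ne_zero _), mul_one]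
      ring
    simp_rw [h2]
    rw [intervalIntegral.integral_const_mul, h1]
    simp
  · have hXpos : 0 < ‖X‖ := norm_pos_iff.2 hX0
    have hnorm : ‖s / X‖ = s / ‖X‖ := by simp [abs_of_pos hs]
    have ha : ‖s / X‖ ≠ 1 := by
      rw [hnorm]
      intro h
      exact hX (by field_simp at h; exact h.symm)
    have h1 := integral_exp_div_sub n ha
    have h2 : ∀ θ : ℝ, exp (θ * I) ^ (n + 1) / (X * exp (θ * I) - s)
        = (1 / X) * (exp (θ * I) ^ (n + 1) / (exp (θ * I) - s / X)) := by
      intro θ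
      rw [show X * exp (θ * I) - s = X * (exp (θ * I) - s / X) by field_simp]
      rw [div_mul_div_comm, one_mul]
    simp_rw [h2]
    rw [intervalIntegral.integral_const_mul, h1, hnorm]
    simp only [div_lt_one hXpos]
    split_ifs
    · rw [div_pow]
      field_simp
      ring
    · simp

theorem ofReal_re_eq (z : ℂ) : ((z.re : ℝ) : ℂ) = (z + (starRingEnd ℂ) z) / 2 := by
  rw [re_eq_add_conj]

/-- The angular part of the Cauchy transform of a function of angular frequency `n`. -/
theorem integral_re_mul_inv_sub {n : ℕ} (hn : 1 ≤ n) (A : ℂ) {X : ℂ} {s : ℝ} (hs : 0 < s)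
    (hX : ‖X‖ ≠ s) :
    ∫ θ in (-Real.pi)..Real.pi,
        (((A * exp (θ * I) ^ n).re : ℝ) : ℂ) / (X - s * exp (θ * I))
      = if s < ‖X‖ then Real.pi * (starRingEnd ℂ) A * s ^ n / X ^ (n + 1)
        else -(Real.pi * A * X ^ (n - 1) / s ^ n) := by
  have hne : ∀ θ : ℝ, X - s * exp (θ * I) ≠ 0 := by
    intro θ h0
    rw [sub_eq_zero] at h0
    apply hX
    rw [h0, norm_mul, norm_exp_ofReal_mul_I]
    simp [abs_of_pos hs]
  have hconj : ∀ θ : ℝ, (starRingEnd ℂ) (exp (θ * I)) = (exp (θ * I))⁻¹ := by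
    intro θ
    rw [← exp_conj, ← exp_neg]
    simp
  have h1 : ∀ θ : ℝ, (((A * exp (θ * I) ^ n).re : ℝ) : ℂ) / (X - s * exp (θ * I))
      = A / 2 * (exp (θ * I) ^ n / (X - s * exp (θ * I)))
        + (starRingEnd ℂ) A / 2 * ((exp (θ * I) ^ n)⁻¹ / (X - s * exp (θ * I))) := by
    intro θ
    rw [ofReal_re_eq, map_mul, map_pow, hconj, inv_pow]
    have := hne θ
    have he := exp_ne_zero (θ * I)
    field_simp
  simp_rw [h1]
  rw [intervalIntegral.integral_add, intervalIntegral.integral_const_mul,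
    intervalIntegral.integral_const_mul, integral_exp_mul_inv_sub hn hs hX,
    integral_exp_inv_mul_inv_sub n hs hX]
  · split_ifs
    · ring
    · ring
  · refine Continuous.intervalIntegrable ?_ _ _
    refine continuous_const.mul (Continuous.div (by fun_prop) (by fun_prop) hne)
  · refine Continuous.intervalIntegrable ?_ _ _
    refine continuous_const.mul (Continuous.div ?_ (by fun_prop) hne)
    exact Continuous.inv₀ (by fun_prop) (fun θ => pow_ne_zero _ (exp_ne_zero _))

end Angular

/-! ### The Biot-Savart law as a Cauchy transform. -/

section Cauchy

open Complex

/-- The real part of the Cauchy kernel `1 / z`. -/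
def kerRe (y : Plane) : ℝ := ((toC y)⁻¹).re

/-- The imaginary part of the Cauchy kernel `1 / z`. -/
def kerIm (y : Plane) : ℝ := ((toC y)⁻¹).im

theorem isNewtonKernel_kerRe : IsNewtonKernel kerRe where
  measurable := measurable_re.comp toC.continuous.measurable.inv
  bound y := by
    rw [kerRe, Real.norm_eq_abs, ← norm_toC, ← norm_inv]
    exact abs_re_le_norm _

theorem isNewtonKernel_kerIm : IsNewtonKernel kerIm where
  measurable := measurable_im.comp toC.continuous.measurable.inv
  bound y := by
    rw [kerIm, Real.norm_eq_abs, ← norm_toC, ← norm_inv]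
    exact abs_im_le_norm _

/-- The complex velocity `v₁ + i v₀` of the velocity field `v` of a vorticity `w`. -/
def cauchyVel (w : Plane → ℝ) (x : Plane) : ℂ :=
  1 / (2 * Real.pi) * ∫ y, (w y : ℂ) / (toC x - toC y)

/-- Splits the Cauchy kernel into two real Newtonian kernels. The form `x - (x - y)` prepares the
substitution `y ↦ x - y`, which produces a `kernelConv`. -/
theorem div_toC_sub (w : Plane → ℝ) (x y : Plane) : (w y : ℂ) / (toC x - toC y)
    = ((kerRe (x - y) • w (x - (x - y)) : ℝ) : ℂ)
      + ((kerIm (x - y) • w (x - (x - y)) : ℝ) : ℂ) * I := by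
  rw [sub_sub_cancel, smul_eq_mul, smul_eq_mul, kerRe, kerIm, map_sub]
  push_cast
  rw [mul_right_comm, ← add_mul, re_add_im, div_eq_mul_inv, mul_comm]

theorem integrable_div_toC_sub {w : Plane → ℝ} (hw : RapidDecay 0 w) (x : Plane) :
    Integrable (fun y => (w y : ℂ) / (toC x - toC y)) := by
  simp_rw [div_toC_sub]
  exact ((isNewtonKernel_kerRe.integrable hw x).comp_sub_left x).ofReal.add
    (((isNewtonKernel_kerIm.integrable hw x).comp_sub_left x).ofReal.mul_const I)

theorem cauchyVel_eq {w : Plane → ℝ} (hw : RapidDecay 0 w) (x : Plane) :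
    cauchyVel w x
      = 1 / (2 * Real.pi) * ((kernelConv kerRe w x : ℝ) + (kernelConv kerIm w x : ℝ) * I) := by
  have h1 := (isNewtonKernel_kerRe.integrable hw x).comp_sub_left x
  have h2 := (isNewtonKernel_kerIm.integrable hw x).comp_sub_left x
  have h1' : Integrable (fun y => ((kerRe (x - y) • w (x - (x - y)) : ℝ) : ℂ)) := h1.ofReal
  have h2' : Integrable (fun y => ((kerIm (x - y) • w (x - (x - y)) : ℝ) : ℂ) * I) :=
    h2.ofReal.mul_const I
  rw [cauchyVel]
  simp_rw [div_toC_sub]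
  rw [integral_add h1' h2', integral_mul_const, integral_complex_ofReal,
    integral_complex_ofReal, integral_sub_left_eq_self (fun y => kerRe y • w (x - y)) volume x,
    integral_sub_left_eq_self (fun y => kerIm y • w (x - y)) volume x]
  rfl

/-- The real-linear map `C ↦ (Im C, Re C)`. -/
def velOfC : ℂ →L[ℝ] Plane :=
  (toC.symm.toContinuousLinearEquiv : ℂ →L[ℝ] Plane).comp
    ((I • (1 : ℂ →L[ℝ] ℂ)).comp (conjCLE : ℂ →L[ℝ] ℂ))

theorem toC_velOfC (c : ℂ) : toC (velOfC c) = I * (starRingEnd ℂ) c := by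
  simp [velOfC]

/-- In complex notation `z^⊥ / |z|²` is `i / conj z`, that is, `i` times the conjugate of the Cauchy
kernel. -/
theorem biotSavart_eq {w : Plane → ℝ} (hw : RapidDecay 0 w) (x : Plane) :
    biotSavart w x = velOfC (cauchyVel w x) := by
  have h1 : ∀ y, (w y / ‖x - y‖ ^ 2) • perp (x - y) = velOfC ((w y : ℂ) / (toC x - toC y)) := by
    intro y
    apply toC.injective
    rw [toC_velOfC, map_smul, map_div₀, conj_ofReal, ← map_sub]
    have hp : toC (perp (x - y)) = I * toC (x - y) := by
      apply Complex.ext <;> simp [toC_re, toC_im, perp]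
    rw [hp]
    generalize x - y = z
    rcases eq_or_ne z 0 with rfl | hz
    · simp
    have hz' : toC z ≠ 0 := by simpa using hz
    have hz'' : (starRingEnd ℂ) (toC z) ≠ 0 := by simpa using hz
    have hn : ((‖z‖ ^ 2 : ℝ) : ℂ) = (starRingEnd ℂ) (toC z) * toC z := by
      rw [← norm_toC, mul_comm, mul_conj, normSq_eq_norm_sq]
    rw [real_smul, ofReal_div, hn]
    field_simp
  rw [biotSavart, cauchyVel]
  simp_rw [h1]
  rw [velOfC.integral_comp_comm (integrable_div_toC_sub hw x), ← map_smul]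
  congr 1
  rw [real_smul]
  push_cast
  rfl

end Cauchy

/-! ### Amplitudes of functions of a single angular frequency. -/

section Amplitude

open Complex

/-- The complex amplitude `W` of a function `Re (W(r) e^{inθ})` of angular frequency `n`. -/
def amp (n : ℕ) (w : Plane → ℝ) (r : ℝ) : ℂ :=
  w (polar r 0) - w (polar r (Real.pi / (2 * n))) * I

/-- `w` has angular frequency `n`. -/
def IsMode (n : ℕ) (w : Plane → ℝ) : Prop :=
  ∀ r θ : ℝ, 0 < r → w (polar r θ) = (amp n w r * exp (θ * I) ^ n).re

/-- At `θ = π/(2n)` the factor `e^{inθ}` is `i`, so the two samples in `amp` are `Re W` and `-Im W`.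
-/
theorem amp_eq {n : ℕ} (hn : n ≠ 0) {w : Plane → ℝ} {W : ℂ} {r : ℝ}
    (h : ∀ θ : ℝ, w (polar r θ) = (W * exp (θ * I) ^ n).re) : amp n w r = W := by
  have h1 : exp ((Real.pi / (2 * n) : ℝ) * I) ^ n = I := by
    rw [← exp_nat_mul]
    have : (n : ℂ) ≠ 0 := by exact_mod_cast hn
    rw [show (n : ℂ) * ((Real.pi / (2 * n) : ℝ) * I) = Real.pi / 2 * I by
      push_cast; field_simp]
    exact exp_pi_div_two_mul_I
  rw [amp, h 0, h, h1]
  apply Complex.ext <;> simp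

theorem isMode_of {n : ℕ} (hn : n ≠ 0) {w : Plane → ℝ} {W : ℝ → ℂ}
    (h : ∀ r θ : ℝ, 0 < r → w (polar r θ) = (W r * exp (θ * I) ^ n).re) : IsMode n w := by
  intro r θ hr
  rw [h r θ hr, amp_eq hn (fun θ => h r θ hr)]

theorem continuous_polar : Continuous (fun p : ℝ × ℝ => polar p.1 p.2) := by
  have : (fun p : ℝ × ℝ => polar p.1 p.2)
      = fun p => toC.symm (p.1 * exp (p.2 * I)) := by
    ext1 p
    rw [LinearIsometryEquiv.eq_symm_apply, toC_polar]
  rw [this]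
  exact toC.symm.continuous.comp (by fun_prop)

theorem continuous_amp (n : ℕ) {w : Plane → ℝ} (hw : Continuous w) : Continuous (amp n w) := by
  have h : ∀ θ : ℝ, Continuous fun r : ℝ => w (polar r θ) := fun θ =>
    hw.comp (continuous_polar.comp (by fun_prop : Continuous fun r : ℝ => (r, θ)))
  unfold amp
  exact (continuous_ofReal.comp (h 0)).sub
    ((continuous_ofReal.comp (h (Real.pi / (2 * n)))).mul continuous_const)

/-- A continuous, rapidly decaying radial profile. -/
structure RadialDecay (W : ℝ → ℂ) : Prop where
  cont : Continuous W
  decay : ∀ N : ℕ, ∃ C : ℝ, 0 ≤ C ∧ ∀ s, 0 ≤ s → (1 + s) ^ N * ‖W s‖ ≤ C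

theorem radialDecay_amp (n : ℕ) {w : Plane → ℝ} (hw : RapidDecay 0 w) :
    RadialDecay (amp n w) where
  cont := continuous_amp n hw.1.continuous
  decay N := by
    obtain ⟨C, hC, h⟩ := (rapidDecay_zero_iff.1 hw).2 N
    refine ⟨2 * C, by positivity, fun s hs => ?_⟩
    have h1 := h (polar s 0)
    have h2 := h (polar s (Real.pi / (2 * n)))
    rw [norm_polar hs] at h1 h2
    calc _ ≤ (1 + s) ^ N * (‖w (polar s 0)‖ + ‖w (polar s (Real.pi / (2 * n)))‖) := by
          gcongr
          refine (norm_sub_le _ _).trans ?_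
          rw [norm_mul, norm_I, mul_one, norm_real, norm_real]
      _ ≤ _ := by linarith

end Amplitude

/-! ### The radial Green's function of the Laplacian in frequency `n`. -/

section RadialPotential

open Complex

theorem RadialDecay.integrableOn {W : ℝ → ℂ} (hW : RadialDecay W) (k : ℕ) :
    IntegrableOn (fun s : ℝ => (s : ℂ) ^ k * W s) (Set.Ioi 0) := by
  obtain ⟨C, hC, h⟩ := hW.decay (k + 2)
  have h1 : Integrable (fun r : ℝ => (1 + ‖r‖) ^ (-2 : ℝ)) :=
    integrable_one_add_norm (by simp)
  have hc := hW.cont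
  refine ((h1.const_mul C).integrableOn (s := Set.Ioi 0)).mono'
    (Continuous.aestronglyMeasurable (by fun_prop))
    ((ae_restrict_iff' measurableSet_Ioi).2 (Eventually.of_forall fun s hs => ?_))
  have hs : 0 < s := hs
  rw [norm_mul, norm_pow, norm_real, Real.norm_of_nonneg hs.le, Real.rpow_neg (by positivity),
    ← div_eq_mul_inv, le_div_iff₀ (by positivity)]
  norm_cast
  calc s ^ k * ‖W s‖ * (1 + s) ^ 2 ≤ (1 + s) ^ k * ‖W s‖ * (1 + s) ^ 2 := by
        gcongr
        linarith
    _ = (1 + s) ^ (k + 2) * ‖W s‖ := by ring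
    _ ≤ C := h s hs.le

/-- `∫_0^r s^{n+1} W(s) ds`. -/
def innerInt (n : ℕ) (W : ℝ → ℂ) (r : ℝ) : ℂ := ∫ s in (0 : ℝ)..r, (s : ℂ) ^ (n + 1) * W s

/-- `∫_r^∞ s^{1-n} W(s) ds`. -/
def outerInt (n : ℕ) (W : ℝ → ℂ) (r : ℝ) : ℂ := ∫ s in Set.Ioi r, (s : ℂ) / s ^ n * W s

/-- `r^{-n} ∫_0^r s^{n+1} W(s) ds`. -/
def potP (n : ℕ) (W : ℝ → ℂ) (r : ℝ) : ℂ := innerInt n W r / r ^ n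

/-- `r^n ∫_r^∞ s^{1-n} W(s) ds`. -/
def potQ (n : ℕ) (W : ℝ → ℂ) (r : ℝ) : ℂ := r ^ n * outerInt n W r

/-- The decaying solution `Ψ` of `Ψ'' + Ψ'/r - n²Ψ/r² = W`. -/
def radPot (n : ℕ) (W : ℝ → ℂ) (r : ℝ) : ℂ := -(potP n W r + potQ n W r) / (2 * n)

theorem integrableOn_outer {W : ℝ → ℂ} (hW : RadialDecay W) {n : ℕ} (hn : 1 ≤ n) {r : ℝ}
    (hr : 0 < r) : IntegrableOn (fun s : ℝ => (s : ℂ) / s ^ n * W s) (Set.Ioi r) := by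
  obtain ⟨m, rfl⟩ : ∃ m, n = m + 1 := ⟨n - 1, by omega⟩
  have h := ((hW.integrableOn 0).mono_set (Set.Ioi_subset_Ioi hr.le)).norm.const_mul (r ^ m)⁻¹
  have hc := hW.cont
  refine h.mono' ?_ ((ae_restrict_iff' measurableSet_Ioi).2 (Eventually.of_forall fun s hs => ?_))
  · exact AEStronglyMeasurable.mul (Measurable.aestronglyMeasurable (by fun_prop))
      hc.aestronglyMeasurable
  · have hs : r < s := hs
    have hs0 : 0 < s := hr.trans hs
    simp only [norm_mul, norm_div, norm_pow, norm_real, Real.norm_of_nonneg hs0.le, pow_zero,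
      one_mul]
    gcongr
    rw [pow_succ, ← div_div, div_right_comm, div_self hs0.ne', one_div]
    gcongr

theorem hasDerivAt_innerInt {W : ℝ → ℂ} (hW : Continuous W) (n : ℕ) (r : ℝ) :
    HasDerivAt (innerInt n W) ((r : ℂ) ^ (n + 1) * W r) r := by
  have hc : Continuous fun s : ℝ => (s : ℂ) ^ (n + 1) * W s := by fun_prop
  exact intervalIntegral.integral_hasDerivAt_right (hc.intervalIntegrable _ _)
    hc.stronglyMeasurable.stronglyMeasurableAtFilter hc.continuousAt

theorem hasDerivAt_outerInt {W : ℝ → ℂ} (hW : RadialDecay W) {n : ℕ} (hn : 1 ≤ n) {r : ℝ}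
    (hr : 0 < r) : HasDerivAt (outerInt n W) (-((r : ℂ) / r ^ n * W r)) r := by
  have hc := hW.cont
  have hr2 : 0 < r / 2 := by positivity
  have hint := integrableOn_outer hW hn hr2
  have hm : StronglyMeasurable fun s : ℝ => (s : ℂ) / s ^ n * W s :=
    StronglyMeasurable.mul (Measurable.stronglyMeasurable (by fun_prop)) hc.stronglyMeasurable
  have h1 : HasDerivAt (fun u => ∫ s in (r / 2)..u, (s : ℂ) / s ^ n * W s)
      ((r : ℂ) / r ^ n * W r) r := by
    refine intervalIntegral.integral_hasDerivAt_right ?_ hm.stronglyMeasurableAtFilter ?_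
    · rw [intervalIntegrable_iff_integrableOn_Ioc_of_le (by linarith)]
      exact hint.mono_set Set.Ioc_subset_Ioi_self
    · have : ((r : ℂ)) ^ n ≠ 0 := pow_ne_zero _ (by exact_mod_cast hr.ne')
      have h3 : ContinuousAt (fun s : ℝ => (s : ℂ) / (s : ℂ) ^ n) r :=
        ContinuousAt.div (by fun_prop) (by fun_prop) this
      exact h3.mul hc.continuousAt
  have h2 : outerInt n W =ᶠ[𝓝 r] fun u =>
      outerInt n W (r / 2) - ∫ s in (r / 2)..u, (s : ℂ) / s ^ n * W s := by
    filter_upwards [Ioi_mem_nhds (by linarith : r / 2 < r)] with u hu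
    have hu : r / 2 < u := hu
    rw [outerInt, outerInt, ← intervalIntegral.integral_interval_add_Ioi hint
      (hint.mono_set (Set.Ioi_subset_Ioi hu.le))]
    ring
  exact (h1.const_sub _).congr_of_eventuallyEq h2

theorem hasDerivAt_pow_ofReal (n : ℕ) (r : ℝ) :
    HasDerivAt (fun s : ℝ => (s : ℂ) ^ n) (n * (r : ℂ) ^ (n - 1)) r := by
  simpa using (hasDerivAt_pow n (r : ℂ)).comp_ofReal

theorem hasDerivAt_potP {W : ℝ → ℂ} (hW : Continuous W) {n : ℕ} (hn : 1 ≤ n) {r : ℝ}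
    (hr : 0 < r) : HasDerivAt (potP n W) (-(n / r) * potP n W r + r * W r) r := by
  obtain ⟨m, rfl⟩ : ∃ m, n = m + 1 := ⟨n - 1, by omega⟩
  have hrC : (r : ℂ) ≠ 0 := by exact_mod_cast hr.ne'
  have h := (hasDerivAt_innerInt hW (m + 1) r).div (hasDerivAt_pow_ofReal (m + 1) r)
    (pow_ne_zero _ hrC)
  refine h.congr_deriv ?_
  rw [potP, Nat.add_sub_cancel]
  field_simp
  ring

theorem hasDerivAt_potQ {W : ℝ → ℂ} (hW : RadialDecay W) {n : ℕ} (hn : 1 ≤ n) {r : ℝ}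
    (hr : 0 < r) : HasDerivAt (potQ n W) (n / r * potQ n W r - r * W r) r := by
  obtain ⟨m, rfl⟩ : ∃ m, n = m + 1 := ⟨n - 1, by omega⟩
  have hrC : (r : ℂ) ≠ 0 := by exact_mod_cast hr.ne'
  have h := (hasDerivAt_pow_ofReal (m + 1) r).mul (hasDerivAt_outerInt hW hn hr)
  refine h.congr_deriv ?_
  rw [potQ, Nat.add_sub_cancel]
  field_simp
  ring

theorem hasDerivAt_radPot {W : ℝ → ℂ} (hW : RadialDecay W) {n : ℕ} (hn : 1 ≤ n) {r : ℝ}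
    (hr : 0 < r) : HasDerivAt (radPot n W) ((potP n W r - potQ n W r) / (2 * r)) r := by
  have hrC : (r : ℂ) ≠ 0 := by exact_mod_cast hr.ne'
  have hnC : (n : ℂ) ≠ 0 := by exact_mod_cast (by omega : n ≠ 0)
  have h := (((hasDerivAt_potP hW.cont hn hr).add (hasDerivAt_potQ hW hn hr)).neg).div_const
    (2 * (n : ℂ))
  refine h.congr_deriv ?_
  field_simp
  ring

theorem hasDerivAt_mul_deriv_radPot {W : ℝ → ℂ} (hW : RadialDecay W) {n : ℕ} (hn : 1 ≤ n)
    {r : ℝ} (hr : 0 < r) :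
    HasDerivAt (fun s => (potP n W s - potQ n W s) / 2) (r * W r + n ^ 2 / r * radPot n W r) r := by
  have hrC : (r : ℂ) ≠ 0 := by exact_mod_cast hr.ne'
  have hnC : (n : ℂ) ≠ 0 := by exact_mod_cast (by omega : n ≠ 0)
  have h := ((hasDerivAt_potP hW.cont hn hr).sub (hasDerivAt_potQ hW hn hr)).div_const 2
  refine h.congr_deriv ?_
  rw [radPot]
  field_simp
  ring

/-- The weight function controlling the radial potential near the origin. -/
def cutMass (W : ℝ → ℂ) (r : ℝ) : ℝ := ∫ s in Set.Ioi (0 : ℝ), min (r / s) 1 * ‖W s‖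

theorem RadialDecay.integrableOn_norm {W : ℝ → ℂ} (hW : RadialDecay W) :
    IntegrableOn (fun s => ‖W s‖) (Set.Ioi 0) := by
  have h := (hW.integrableOn 0).norm
  simp only [pow_zero, one_mul] at h
  exact h

theorem integrableOn_cut {W : ℝ → ℂ} (hW : RadialDecay W) {r : ℝ} (hr : 0 ≤ r) :
    IntegrableOn (fun s => min (r / s) 1 * ‖W s‖) (Set.Ioi 0) := by
  have hc := hW.cont
  refine hW.integrableOn_norm.mono' (Measurable.aestronglyMeasurable ?_)
    ((ae_restrict_iff' measurableSet_Ioi).2 (Eventually.of_forall fun s hs => ?_))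
  · exact Measurable.mul (by fun_prop) hc.measurable.norm
  · have hs : 0 < s := hs
    have : 0 ≤ min (r / s) 1 := le_min (by positivity) zero_le_one
    rw [Real.norm_of_nonneg (by positivity)]
    exact mul_le_of_le_one_left (norm_nonneg _) (min_le_right _ _)

/-- Dominated convergence. With the bounds below it yields `Ψ(r) = o(r)`, hence a vanishing gradient
of the stream function at the origin. -/
theorem tendsto_cutMass {W : ℝ → ℂ} (hW : RadialDecay W) :
    Tendsto (cutMass W) (𝓝[≥] 0) (𝓝 0) := by
  have hc := hW.cont
  suffices h : Tendsto (cutMass W) (𝓝[≥] 0) (𝓝 (∫ s in Set.Ioi (0 : ℝ), (0 : ℝ))) by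
    simpa using h
  refine tendsto_integral_filter_of_dominated_convergence (fun s => ‖W s‖) ?_ ?_
    hW.integrableOn_norm ?_
  · refine Eventually.of_forall fun r => (Measurable.aestronglyMeasurable ?_)
    exact Measurable.mul (by fun_prop) hc.measurable.norm
  · filter_upwards [self_mem_nhdsWithin] with r hr
    have hr : 0 ≤ r := hr
    refine (ae_restrict_iff' measurableSet_Ioi).2 (Eventually.of_forall fun s hs => ?_)
    have hs : 0 < s := hs
    have : 0 ≤ min (r / s) 1 := le_min (by positivity) zero_le_one
    rw [Real.norm_of_nonneg (by positivity)]
    exact mul_le_of_le_one_left (norm_nonneg _) (min_le_right _ _)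
  · refine Eventually.of_forall fun s => ?_
    have : Continuous fun r : ℝ => min (r / s) 1 * ‖W s‖ := by fun_prop
    have h := (this.tendsto 0).mono_left (nhdsWithin_le_nhds (s := Set.Ici 0))
    simpa using h

theorem norm_potP_le {W : ℝ → ℂ} (hW : RadialDecay W) (n : ℕ) {r : ℝ} (hr : 0 < r) :
    ‖potP n W r‖ ≤ r * cutMass W r := by
  have h1 : ‖innerInt n W r‖ ≤ ∫ s in Set.Ioc 0 r, r ^ (n + 1) * (min (r / s) 1 * ‖W s‖) := by
    rw [innerInt, intervalIntegral.integral_of_le hr.le]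
    refine norm_integral_le_of_norm_le
      (((integrableOn_cut hW hr.le).mono_set Set.Ioc_subset_Ioi_self).const_mul _) ?_
    refine (ae_restrict_iff' measurableSet_Ioc).2 (Eventually.of_forall fun s hs => ?_)
    have hs0 : 0 < s := hs.1
    rw [min_eq_right ((one_le_div hs0).2 hs.2), norm_mul, norm_pow, norm_real,
      Real.norm_of_nonneg hs0.le, one_mul]
    gcongr
    exact hs.2
  have h2 : ∫ s in Set.Ioc 0 r, (min (r / s) 1 * ‖W s‖) ≤ cutMass W r := by
    refine setIntegral_mono_set (integrableOn_cut hW hr.le) ?_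
      (Eventually.of_forall (fun s (hs : s ∈ Set.Ioc 0 r) => hs.1))
    refine (ae_restrict_iff' measurableSet_Ioi).2 (Eventually.of_forall fun s hs => ?_)
    have hs : 0 < s := hs
    have : 0 ≤ min (r / s) 1 := le_min (by positivity) zero_le_one
    exact mul_nonneg this (norm_nonneg _)
  rw [integral_const_mul] at h1
  rw [potP, norm_div, norm_pow, norm_real, Real.norm_of_nonneg hr.le, div_le_iff₀ (by positivity)]
  calc _ ≤ r ^ (n + 1) * cutMass W r := h1.trans (by gcongr)
    _ = _ := by ring

/-- For `s > r` the kernel is `r (r/s)^{n-1} ≤ r (r/s)`; this is where `n ≥ 2` enters. -/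
theorem norm_potQ_le {W : ℝ → ℂ} (hW : RadialDecay W) {n : ℕ} (hn : 2 ≤ n) {r : ℝ}
    (hr : 0 < r) : ‖potQ n W r‖ ≤ r * cutMass W r := by
  have h1 : ‖potQ n W r‖ ≤ ∫ s in Set.Ioi r, r * (min (r / s) 1 * ‖W s‖) := by
    rw [potQ, outerInt, ← integral_const_mul]
    refine norm_integral_le_of_norm_le
      (((integrableOn_cut hW hr.le).mono_set (Set.Ioi_subset_Ioi hr.le)).const_mul _) ?_
    refine (ae_restrict_iff' measurableSet_Ioi).2 (Eventually.of_forall fun s hs => ?_)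
    have hs : r < s := hs
    have hs0 : 0 < s := hr.trans hs
    rw [min_eq_left ((div_le_one hs0).2 hs.le), norm_mul, norm_mul, norm_div, norm_pow, norm_pow,
      norm_real, norm_real, Real.norm_of_nonneg hs0.le, Real.norm_of_nonneg hr.le, ← mul_assoc,
      ← mul_assoc]
    refine mul_le_mul_of_nonneg_right ?_ (norm_nonneg _)
    obtain ⟨m, rfl⟩ : ∃ m, n = m + 2 := ⟨n - 2, by omega⟩
    have h3 : r ^ m ≤ s ^ m := by gcongr
    rw [← mul_div_assoc, ← mul_div_assoc, div_le_div_iff₀ (by positivity) hs0]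
    calc r ^ (m + 2) * s * s = r ^ m * (r * r * (s * s)) := by ring
      _ ≤ s ^ m * (r * r * (s * s)) := by gcongr
      _ = _ := by ring
  have h2 : ∫ s in Set.Ioi r, (min (r / s) 1 * ‖W s‖) ≤ cutMass W r := by
    refine setIntegral_mono_set (integrableOn_cut hW hr.le) ?_
      (Eventually.of_forall (fun s (hs : s ∈ Set.Ioi r) => hr.trans hs))
    refine (ae_restrict_iff' measurableSet_Ioi).2 (Eventually.of_forall fun s hs => ?_)
    have hs : 0 < s := hs
    have : 0 ≤ min (r / s) 1 := le_min (by positivity) zero_le_one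
    exact mul_nonneg this (norm_nonneg _)
  rw [integral_const_mul] at h1
  exact h1.trans (by gcongr)

theorem norm_radPot_le {W : ℝ → ℂ} (hW : RadialDecay W) {n : ℕ} (hn : 2 ≤ n) {r : ℝ}
    (hr : 0 < r) : ‖radPot n W r‖ ≤ r * cutMass W r := by
  have h1 := norm_potP_le hW n hr
  have h2 := norm_potQ_le hW hn hr
  have h3 := (norm_nonneg _).trans h1
  have hn' : (2 : ℝ) ≤ n := by exact_mod_cast hn
  rw [radPot, norm_div, norm_neg, div_le_iff₀ (by simp; omega)]
  refine (norm_add_le _ _).trans ?_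
  simp only [norm_mul, norm_ofNat, norm_natCast]
  nlinarith

end RadialPotential

/-! ### Velocity and stream function of a single mode. -/

section ModeVelocity

open Complex

/-- Circle by circle, the radii below `‖x‖` contribute the inner integral and those above it the
outer one; the circle through `x` is negligible. The formula survives at `x = 0`, where the inner
integral is zero. -/
theorem cauchyVel_mode {n : ℕ} (hn : 2 ≤ n) {w : Plane → ℝ} (hw : RapidDecay 0 w)
    (hm : IsMode n w) (x : Plane) :
    cauchyVel w x = 1 / 2 * ((starRingEnd ℂ) (innerInt n (amp n w) ‖x‖) / toC x ^ (n + 1)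
      - toC x ^ (n - 1) * outerInt n (amp n w) ‖x‖) := by
  set W := amp n w with hWdef
  set X := toC x with hX
  set R := ‖x‖ with hR
  have hRX : ‖X‖ = R := norm_toC x
  have hR0 : 0 ≤ R := norm_nonneg x
  have hint := integrable_div_toC_sub hw x
  have hrad := integrableOn_radial hint
  have hval : ∀ s : ℝ, 0 < s → s ≠ R →
      s • ∫ θ in (-Real.pi)..Real.pi, (w (polar s θ) : ℂ) / (toC x - toC (polar s θ))
        = s * if s < R then Real.pi * (starRingEnd ℂ) (W s) * s ^ n / X ^ (n + 1)
          else -(Real.pi * W s * X ^ (n - 1) / s ^ n) := by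
    intro s hs hsR
    have h := integral_re_mul_inv_sub (by omega : 1 ≤ n) (W s) hs (X := X)
      (by rw [hRX]; exact hsR.symm)
    rw [hRX] at h
    rw [← h, real_smul]
    congr 2
    ext θ
    rw [hm s θ hs, toC_polar]
  have hunion : Set.Ioc 0 R ∪ Set.Ioi R = Set.Ioi (0 : ℝ) := Set.Ioc_union_Ioi_eq_Ioi hR0
  have h1 : ∫ s in Set.Ioc 0 R,
      s • ∫ θ in (-Real.pi)..Real.pi, (w (polar s θ) : ℂ) / (toC x - toC (polar s θ))
        = Real.pi / X ^ (n + 1) * (starRingEnd ℂ) (innerInt n W R) := by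
    rw [innerInt, intervalIntegral.integral_of_le hR0, ← integral_conj, ← integral_const_mul,
      integral_Ioc_eq_integral_Ioo, integral_Ioc_eq_integral_Ioo]
    refine setIntegral_congr_fun measurableSet_Ioo fun s hs => ?_
    rw [hval s hs.1 hs.2.ne, if_pos hs.2, map_mul, map_pow, conj_ofReal]
    ring
  have h2 : ∫ s in Set.Ioi R,
      s • ∫ θ in (-Real.pi)..Real.pi, (w (polar s θ) : ℂ) / (toC x - toC (polar s θ))
        = -(Real.pi * X ^ (n - 1)) * outerInt n W R := by
    rw [outerInt, ← integral_const_mul]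
    refine setIntegral_congr_fun measurableSet_Ioi fun s hs => ?_
    have hs : R < s := hs
    rw [hval s (hR0.trans_lt hs) hs.ne', if_neg hs.le.not_gt]
    ring
  rw [cauchyVel, integral_polar hint, ← hunion,
    setIntegral_union Set.Ioc_disjoint_Ioi_same measurableSet_Ioi
      (hrad.mono_set Set.Ioc_subset_Ioi_self) (hrad.mono_set (Set.Ioi_subset_Ioi hR0)), h1, h2]
  have hpi : (Real.pi : ℂ) ≠ 0 := by exact_mod_cast Real.pi_ne_zero
  field_simp
  ring

theorem cauchyVel_zero {n : ℕ} (hn : 2 ≤ n) {w : Plane → ℝ} (hw : RapidDecay 0 w)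
    (hm : IsMode n w) : cauchyVel w 0 = 0 := by
  rw [cauchyVel_mode hn hw hm]
  have : n - 1 ≠ 0 := by omega
  simp [this]

/-- The function `Re (Ψ(r) e^{inθ})` on the plane. -/
def modeFun (n : ℕ) (Ψ : ℝ → ℂ) (x : Plane) : ℝ := (Ψ ‖x‖ * (toC x / ‖x‖) ^ n).re

theorem modeFun_polar (n : ℕ) (Ψ : ℝ → ℂ) {r : ℝ} (hr : 0 < r) (θ : ℝ) :
    modeFun n Ψ (polar r θ) = (Ψ r * exp (θ * I) ^ n).re := by
  have hrC : (r : ℂ) ≠ 0 := by exact_mod_cast hr.ne'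
  rw [modeFun, norm_polar hr.le, toC_polar, mul_div_cancel_left₀ _ hrC]

theorem modeFun_zero {n : ℕ} (hn : n ≠ 0) (Ψ : ℝ → ℂ) : modeFun n Ψ 0 = 0 := by
  simp [modeFun, hn]

theorem abs_modeFun_le (n : ℕ) (Ψ : ℝ → ℂ) (x : Plane) : |modeFun n Ψ x| ≤ ‖Ψ ‖x‖‖ := by
  refine (abs_re_le_norm _).trans ?_
  rw [norm_mul, norm_pow, norm_div, norm_toC, norm_real, norm_norm]
  exact mul_le_of_le_one_right (norm_nonneg _) (pow_le_one₀ (by positivity) (div_self_le_one _))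

theorem IsMode.eq_modeFun {n : ℕ} {w : Plane → ℝ} (hm : IsMode n w) {x : Plane} (hx : x ≠ 0) :
    w x = modeFun n (amp n w) x := by
  have hx' : 0 < ‖x‖ := norm_pos_iff.2 hx
  rw [← polar_norm_angle x, modeFun_polar n _ hx']
  exact hm _ _ hx'

/-- The real-linear functional `u ↦ Re (c u)`. -/
def reMul : ℂ →L[ℝ] (Plane →L[ℝ] ℝ) :=
  (ContinuousLinearMap.compL ℝ Plane ℂ ℝ reCLM).comp
    (((ContinuousLinearMap.compL ℝ Plane ℂ ℂ).flip
      (toC.toContinuousLinearEquiv : Plane →L[ℝ] ℂ)).comp (ContinuousLinearMap.mul ℝ ℂ))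

theorem reMul_apply (c : ℂ) (u : Plane) : reMul c u = (c * toC u).re := by
  simp [reMul]

theorem hasFDerivAt_toC (x : Plane) :
    HasFDerivAt toC (toC.toContinuousLinearEquiv : Plane →L[ℝ] ℂ) x :=
  toC.toContinuousLinearEquiv.hasFDerivAt

theorem inner_eq_toC (x u : Plane) : inner ℝ x u = (toC u * (starRingEnd ℂ) (toC x)).re := by
  rw [← toC.inner_map_map, Complex.inner]

/-- The stream function of a vorticity of angular frequency `n ≥ 2` is `C¹`, and its gradient
is the velocity. -/
theorem hasFDerivAt_stream {n : ℕ} (hn : 2 ≤ n) {w : Plane → ℝ} (hw : RapidDecay 0 w)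
    (hm : IsMode n w) (x : Plane) :
    HasFDerivAt (modeFun n (radPot n (amp n w))) (reMul (cauchyVel w x)) x := by
  set W := amp n w with hWdef
  have hW : RadialDecay W := radialDecay_amp n hw
  rcases eq_or_ne x 0 with rfl | hx
  · rw [cauchyVel_zero hn hw hm, map_zero, hasFDerivAt_iff_isLittleO_nhds_zero]
    simp only [zero_add, modeFun_zero (by omega : n ≠ 0), sub_zero, zero_apply]
    have h1 : (modeFun n (radPot n W)) =O[𝓝 0] fun x : Plane => ‖x‖ * cutMass W ‖x‖ := by
      refine IsBigO.of_bound 1 (Eventually.of_forall fun x => ?_)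
      rcases eq_or_ne x 0 with rfl | hx
      · simp [modeFun_zero (by omega : n ≠ 0)]
      · rw [one_mul]
        exact ((abs_modeFun_le _ _ x).trans (norm_radPot_le hW hn (norm_pos_iff.2 hx))).trans
          (le_abs_self _)
    have h2 : Tendsto (fun x : Plane => cutMass W ‖x‖) (𝓝 0) (𝓝 0) := by
      refine (tendsto_cutMass hW).comp (tendsto_nhdsWithin_iff.2 ⟨?_, ?_⟩)
      · simpa using (continuous_norm (E := Plane)).tendsto 0
      · exact Eventually.of_forall fun x => norm_nonneg x
    have h3 : (fun x : Plane => ‖x‖ * cutMass W ‖x‖) =o[𝓝 0] fun x : Plane => ‖x‖ * (1 : ℝ) :=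
      (isBigO_refl _ _).mul_isLittleO ((isLittleO_one_iff ℝ).2 h2)
    simp only [mul_one] at h3
    exact (h1.trans_isLittleO h3).of_norm_right
  · have hr : 0 < ‖x‖ := norm_pos_iff.2 hx
    set r := ‖x‖ with hrdef
    have hrC : (r : ℂ) ≠ 0 := by exact_mod_cast hr.ne'
    have hX : toC x ≠ 0 := by simpa using hx
    obtain ⟨m, rfl⟩ : ∃ m, n = m + 1 := ⟨n - 1, by omega⟩
    have hm0 : (m : ℂ) + 1 ≠ 0 := by exact_mod_cast (by omega : m + 1 ≠ 0)
    -- The stream function is written as `Re (Ψ(r) r^{-n} X^n)`, a radial factor times a holomorphic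
    -- one. The derivative of the radial factor involves only `potP`.
    have hU : HasDerivAt (fun s : ℝ => radPot (m + 1) W s / (s : ℂ) ^ (m + 1))
        (potP (m + 1) W r / r ^ (m + 2)) r := by
      have h := (hasDerivAt_radPot hW (by omega : 1 ≤ m + 1) hr).div
        (hasDerivAt_pow_ofReal (m + 1) r) (pow_ne_zero _ hrC)
      refine h.congr_deriv ?_
      rw [radPot, Nat.add_sub_cancel]
      push_cast
      field_simp
      ring
    have hnorm : HasFDerivAt (fun y : Plane => ‖y‖) (r⁻¹ • innerSL ℝ x) x := by
      have h := ((hasStrictFDerivAt_norm_sq x).hasFDerivAt).sqrt (by positivity)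
      simp only [Real.sqrt_sq (norm_nonneg _)] at h
      refine h.congr_fderiv ?_
      ext u
      simp [← hrdef]
      field_simp
    have h1 := hU.hasFDerivAt.comp x hnorm
    have h2 := ((hasDerivAt_pow (m + 1) (toC x)).hasFDerivAt.restrictScalars ℝ).comp x
      (hasFDerivAt_toC x)
    have h3 := reCLM.hasFDerivAt.comp x (h1.mul h2)
    have hfun : modeFun (m + 1) (radPot (m + 1) W)
        = fun y => reCLM (((fun s : ℝ => radPot (m + 1) W s / (s : ℂ) ^ (m + 1)) ∘ fun y => ‖y‖) y
          * ((fun z : ℂ => z ^ (m + 1)) ∘ toC) y) := by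
      ext y
      simp only [modeFun, reCLM_apply, Function.comp_apply, div_pow]
      congr 1
      ring
    rw [hfun]
    refine h3.congr_fderiv ?_
    ext u
    rw [reMul_apply, cauchyVel_mode hn hw hm]
    have hXc : (starRingEnd ℂ) (toC x) = (r : ℂ) ^ 2 / toC x := by
      rw [eq_div_iff hX, mul_comm, mul_conj, normSq_eq_norm_sq, norm_toC, ofReal_pow]
    have hip : ((inner ℝ x u : ℝ) : ℂ)
        = (toC u * ((r : ℂ) ^ 2 / toC x) + (starRingEnd ℂ) (toC u) * toC x) / 2 := by
      rw [inner_eq_toC, ofReal_re_eq, map_mul, conj_conj, hXc]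
    -- The two derivatives agree only in real part; conjugating the inner term makes them agree as
    -- complex numbers.
    have hval : radPot (m + 1) W r / (r : ℂ) ^ (m + 1) * (toC u * ((m + 1) * toC x ^ m))
          + toC x ^ (m + 1) * ((r : ℂ)⁻¹ * (inner ℝ x u : ℝ) * (potP (m + 1) W r / r ^ (m + 2)))
        = (starRingEnd ℂ) (1 / 2 * ((starRingEnd ℂ) (innerInt (m + 1) W r) / toC x ^ (m + 2))
            * toC u) - 1 / 2 * (toC x ^ m * outerInt (m + 1) W r) * toC u := by
      rw [hip]
      simp only [map_mul, map_div₀, map_pow, conj_conj, map_one, map_ofNat, hXc]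
      rw [radPot, potP, potQ, div_pow]
      push_cast
      field_simp
      ring
    have hlhs := congrArg re hval
    rw [sub_re, conj_re, ← sub_re, ← sub_mul, ← mul_sub] at hlhs
    rw [Nat.add_sub_cancel, ← hrdef, ← hWdef, ← hlhs]
    simp [← hrdef]
    ring

end ModeVelocity

/-! ### The weights `φ` and `h`, extended regularly to the origin. -/

section Weights

/-- `∫_0^1 t^k e^{-xt} dt`. -/
def expMoment (k : ℕ) (x : ℝ) : ℝ := ∫ t in (0 : ℝ)..1, t ^ k * Real.exp (-(x * t))

/-- The moments are closed under differentiation and lie in `[0, 1]` for `x ≥ 0`; this gives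
smoothness and derivative bounds for `profile`, including at the origin. -/
theorem hasDerivAt_expMoment (k : ℕ) (x : ℝ) :
    HasDerivAt (expMoment k) (-expMoment (k + 1) x) x := by
  have h := intervalIntegral.hasDerivAt_integral_of_dominated_loc_of_deriv_le
    (μ := volume) (F := fun x t : ℝ => t ^ k * Real.exp (-(x * t)))
    (F' := fun x t : ℝ => -(t ^ (k + 1) * Real.exp (-(x * t)))) (a := 0) (b := 1) (x₀ := x)
    (bound := fun _ => Real.exp (|x| + 1)) (Metric.ball_mem_nhds x one_pos)
    (Eventually.of_forall fun y => Continuous.aestronglyMeasurable (by fun_prop))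
    (Continuous.intervalIntegrable (by fun_prop) _ _)
    (Continuous.aestronglyMeasurable (by fun_prop)) ?_
    (continuous_const.intervalIntegrable _ _) ?_
  · have h2 := h.2
    rw [intervalIntegral.integral_neg] at h2
    exact h2
  · refine Eventually.of_forall fun t ht y hy => ?_
    rw [Set.uIoc_of_le zero_le_one] at ht
    have hy' : |y| ≤ |x| + 1 := by
      have h1 : |y - x| < 1 := by simpa [Real.dist_eq] using hy
      have h2 := abs_add_le (y - x) x
      rw [sub_add_cancel] at h2
      linarith
    rw [norm_neg, norm_mul, norm_pow, Real.norm_of_nonneg ht.1.le,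
      Real.norm_of_nonneg (Real.exp_pos _).le]
    have h1 : t ^ (k + 1) ≤ 1 := pow_le_one₀ ht.1.le ht.2
    have h2 : Real.exp (-(y * t)) ≤ Real.exp (|x| + 1) := by
      gcongr
      calc -(y * t) = -y * t := by ring
        _ ≤ |y| * t := mul_le_mul_of_nonneg_right (neg_le_abs y) ht.1.le
        _ ≤ |y| := mul_le_of_le_one_right (abs_nonneg y) ht.2
        _ ≤ _ := hy'
    exact (mul_le_of_le_one_left (Real.exp_pos _).le h1).trans h2
  · refine Eventually.of_forall fun t _ y _ => ?_
    have h1 : HasDerivAt (fun y : ℝ => -(y * t)) (-t) y := by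
      simpa using ((hasDerivAt_id y).mul_const t).fun_neg
    refine (h1.exp.const_mul (t ^ k)).congr_deriv ?_
    ring

theorem mul_expMoment_zero (x : ℝ) : x * expMoment 0 x = 1 - Real.exp (-x) := by
  have h : ∀ t ∈ Set.uIcc (0 : ℝ) 1,
      HasDerivAt (fun t : ℝ => -Real.exp (-(x * t))) (x * (t ^ 0 * Real.exp (-(x * t)))) t := by
    intro t _
    have h1 : HasDerivAt (fun t : ℝ => -(x * t)) (-x) t := by
      simpa using ((hasDerivAt_id t).const_mul x).fun_neg
    refine h1.exp.neg.congr_deriv ?_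
    ring
  have h2 := intervalIntegral.integral_eq_sub_of_hasDerivAt h
    (Continuous.intervalIntegrable (by fun_prop) _ _)
  rw [expMoment, ← intervalIntegral.integral_const_mul, h2]
  simp
  ring

theorem expMoment_nonneg (k : ℕ) (x : ℝ) : 0 ≤ expMoment k x :=
  intervalIntegral.integral_nonneg zero_le_one fun t ht => by
    have := ht.1
    positivity

theorem expMoment_le_one (k : ℕ) {x : ℝ} (hx : 0 ≤ x) : expMoment k x ≤ 1 := by
  have h : expMoment k x ≤ ∫ _ in (0 : ℝ)..1, (1 : ℝ) := by
    refine intervalIntegral.integral_mono_on zero_le_one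
      (Continuous.intervalIntegrable (by fun_prop) _ _) (by simp) fun t ht => ?_
    have h1 : t ^ k ≤ 1 := pow_le_one₀ ht.1 ht.2
    have h2 : Real.exp (-(x * t)) ≤ 1 := by
      rw [Real.exp_le_one_iff]
      have := mul_nonneg hx ht.1
      linarith
    exact mul_le_one₀ h1 (Real.exp_pos _).le h2
  simpa using h

/-- Follows from `(1 + x) e^{-x} ≤ 1`. This quantitative positivity makes `1 / profile` grow at most
quadratically. -/
theorem one_le_mul_expMoment {x : ℝ} (hx : 0 ≤ x) : 1 ≤ (1 + x) * expMoment 0 x := by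
  rcases hx.eq_or_lt with rfl | hx
  · simp [expMoment]
  · have h := mul_expMoment_zero x
    have h1 := Real.add_one_le_exp x
    have h2 : Real.exp (-x) * (1 + x) ≤ 1 := by
      calc Real.exp (-x) * (1 + x) ≤ Real.exp (-x) * Real.exp x := by
            gcongr
            linarith
        _ = 1 := by rw [← Real.exp_add]; simp
    have h3 : x * 1 ≤ x * ((1 + x) * expMoment 0 x) := by
      calc x * 1 ≤ (1 + x) * (1 - Real.exp (-x)) := by linarith
        _ = _ := by rw [← h]; ring
    exact le_of_mul_le_mul_left h3 hx

theorem expMoment_zero_pos {x : ℝ} (hx : 0 ≤ x) : 0 < expMoment 0 x := by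
  have h := one_le_mul_expMoment hx
  by_contra h0
  have : expMoment 0 x = 0 := le_antisymm (not_lt.1 h0) (expMoment_nonneg 0 x)
  rw [this] at h
  norm_num at h

/-- The smooth positive profile `E(|ξ|²/4) = (1 - e^{-|ξ|²/4}) / (|ξ|²/4)`. -/
def profile (r : ℝ) : ℝ := expMoment 0 (r ^ 2 / 4)

theorem profile_pos (r : ℝ) : 0 < profile r := expMoment_zero_pos (by positivity)

theorem continuous_profile : Continuous profile := by
  have : Continuous (expMoment 0) :=
    continuous_iff_continuousAt.2 fun x => (hasDerivAt_expMoment 0 x).continuousAt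
  exact this.comp (by fun_prop)

theorem phi_eq {r : ℝ} (hr : 0 < r) : phi r = profile r / (8 * Real.pi) := by
  have h := mul_expMoment_zero (r ^ 2 / 4)
  have hpi := Real.pi_pos
  rw [phi, profile, neg_div, ← h]
  field_simp
  ring

theorem phi_pos {r : ℝ} (hr : 0 < r) : 0 < phi r := by
  rw [phi_eq hr]
  have := profile_pos r
  have := Real.pi_pos
  positivity

/-- The function `h`, with its value at the origin corrected. -/
def hReg (r : ℝ) : ℝ := Real.exp (-(r ^ 2 / 4)) / profile r

theorem h_eq {r : ℝ} (hr : 0 < r) : h r = hReg r := by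
  have := profile_pos r
  have hpi := Real.pi_pos
  rw [h, phi_eq hr, g, hReg, neg_div]
  field_simp
  ring

theorem continuous_hReg : Continuous hReg :=
  Continuous.div (by fun_prop) continuous_profile fun r => (profile_pos r).ne'

theorem hReg_nonneg (r : ℝ) : 0 ≤ hReg r := div_nonneg (Real.exp_pos _).le (profile_pos r).le

/-- With `x = r²/4` the left side is `4x²/(e^x - 1)`, estimated by a cubic Taylor bound for `e^x`.
What matters is that `16/5` is less than `4`, the smallest value of `n²`. -/
theorem sq_mul_hReg_le (r : ℝ) : r ^ 2 * hReg r ≤ 16 / 5 := by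
  rw [hReg, ← mul_div_assoc, div_le_iff₀ (profile_pos r), profile]
  set x := r ^ 2 / 4 with hx
  have hx0 : 0 ≤ x := by positivity
  have hr : r ^ 2 = 4 * x := by rw [hx]; ring
  rw [hr]
  rcases hx0.eq_or_lt with h0 | h0
  · rw [← h0]
    norm_num [expMoment]
  · have h1 := mul_expMoment_zero x
    have h2 : 1 + x + x ^ 2 / 2 + x ^ 3 / 6 ≤ Real.exp x := by
      have h := Real.sum_le_exp_of_nonneg hx0 4
      simp [Finset.sum_range_succ, Nat.factorial] at h
      linarith
    -- After division by `x` the Taylor bound leaves `4 - 3x + 2x²/3 = (2/3)(x - 9/4)² + 5/8`, which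
    -- is positive.
    have h3 : 5 * x ^ 2 ≤ 4 * (Real.exp x - 1) := by
      nlinarith [mul_nonneg hx0 (sq_nonneg (x - 9 / 4))]
    have h4 : Real.exp (-x) * Real.exp x = 1 := by rw [← Real.exp_add]; simp
    have h5 : x * (4 * x * Real.exp (-x)) ≤ x * (16 / 5 * expMoment 0 x) := by
      have h6 := mul_le_mul_of_nonneg_left h3 (Real.exp_pos (-x)).le
      nlinarith
    exact le_of_mul_le_mul_left h5 h0

theorem tempGrowth_expMoment (k m : ℕ) :
    TempGrowth k (fun ξ : Plane => expMoment m (‖ξ‖ ^ 2 / 4)) := by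
  have hsq : ∀ k, TempGrowth k (fun ξ : Plane => ‖ξ‖ ^ 2) := fun k => tempGrowth_norm_sq k
  have hdiff : ∀ (m : ℕ) (ξ : Plane), HasFDerivAt (fun ξ : Plane => expMoment m (‖ξ‖ ^ 2 / 4))
      (expMoment (m + 1) (‖ξ‖ ^ 2 / 4) • ((-(1 / 2 : ℝ)) • innerSL ℝ ξ)) ξ := by
    intro m ξ
    have h1 : HasFDerivAt (fun ξ : Plane => ‖ξ‖ ^ 2 / 4) ((4 : ℝ)⁻¹ • (2 • innerSL ℝ ξ)) ξ := by
      have h := (hasStrictFDerivAt_norm_sq ξ).hasFDerivAt.const_mul (4 : ℝ)⁻¹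
      simpa only [div_eq_inv_mul] using h
    have h2 := (hasDerivAt_expMoment m (‖ξ‖ ^ 2 / 4)).comp_hasFDerivAt ξ h1
    refine h2.congr_fderiv ?_
    ext u
    simp only [smul_apply, smul_eq_mul, nsmul_eq_mul]
    push_cast
    ring
  have h₀ : ∀ m, TempGrowth 0 (fun ξ : Plane => expMoment m (‖ξ‖ ^ 2 / 4)) := by
    intro m
    refine tempGrowth_zero_iff.2 ⟨continuous_iff_continuousAt.2 fun ξ => (hdiff m ξ).continuousAt,
      0, 1, zero_le_one, fun ξ => ?_⟩
    rw [Real.norm_of_nonneg (expMoment_nonneg _ _)]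
    simpa using expMoment_le_one m (by positivity : 0 ≤ ‖ξ‖ ^ 2 / 4)
  induction k generalizing m with
  | zero => exact h₀ m
  | succ k ih =>
    refine TempGrowth.succ (h₀ m) (fun ξ => (hdiff m ξ).differentiableAt) ?_
    have : fderiv ℝ (fun ξ : Plane => expMoment m (‖ξ‖ ^ 2 / 4))
        = fun ξ => expMoment (m + 1) (‖ξ‖ ^ 2 / 4) • ((-(1 / 2 : ℝ)) • innerSL ℝ ξ) := by
      ext1 ξ
      exact (hdiff m ξ).fderiv
    rw [this]
    exact (ih (m + 1)).smul ((TempGrowth.const k _).smul (tempGrowth_clm k (innerSL ℝ)))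

theorem tempGrowth_profile (k : ℕ) : TempGrowth k (fun ξ : Plane => profile ‖ξ‖) :=
  tempGrowth_expMoment k 0

theorem tempGrowth_profile_inv (k : ℕ) : TempGrowth k (fun ξ : Plane => (profile ‖ξ‖)⁻¹) := by
  refine TempGrowth.inv tempGrowth_profile (fun ξ => profile_pos _) (N := 2) (C := 1)
    (fun ξ => ?_) k
  have h1 : 0 ≤ ‖ξ‖ ^ 2 / 4 := by positivity
  have h := one_le_mul_expMoment h1
  have hp := profile_pos ‖ξ‖
  rw [inv_le_iff_one_le_mul₀ hp, one_mul]
  refine h.trans ?_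
  rw [profile]
  have := expMoment_nonneg 0 (‖ξ‖ ^ 2 / 4)
  gcongr
  nlinarith [norm_nonneg ξ]

/-- `e^{c|ξ|²} hReg(|ξ|)` decays rapidly for `c < 1/4`. -/
theorem rapidDecay_exp_mul_hReg {c : ℝ} (hc : c < 1 / 4) (k : ℕ) :
    RapidDecay k (fun ξ : Plane => Real.exp (c * ‖ξ‖ ^ 2) * hReg ‖ξ‖) := by
  have h := (rapidDecay_exp (H := Plane) (by linarith : 0 < 1 / 4 - c) k).mul
    (tempGrowth_profile_inv k)
  refine (congrArg (RapidDecay k) ?_).mp h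
  ext ξ
  rw [hReg, ← mul_div_assoc, ← Real.exp_add, div_eq_mul_inv]
  congr 2
  ring

end Weights

/-! ### The radial equation as a contraction. -/

section FixedPoint

open scoped BoundedContinuousFunction

/-- The kernel `min(t, 1/t)^n / t`. -/
def dilKer (n : ℕ) (t : ℝ) : ℝ := if t ≤ 1 then t ^ (n - 1) else (t ^ (n + 1))⁻¹

theorem dilKer_nonneg (n : ℕ) {t : ℝ} (ht : 0 < t) : 0 ≤ dilKer n t := by
  unfold dilKer
  split_ifs <;> positivity

theorem dilKer_Ioc (n : ℕ) : Set.EqOn (dilKer n) (fun t => t ^ (n - 1)) (Set.Ioc 0 1) :=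
  fun _ ht => if_pos ht.2

theorem dilKer_Ioi (n : ℕ) : Set.EqOn (dilKer n) (fun t => (t ^ (n + 1))⁻¹) (Set.Ioi 1) :=
  fun _ ht => if_neg (not_le.2 ht)

theorem inv_pow_eq_rpow (n : ℕ) : Set.EqOn (fun t : ℝ => (t ^ (n + 1))⁻¹)
    (fun t => t ^ (-((n : ℝ) + 1))) (Set.Ioi 1) := by
  intro t ht
  have ht0 : 0 < t := one_pos.trans ht
  simp only
  rw [Real.rpow_neg ht0.le]
  norm_cast

theorem integrableOn_dilKer {n : ℕ} (hn : 1 ≤ n) : IntegrableOn (dilKer n) (Set.Ioi 0) := by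
  rw [← Set.Ioc_union_Ioi_eq_Ioi zero_le_one, integrableOn_union]
  constructor
  · refine IntegrableOn.congr_fun ?_ (dilKer_Ioc n).symm measurableSet_Ioc
    exact (Continuous.integrableOn_Icc (by fun_prop)).mono_set Set.Ioc_subset_Icc_self
  · refine IntegrableOn.congr_fun ?_ ((dilKer_Ioi n).trans (inv_pow_eq_rpow n)).symm
      measurableSet_Ioi
    refine integrableOn_Ioi_rpow_of_lt ?_ one_pos
    have : (1 : ℝ) ≤ n := by exact_mod_cast hn
    linarith

theorem integral_dilKer {n : ℕ} (hn : 1 ≤ n) : ∫ t in Set.Ioi 0, dilKer n t = 2 / n := by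
  have h := integrableOn_dilKer hn
  have hn' : (1 : ℝ) ≤ n := by exact_mod_cast hn
  rw [← Set.Ioc_union_Ioi_eq_Ioi zero_le_one] at h ⊢
  rw [setIntegral_union Set.Ioc_disjoint_Ioi_same measurableSet_Ioi
    (h.mono_set Set.subset_union_left) (h.mono_set Set.subset_union_right),
    setIntegral_congr_fun measurableSet_Ioc (dilKer_Ioc n),
    setIntegral_congr_fun measurableSet_Ioi ((dilKer_Ioi n).trans (inv_pow_eq_rpow n)),
    ← intervalIntegral.integral_of_le zero_le_one, integral_pow,
    integral_Ioi_rpow_of_lt (by linarith) one_pos]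
  have h1 : ((n - 1 : ℕ) : ℝ) + 1 = n := by
    rw [Nat.cast_sub hn]
    simp
  have h2 : n - 1 + 1 ≠ 0 := by omega
  rw [h1]
  simp
  field_simp
  norm_num

/-- The averaging operator `U ↦ (1/2n) ∫_0^∞ dilKer(t) U(rt) dt`. -/
def dilAvg (n : ℕ) (U : ℝ → ℂ) (r : ℝ) : ℂ :=
  1 / (2 * n) * ∫ t in Set.Ioi (0 : ℝ), (dilKer n t : ℂ) * U (r * t)

theorem integrableOn_dil {n : ℕ} (hn : 1 ≤ n) {U : ℝ → ℂ} (hU : Continuous U) {C : ℝ}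
    (hC : ∀ s, ‖U s‖ ≤ C) (r : ℝ) :
    IntegrableOn (fun t => (dilKer n t : ℂ) * U (r * t)) (Set.Ioi 0) := by
  refine Integrable.mul_bdd (c := C) (integrableOn_dilKer hn).ofReal ?_
    (Eventually.of_forall fun t => hC _)
  exact (hU.comp (by fun_prop)).aestronglyMeasurable

/-- The kernel is nonnegative of mass `2/n`, and the prefactor `1/(2n)` turns this into `1/n²`. -/
theorem norm_dilAvg_le {n : ℕ} (hn : 1 ≤ n) {U : ℝ → ℂ} {C : ℝ}
    (hC : ∀ s, ‖U s‖ ≤ C) (r : ℝ) : ‖dilAvg n U r‖ ≤ C / n ^ 2 := by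
  have hn' : (0 : ℝ) < n := by exact_mod_cast hn
  have h : ‖∫ t in Set.Ioi (0 : ℝ), (dilKer n t : ℂ) * U (r * t)‖
      ≤ ∫ t in Set.Ioi (0 : ℝ), dilKer n t * C := by
    refine norm_integral_le_of_norm_le ((integrableOn_dilKer hn).mul_const C) ?_
    refine (ae_restrict_iff' measurableSet_Ioi).2 (Eventually.of_forall fun t ht => ?_)
    rw [norm_mul, Complex.norm_real, Real.norm_of_nonneg (dilKer_nonneg n ht)]
    exact mul_le_mul_of_nonneg_left (hC _) (dilKer_nonneg n ht)
  rw [integral_mul_const, integral_dilKer hn] at h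
  rw [dilAvg, norm_mul]
  calc _ ≤ ‖(1 / (2 * n) : ℂ)‖ * (2 / n * C) := by gcongr
    _ = _ := by
      simp
      field_simp

theorem continuous_dilAvg {n : ℕ} (hn : 1 ≤ n) {U : ℝ → ℂ} (hU : Continuous U) {C : ℝ}
    (hC : ∀ s, ‖U s‖ ≤ C) : Continuous (dilAvg n U) := by
  refine continuous_const.mul ?_
  refine continuous_of_dominated (bound := fun t => dilKer n t * C)
    (fun r => (integrableOn_dil hn hU hC r).aestronglyMeasurable) (fun r => ?_)
    ((integrableOn_dilKer hn).mul_const C) (Eventually.of_forall fun t => by fun_prop)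
  refine (ae_restrict_iff' measurableSet_Ioi).2 (Eventually.of_forall fun t ht => ?_)
  rw [norm_mul, Complex.norm_real, Real.norm_of_nonneg (dilKer_nonneg n ht)]
  exact mul_le_mul_of_nonneg_left (hC _) (dilKer_nonneg n ht)

/-- Substituting `s = rt` and moving the factor `s²` into `U` makes the potential a dilation
average, bounded on bounded functions with no weight. -/
theorem dilAvg_eq_radPot {n : ℕ} (hn : 1 ≤ n) {U W : ℝ → ℂ} (hU : Continuous U) {C : ℝ}
    (hC : ∀ s, ‖U s‖ ≤ C) (hUW : ∀ s, 0 < s → U s = -((s : ℂ) ^ 2 * W s)) {r : ℝ} (hr : 0 < r) :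
    dilAvg n U r = radPot n W r := by
  obtain ⟨m, rfl⟩ : ∃ m, n = m + 1 := ⟨n - 1, by omega⟩
  have hrC : (r : ℂ) ≠ 0 := by exact_mod_cast hr.ne'
  have h := integrableOn_dil hn hU hC r
  have h1 : ∫ t in Set.Ioc (0 : ℝ) 1, (dilKer (m + 1) t : ℂ) * U (r * t) = -potP (m + 1) W r := by
    have e : ∫ t in Set.Ioc (0 : ℝ) 1, (dilKer (m + 1) t : ℂ) * U (r * t)
        = ∫ t in Set.Ioc (0 : ℝ) 1,
          (-((r : ℂ) ^ m)⁻¹) * (((r * t : ℝ) : ℂ) ^ (m + 1 + 1) * W (r * t)) := by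
      refine setIntegral_congr_fun measurableSet_Ioc fun t ht => ?_
      rw [dilKer_Ioc _ ht, hUW _ (mul_pos hr ht.1), Nat.add_sub_cancel]
      push_cast
      simp only [mul_pow]
      field_simp
      ring
    rw [e, ← intervalIntegral.integral_of_le zero_le_one, intervalIntegral.integral_const_mul,
      intervalIntegral.integral_comp_mul_left
        (fun s : ℝ => (s : ℂ) ^ (m + 1 + 1) * W s) hr.ne', potP, innerInt, mul_zero, mul_one,
      Complex.real_smul]
    push_cast
    field_simp
    ring
  have h2 : ∫ t in Set.Ioi (1 : ℝ), (dilKer (m + 1) t : ℂ) * U (r * t) = -potQ (m + 1) W r := by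
    have e : ∫ t in Set.Ioi (1 : ℝ), (dilKer (m + 1) t : ℂ) * U (r * t)
        = ∫ t in Set.Ioi (1 : ℝ),
          (-(r : ℂ) ^ (m + 2)) * (((r * t : ℝ) : ℂ) / ((r * t : ℝ) : ℂ) ^ (m + 1) * W (r * t)) := by
      refine setIntegral_congr_fun measurableSet_Ioi fun t ht => ?_
      have ht0 : 0 < t := one_pos.trans ht
      have htC : (t : ℂ) ≠ 0 := by exact_mod_cast ht0.ne'
      rw [dilKer_Ioi _ ht, hUW _ (mul_pos hr ht0)]
      push_cast
      rw [mul_pow, mul_pow]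
      field_simp
      ring
    rw [e, integral_const_mul, integral_comp_mul_left_Ioi
        (fun s : ℝ => (s : ℂ) / (s : ℂ) ^ (m + 1) * W s) 1 hr, potQ, outerInt, mul_one,
      Complex.real_smul]
    push_cast
    field_simp
    ring
  rw [dilAvg, ← Set.Ioc_union_Ioi_eq_Ioi zero_le_one] at *
  rw [setIntegral_union Set.Ioc_disjoint_Ioi_same measurableSet_Ioi
    (h.mono_set Set.subset_union_left) (h.mono_set Set.subset_union_right), h1, h2, radPot]
  ring

theorem dilAvg_zero (n : ℕ) {U : ℝ → ℂ} (hU : U 0 = 0) : dilAvg n U 0 = 0 := by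
  simp [dilAvg, hU]

theorem dilAvg_sub {n : ℕ} (hn : 1 ≤ n) {U V : ℝ → ℂ} (hU : Continuous U) (hV : Continuous V)
    {C D : ℝ} (hC : ∀ s, ‖U s‖ ≤ C) (hD : ∀ s, ‖V s‖ ≤ D) (r : ℝ) :
    dilAvg n U r - dilAvg n V r = dilAvg n (fun s => U s - V s) r := by
  simp only [dilAvg]
  rw [← mul_sub, ← integral_sub (integrableOn_dil hn hU hC r) (integrableOn_dil hn hV hD r)]
  simp only [mul_sub]

/-- The radial equation `-Ψ'' - Ψ'/r + n²Ψ/r² = hΨ + F`, in integrated form, has a bounded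
continuous solution. -/
theorem exists_radial_fixedPoint {n : ℕ} (hn : 2 ≤ n) {F : ℝ → ℂ} (hF : RadialDecay F) :
    ∃ Ω : ℝ → ℂ, Continuous Ω ∧ (∃ C, ∀ s, ‖Ω s‖ ≤ C) ∧ Ω 0 = 0 ∧
      ∀ r, 0 < r → Ω r = radPot n (fun s => -(hReg s * Ω s + F s)) r := by
  have hn1 : 1 ≤ n := by omega
  have hn' : (2 : ℝ) ≤ n := by exact_mod_cast hn
  have hFc := hF.cont
  have hhc := continuous_hReg
  obtain ⟨CF, hCF, hFb⟩ := hF.decay 2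
  -- The decay of `F` is known only on `[0, ∞)`; the even reflection `F |s|` makes `U` bounded on
  -- the whole line.
  let U : (ℝ →ᵇ ℂ) → ℝ → ℂ := fun Ω s =>
    ((s ^ 2 * hReg s : ℝ) : ℂ) * Ω s + ((s ^ 2 : ℝ) : ℂ) * F |s|
  have hUc : ∀ Ω, Continuous (U Ω) := fun Ω => by
    have := Ω.continuous
    fun_prop
  have hH : ∀ s, ‖((s ^ 2 * hReg s : ℝ) : ℂ)‖ ≤ 16 / 5 := fun s => by
    rw [Complex.norm_real, Real.norm_of_nonneg (mul_nonneg (sq_nonneg s) (hReg_nonneg s))]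
    exact sq_mul_hReg_le s
  have hUb : ∀ Ω s, ‖U Ω s‖ ≤ 16 / 5 * ‖Ω‖ + CF := fun Ω s => by
    refine (norm_add_le _ _).trans (add_le_add ?_ ?_)
    · rw [norm_mul]
      exact mul_le_mul (hH s) (Ω.norm_coe_le_norm s) (norm_nonneg _) (by norm_num)
    · rw [norm_mul, Complex.norm_real, Real.norm_of_nonneg (sq_nonneg s), ← sq_abs]
      refine le_trans ?_ (hFb |s| (abs_nonneg s))
      gcongr
      linarith
  let T : (ℝ →ᵇ ℂ) → (ℝ →ᵇ ℂ) := fun Ω =>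
    BoundedContinuousFunction.ofNormedAddCommGroup (dilAvg n (U Ω))
      (continuous_dilAvg hn1 (hUc Ω) (hUb Ω)) _ (norm_dilAvg_le hn1 (hUb Ω))
  -- The constant is `16/5` from the bound on `s² hReg s`, divided by `n² ≥ 4`.
  have hT : ContractingWith (4 / 5) T := by
    refine ⟨by norm_num, LipschitzWith.of_dist_le_mul fun Ω Ω' => ?_⟩
    rw [BoundedContinuousFunction.dist_le (by positivity)]
    intro r
    change dist (dilAvg n (U Ω) r) (dilAvg n (U Ω') r) ≤ _
    rw [dist_eq_norm, dilAvg_sub hn1 (hUc Ω) (hUc Ω') (hUb Ω) (hUb Ω')]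
    have hb : ∀ s, ‖U Ω s - U Ω' s‖ ≤ 16 / 5 * dist Ω Ω' := by
      intro s
      have : U Ω s - U Ω' s = ((s ^ 2 * hReg s : ℝ) : ℂ) * (Ω s - Ω' s) := by
        simp only [U]
        ring
      rw [this, norm_mul, ← dist_eq_norm]
      exact mul_le_mul (hH s) (BoundedContinuousFunction.dist_coe_le_dist s) dist_nonneg
        (by norm_num)
    refine (norm_dilAvg_le hn1 hb r).trans ?_
    rw [div_le_iff₀ (by positivity)]
    have h4 : (4 : ℝ) ≤ n ^ 2 := by nlinarith
    have hd := dist_nonneg (x := Ω) (y := Ω')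
    push_cast
    nlinarith
  obtain ⟨Ω, hΩ⟩ : ∃ Ω, T Ω = Ω := ⟨_, hT.fixedPoint_isFixedPt⟩
  have hΩ' : ∀ r, dilAvg n (U Ω) r = Ω r := fun r => congrArg (fun f : ℝ →ᵇ ℂ => f r) hΩ
  refine ⟨Ω, Ω.continuous, ⟨‖Ω‖, Ω.norm_coe_le_norm⟩, ?_, fun r hr => ?_⟩
  · rw [← hΩ', dilAvg_zero]
    simp [U]
  · rw [← hΩ']
    refine dilAvg_eq_radPot hn1 (hUc Ω) (hUb Ω) (fun s hs => ?_) hr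
    simp only [U, abs_of_pos hs]
    push_cast
    ring

end FixedPoint

/-! ### Uniqueness for the radial equation, and decay of the potential at both ends. -/

section RadialODE

theorem h_lt {n : ℕ} (hn : 2 ≤ n) {r : ℝ} (hr : 0 < r) : 0 < (n : ℝ) ^ 2 / r ^ 2 - h r := by
  have h1 := sq_mul_hReg_le r
  have hn' : (2 : ℝ) ≤ n := by exact_mod_cast hn
  rw [h_eq hr, sub_pos, lt_div_iff₀ (by positivity)]
  nlinarith

/-- `u` solves `-u'' - u'/r + (n²/r² - h) u = f` on `(0, ∞)`. -/
def SolvesRadial (n : ℕ) (f u u' u'' : ℝ → ℝ) : Prop :=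
  ∀ r, 0 < r → HasDerivAt u (u' r) r ∧ HasDerivAt u' (u'' r) r ∧
    -(u'' r + u' r / r) + ((n : ℝ) ^ 2 / r ^ 2 - h r) * u r = f r

theorem SolvesRadial.sub {n : ℕ} {f u u' u'' g v v' v'' : ℝ → ℝ}
    (hu : SolvesRadial n f u u' u'') (hv : SolvesRadial n g v v' v'') :
    SolvesRadial n (f - g) (u - v) (u' - v') (u'' - v'') := by
  intro r hr
  obtain ⟨a1, a2, a3⟩ := hu r hr
  obtain ⟨b1, b2, b3⟩ := hv r hr
  refine ⟨a1.sub b1, a2.sub b2, ?_⟩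
  simp only [Pi.sub_apply]
  rw [← a3, ← b3]
  ring

/-- Maximum principle: a positive value forces a positive interior maximum, by the limits at both
ends. There `u' = 0` and `u'' = (n²/r² - h) u > 0`. -/
theorem SolvesRadial.nonpos {n : ℕ} (hn : 2 ≤ n) {u u' u'' : ℝ → ℝ}
    (hu : SolvesRadial n 0 u u' u'') (h0 : Tendsto u (𝓝[>] 0) (𝓝 0))
    (hinf : Tendsto u atTop (𝓝 0)) {r : ℝ} (hr : 0 < r) : u r ≤ 0 := by
  by_contra! hpos
  obtain ⟨a, ha, hua⟩ : ∃ a, 0 < a ∧ ∀ s, 0 < s → s < a → u s < u r := by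
    have := h0.eventually_lt_const hpos
    rw [eventually_nhdsWithin_iff, Metric.eventually_nhds_iff] at this
    obtain ⟨ε, hε, h⟩ := this
    exact ⟨ε, hε, fun s hs hsa => h (by simpa [abs_of_pos hs] using hsa) hs⟩
  obtain ⟨b, hub⟩ := eventually_atTop.1 (hinf.eventually_lt_const hpos)
  have hra : a ≤ r := by
    by_contra! hlt
    exact lt_irrefl _ (hua r hr hlt)
  have hrb : r < b := by
    by_contra! hlt
    exact lt_irrefl _ (hub r hlt)
  have hcont : ContinuousOn u (Set.Icc a b) := fun s hs =>
    ((hu s (ha.trans_le hs.1)).1.continuousAt).continuousWithinAt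
  obtain ⟨m, hm, hmax⟩ := isCompact_Icc.exists_isMaxOn ⟨r, hra, hrb.le⟩ hcont
  have hm0 : 0 < m := ha.trans_le hm.1
  have hrm : u r ≤ u m := hmax ⟨hra, hrb.le⟩
  have hglob : ∀ s, 0 < s → u s ≤ u m := by
    intro s hs
    rcases lt_or_ge s a with h1 | h1
    · exact (hua s hs h1).le.trans hrm
    rcases le_or_gt b s with h2 | h2
    · exact (hub s h2).le.trans hrm
    · exact hmax ⟨h1, h2.le⟩
  have hloc : IsLocalMax u m := by
    filter_upwards [Ioi_mem_nhds hm0] with s hs using hglob s hs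
  obtain ⟨d1, d2, e⟩ := hu m hm0
  have hd : u' m = 0 := hloc.hasDerivAt_eq_zero d1
  have hd2 : 0 < u'' m := by
    have h1 := mul_pos (h_lt hn hm0) (hpos.trans_le hrm)
    rw [hd] at e
    simp only [zero_div, add_zero, Pi.zero_apply] at e
    linarith
  have hderiv : deriv u =ᶠ[𝓝 m] u' := by
    filter_upwards [Ioi_mem_nhds hm0] with s hs using (hu s hs).1.deriv
  -- By the second derivative test the maximum is also a local minimum. Thus `u` is locally
  -- constant, against `u'' > 0`.
  have hmin : IsLocalMin u m := by
    refine isLocalMin_of_deriv_deriv_pos ?_ (by rw [d1.deriv, hd]) d1.continuousAt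
    rw [hderiv.deriv_eq, d2.deriv]
    exact hd2
  have hconst : u =ᶠ[𝓝 m] fun _ => u m := by
    filter_upwards [hloc, hmin] with s h1 h2 using le_antisymm h1 h2
  have h1 : deriv u =ᶠ[𝓝 m] deriv fun _ => u m := hconst.deriv
  have h2 := (hderiv.symm.trans h1).deriv_eq
  rw [d2.deriv] at h2
  simp at h2
  exact hd2.ne' h2

theorem SolvesRadial.eq {n : ℕ} (hn : 2 ≤ n) {f u u' u'' v v' v'' : ℝ → ℝ}
    (hu : SolvesRadial n f u u' u'') (hv : SolvesRadial n f v v' v'')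
    (hu0 : Tendsto u (𝓝[>] 0) (𝓝 0)) (hv0 : Tendsto v (𝓝[>] 0) (𝓝 0))
    (huinf : Tendsto u atTop (𝓝 0)) (hvinf : Tendsto v atTop (𝓝 0)) {r : ℝ} (hr : 0 < r) :
    u r = v r := by
  have d1 := hu.sub hv
  have d2 := hv.sub hu
  rw [sub_self] at d1 d2
  have a1 := hu0.sub hv0
  have a2 := huinf.sub hvinf
  have b1 := hv0.sub hu0
  have b2 := hvinf.sub huinf
  rw [sub_self] at a1 a2 b1 b2
  have h1 := d1.nonpos hn a1 a2 hr
  have h2 := d2.nonpos hn b1 b2 hr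
  simp only [Pi.sub_apply] at h1 h2
  linarith

theorem isRadialSolution_iff {n : ℕ} {a Ω : ℝ → ℝ} : IsRadialSolution n a Ω ↔
    SolvesRadial n (fun r => a r / (n * phi r)) Ω (deriv Ω) (deriv (deriv Ω)) ∧
      Ω =O[𝓝[>] (0 : ℝ)] (fun r : ℝ => r ^ n) ∧ Ω =O[atTop] (fun r : ℝ => (r ^ n)⁻¹) := by
  have key : ∀ r, 0 < r → DifferentiableAt ℝ (deriv Ω) r →
      -(1 / r) * deriv (fun s : ℝ => s * deriv Ω s) r = -(deriv (deriv Ω) r + deriv Ω r / r) := by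
    intro r hr hd
    have h1 : HasDerivAt (fun s : ℝ => s * deriv Ω s) (1 * deriv Ω r + r * deriv (deriv Ω) r) r :=
      (hasDerivAt_id r).mul hd.hasDerivAt
    rw [h1.deriv]
    field_simp
    ring
  constructor
  · rintro ⟨h1, h2, h3, h4, h5⟩
    refine ⟨fun r hr => ⟨(h1 r hr).hasDerivAt, (h2 r hr).hasDerivAt, ?_⟩, h4, h5⟩
    rw [← key r hr (h2 r hr), h3 r hr]
  · rintro ⟨h1, h4, h5⟩
    refine ⟨fun r hr => (h1 r hr).1.differentiableAt, fun r hr => (h1 r hr).2.1.differentiableAt,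
      fun r hr => ?_, h4, h5⟩
    rw [key r hr (h1 r hr).2.1.differentiableAt, (h1 r hr).2.2]

theorem SolvesRadial.deriv {n : ℕ} {f u u' u'' : ℝ → ℝ} (hu : SolvesRadial n f u u' u'') :
    SolvesRadial n f u (deriv u) (deriv (deriv u)) := by
  intro r hr
  obtain ⟨d1, d2, e⟩ := hu r hr
  have hderiv : _root_.deriv u =ᶠ[𝓝 r] u' := by
    filter_upwards [Ioi_mem_nhds hr] with s hs using (hu s hs).1.deriv
  rw [hderiv.deriv_eq, d1.deriv, d2.deriv]
  exact ⟨d1, d2.congr_of_eventuallyEq hderiv, e⟩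

theorem tendsto_zero_of_isBigO_pow {n : ℕ} (hn : n ≠ 0) {u : ℝ → ℝ}
    (hu : u =O[𝓝[>] (0 : ℝ)] (fun r : ℝ => r ^ n)) : Tendsto u (𝓝[>] 0) (𝓝 0) := by
  refine hu.trans_tendsto ?_
  have : Tendsto (fun r : ℝ => r ^ n) (𝓝 0) (𝓝 (0 ^ n)) := (continuous_pow n).tendsto 0
  rw [zero_pow hn] at this
  exact this.mono_left nhdsWithin_le_nhds

theorem tendsto_zero_of_isBigO_inv_pow {n : ℕ} (hn : n ≠ 0) {u : ℝ → ℝ}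
    (hu : u =O[atTop] (fun r : ℝ => (r ^ n)⁻¹)) : Tendsto u atTop (𝓝 0) :=
  hu.trans_tendsto (tendsto_pow_atTop hn).inv_tendsto_atTop

/-- Real and imaginary parts of the radial potential solve the radial equation. -/
theorem solvesRadial_radPot {n : ℕ} (hn : 1 ≤ n) {W : ℝ → ℂ} (hW : RadialDecay W)
    (L : ℂ →L[ℝ] ℝ) :
    SolvesRadial n (fun r => -L (W r) - h r * L (radPot n W r)) (fun r => L (radPot n W r))
      (fun r => L ((potP n W r - potQ n W r) / 2) / r)
      (fun r => (L (r * W r + n ^ 2 / r * radPot n W r) * r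
        - L ((potP n W r - potQ n W r) / 2)) / r ^ 2) := by
  intro r hr
  have hrC : (r : ℂ) ≠ 0 := by exact_mod_cast hr.ne'
  refine ⟨?_, ?_, ?_⟩
  · have h1 := L.hasFDerivAt.comp_hasDerivAt r (hasDerivAt_radPot hW hn hr)
    refine h1.congr_deriv ?_
    rw [show (potP n W r - potQ n W r) / (2 * r)
      = (r⁻¹ : ℝ) • ((potP n W r - potQ n W r) / 2) by
        rw [Complex.real_smul]; push_cast; field_simp, map_smul, smul_eq_mul]
    ring
  · have h1 := L.hasFDerivAt.comp_hasDerivAt r (hasDerivAt_mul_deriv_radPot hW hn hr)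
    have h2 := h1.div (hasDerivAt_id r) hr.ne'
    refine h2.congr_deriv ?_
    simp
  · have e : L (r * W r + n ^ 2 / r * radPot n W r)
        = r * L (W r) + n ^ 2 / r * L (radPot n W r) := by
      rw [map_add, show (r : ℂ) * W r = r • W r by rw [Complex.real_smul],
        show (n : ℂ) ^ 2 / r * radPot n W r = ((n : ℝ) ^ 2 / r) • radPot n W r by
          rw [Complex.real_smul]; push_cast; rfl, map_smul, map_smul, smul_eq_mul, smul_eq_mul]
    beta_reduce
    rw [e]
    field_simp
    ring

theorem norm_radPot_le_of {n : ℕ} (hn : 1 ≤ n) {W : ℝ → ℂ} {r A B : ℝ} (hA : ‖potP n W r‖ ≤ A)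
    (hB : ‖potQ n W r‖ ≤ B) : ‖radPot n W r‖ ≤ A + B := by
  have hn' : (1 : ℝ) ≤ n := by exact_mod_cast hn
  have h1 := (norm_nonneg _).trans hA
  have h2 := (norm_nonneg _).trans hB
  rw [radPot, norm_div, norm_neg, div_le_iff₀ (by simp; omega)]
  refine ((norm_add_le _ _).trans (add_le_add hA hB)).trans ?_
  simp only [norm_mul, Complex.norm_ofNat, Complex.norm_natCast]
  nlinarith

/-- The moment `∫ s^{n+1} |W|` controls both parts: for `s > r` one has `s^{1-n} ≤ r^{-2n} s^{n+1}`.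
-/
theorem norm_radPot_le_inv_pow {n : ℕ} (hn : 1 ≤ n) {W : ℝ → ℂ} (hW : RadialDecay W) :
    ∃ C, ∀ r, 0 < r → ‖radPot n W r‖ ≤ C * (r ^ n)⁻¹ := by
  have hint := (hW.integrableOn (n + 1)).norm
  set K := ∫ s in Set.Ioi (0 : ℝ), ‖(s : ℂ) ^ (n + 1) * W s‖
  refine ⟨2 * K, fun r hr => ?_⟩
  have hsub : ∀ S : Set ℝ, S ⊆ Set.Ioi 0 → ∫ s in S, ‖(s : ℂ) ^ (n + 1) * W s‖ ≤ K := fun S hS =>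
    setIntegral_mono_set hint (Eventually.of_forall fun s => norm_nonneg _)
      (Eventually.of_forall hS)
  rw [two_mul, add_mul]
  refine norm_radPot_le_of hn ?_ ?_
  · rw [potP, norm_div, norm_pow, Complex.norm_real, Real.norm_of_nonneg hr.le, div_eq_mul_inv]
    gcongr
    rw [innerInt, intervalIntegral.integral_of_le hr.le]
    exact (norm_integral_le_integral_norm _).trans (hsub _ fun s hs => hs.1)
  · rw [potQ, norm_mul, norm_pow, Complex.norm_real, Real.norm_of_nonneg hr.le,
      ← div_eq_mul_inv, le_div_iff₀ (by positivity)]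
    have h1 : ‖outerInt n W r‖ ≤
        ∫ s in Set.Ioi r, ((r ^ n)⁻¹ * (r ^ n)⁻¹) * ‖(s : ℂ) ^ (n + 1) * W s‖ := by
      refine norm_integral_le_of_norm_le
        ((IntegrableOn.mono_set hint (Set.Ioi_subset_Ioi hr.le)).const_mul _) ?_
      refine (ae_restrict_iff' measurableSet_Ioi).2 (Eventually.of_forall fun s hs => ?_)
      have hs : r < s := hs
      have hs0 : 0 < s := hr.trans hs
      simp only [norm_mul, norm_div, norm_pow, Complex.norm_real, Real.norm_of_nonneg hs0.le]
      rw [← mul_assoc]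
      refine mul_le_mul_of_nonneg_right ?_ (norm_nonneg _)
      have h3 : r ^ n ≤ s ^ n := by gcongr
      rw [← mul_inv, inv_mul_eq_div, div_le_div_iff₀ (by positivity) (by positivity)]
      calc s * (r ^ n * r ^ n) ≤ s * (s ^ n * s ^ n) := by gcongr
        _ = s ^ (n + 1) * s ^ n := by ring
    rw [integral_const_mul] at h1
    have h2 := hsub (Set.Ioi r) (Set.Ioi_subset_Ioi hr.le)
    calc _ ≤ r ^ n * (((r ^ n)⁻¹ * (r ^ n)⁻¹) * K) * r ^ n := by
          gcongr
          exact h1.trans (by gcongr)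
      _ = K := by
          field_simp

/-- Since `W = O(s^n)` near zero, `∫ s^{1-n} |W|` converges. It controls both parts, as `s^{n+1} ≤
r^{2n} s^{1-n}` for `s ≤ r`. -/
theorem norm_radPot_le_pow {n : ℕ} (hn : 1 ≤ n) {W : ℝ → ℂ} (hW : RadialDecay W)
    (h0 : ∃ C, ∀ s, 0 < s → s ≤ 1 → ‖W s‖ ≤ C * s ^ n) :
    ∃ C, ∀ r, 0 < r → ‖radPot n W r‖ ≤ C * r ^ n := by
  obtain ⟨C, hC⟩ := h0
  have hint : IntegrableOn (fun s : ℝ => ‖(s : ℂ) / s ^ n * W s‖) (Set.Ioi 0) := by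
    have hc := hW.cont
    rw [← Set.Ioc_union_Ioi_eq_Ioi zero_le_one, integrableOn_union]
    refine ⟨?_, (integrableOn_outer hW hn one_pos).norm⟩
    have hconst : IntegrableOn (fun _ : ℝ => C) (Set.Ioc 0 1) := by simp
    refine hconst.mono' ?_
      ((ae_restrict_iff' measurableSet_Ioc).2 (Eventually.of_forall fun s hs => ?_))
    · exact (AEStronglyMeasurable.mul (Measurable.aestronglyMeasurable (by fun_prop))
        hc.aestronglyMeasurable).norm
    · have hs0 : 0 < s := hs.1
      have h1 := hC s hs.1 hs.2
      simp only [norm_mul, norm_div, norm_pow, Complex.norm_real, norm_norm,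
        Real.norm_of_nonneg hs0.le]
      have hC0 : 0 ≤ C := by
        by_contra! hneg
        have := (norm_nonneg _).trans h1
        nlinarith [pow_pos hs0 n]
      calc s / s ^ n * ‖W s‖ ≤ s / s ^ n * (C * s ^ n) := by gcongr
        _ = s * C := by field_simp
        _ ≤ C := mul_le_of_le_one_left hC0 hs.2
  set K := ∫ s in Set.Ioi (0 : ℝ), ‖(s : ℂ) / s ^ n * W s‖
  refine ⟨2 * K, fun r hr => ?_⟩
  have hsub : ∀ S : Set ℝ, S ⊆ Set.Ioi 0 → ∫ s in S, ‖(s : ℂ) / s ^ n * W s‖ ≤ K := fun S hS =>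
    setIntegral_mono_set hint (Eventually.of_forall fun s => norm_nonneg _)
      (Eventually.of_forall hS)
  rw [two_mul, add_mul]
  refine norm_radPot_le_of hn ?_ ?_
  · have h1 : ‖innerInt n W r‖ ≤
        ∫ s in Set.Ioc 0 r, (r ^ n * r ^ n) * ‖(s : ℂ) / s ^ n * W s‖ := by
      rw [innerInt, intervalIntegral.integral_of_le hr.le]
      refine norm_integral_le_of_norm_le
        ((IntegrableOn.mono_set hint fun s hs => hs.1).const_mul _) ?_
      refine (ae_restrict_iff' measurableSet_Ioc).2 (Eventually.of_forall fun s hs => ?_)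
      have hs0 : 0 < s := hs.1
      simp only [norm_mul, norm_div, norm_pow, Complex.norm_real, Real.norm_of_nonneg hs0.le]
      rw [← mul_assoc]
      refine mul_le_mul_of_nonneg_right ?_ (norm_nonneg _)
      have h3 : s ^ n ≤ r ^ n := by
        gcongr
        exact hs.2
      rw [← mul_div_assoc, le_div_iff₀ (by positivity)]
      calc s ^ (n + 1) * s ^ n = s ^ n * s ^ n * s := by ring
        _ ≤ _ := by gcongr
    rw [integral_const_mul] at h1
    have h2 := hsub (Set.Ioc 0 r) fun s hs => hs.1
    rw [potP, norm_div, norm_pow, Complex.norm_real, Real.norm_of_nonneg hr.le,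
      div_le_iff₀ (by positivity)]
    calc _ ≤ (r ^ n * r ^ n) * K := h1.trans (by gcongr)
      _ = _ := by ring
  · rw [potQ, norm_mul, norm_pow, Complex.norm_real, Real.norm_of_nonneg hr.le, mul_comm]
    gcongr
    exact (norm_integral_le_integral_norm _).trans (hsub _ (Set.Ioi_subset_Ioi hr.le))

end RadialODE

/-! ### Vanishing of high angular modes at the origin. -/

section FourierCoefficients

open Complex

theorem integral_exp_int_mul {m : ℤ} (hm : m ≠ 0) :
    ∫ θ in (-Real.pi)..Real.pi, exp (m * θ * I) = 0 := by
  have hc : (m : ℂ) * I ≠ 0 := mul_ne_zero (by exact_mod_cast hm) I_ne_zero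
  have h := integral_exp_mul_complex (a := -Real.pi) (b := Real.pi) hc
  have e : ∀ θ : ℝ, exp (m * θ * I) = exp (m * I * θ) := fun θ => by ring_nf
  simp_rw [e]
  rw [h, div_eq_zero_iff, sub_eq_zero]
  left
  rw [exp_eq_exp_iff_exists_int]
  exact ⟨m, by push_cast; ring⟩

/-- The `m`-th angular Fourier integral of `w` on the circle of radius `r`. -/
def fourierInt (m : ℤ) (w : Plane → ℝ) (r : ℝ) : ℂ :=
  ∫ θ in (-Real.pi)..Real.pi, (w (polar r θ) : ℂ) * exp (m * θ * I)

theorem norm_exp_int_mul (m : ℤ) (θ : ℝ) : ‖exp (m * θ * I)‖ = 1 := by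
  have : (m * θ * I : ℂ) = ((m * θ : ℝ) : ℂ) * I := by push_cast; rfl
  rw [this, norm_exp_ofReal_mul_I]

theorem polar_eq_smul (r θ : ℝ) : polar r θ = r • polar 1 θ := by
  apply toC.injective
  rw [map_smul, toC_polar, toC_polar, real_smul, ofReal_one, one_mul]

theorem hasDerivAt_polar (r θ : ℝ) : HasDerivAt (fun r => polar r θ) (polar 1 θ) r := by
  have h := (hasDerivAt_id r).smul_const (polar 1 θ)
  rw [one_smul] at h
  exact h.congr_of_eventuallyEq (Eventually.of_forall fun s => polar_eq_smul s θ)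

theorem continuous_polar_right (r : ℝ) : Continuous fun θ : ℝ => polar r θ :=
  continuous_polar.comp (by fun_prop : Continuous fun θ : ℝ => (r, θ))

/-- Partial derivatives. -/
def partialDeriv (j : Fin 2) (w : Plane → ℝ) (x : Plane) : ℝ :=
  fderiv ℝ w x (EuclideanSpace.single j 1)

theorem RapidDecay.partialDeriv {w : Plane → ℝ} {k : ℕ} (hw : RapidDecay (k + 1) w) (j : Fin 2) :
    RapidDecay k (partialDeriv j w) :=
  hw.fderiv.clm_comp (ContinuousLinearMap.apply ℝ ℝ (EuclideanSpace.single j (1 : ℝ)))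

theorem fderiv_polar_one (w : Plane → ℝ) (x : Plane) (θ : ℝ) : fderiv ℝ w x (polar 1 θ)
    = Real.cos θ * partialDeriv 0 w x + Real.sin θ * partialDeriv 1 w x := by
  have : polar 1 θ = Real.cos θ • EuclideanSpace.single (0 : Fin 2) (1 : ℝ)
      + Real.sin θ • EuclideanSpace.single (1 : Fin 2) (1 : ℝ) := by
    ext i
    fin_cases i <;> simp [polar]
  rw [this, map_add, map_smul, map_smul]
  rfl

theorem intervalIntegrable_fourier {w : Plane → ℝ} (hw : Continuous w) (m : ℤ) (r : ℝ) :
    IntervalIntegrable (fun θ : ℝ => (w (polar r θ) : ℂ) * exp (m * θ * I)) volume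
      (-Real.pi) Real.pi := by
  refine Continuous.intervalIntegrable ?_ _ _
  exact (continuous_ofReal.comp (hw.comp (continuous_polar_right r))).mul (by fun_prop)

/-- The radial derivative is `cos θ ∂₀ + sin θ ∂₁`, and multiplication by `cos θ` or `sin θ` shifts
the frequency by `±1`. Each derivative thus costs one unit of frequency. -/
theorem hasDerivAt_fourierInt {w : Plane → ℝ} (hw : RapidDecay 1 w) (m : ℤ) (r : ℝ) :
    HasDerivAt (fourierInt m w)
      (1 / 2 * (fourierInt (m + 1) (partialDeriv 0 w) r + fourierInt (m - 1) (partialDeriv 0 w) r)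
        - I / 2 * (fourierInt (m + 1) (partialDeriv 1 w) r
          - fourierInt (m - 1) (partialDeriv 1 w) r)) r := by
  have hd : Differentiable ℝ w := hw.1.differentiable (by simp)
  have hw' : RapidDecay 0 (fderiv ℝ w) := RapidDecay.fderiv hw
  have hp : ∀ j, Continuous (partialDeriv j w) := fun j =>
    (RapidDecay.partialDeriv (k := 0) hw j).1.continuous
  obtain ⟨C, hC, hb⟩ := (rapidDecay_zero_iff.1 hw').2 0
  have hcont : ∀ r, Continuous fun θ : ℝ => (w (polar r θ) : ℂ) * exp (m * θ * I) := fun r =>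
    (continuous_ofReal.comp (hd.continuous.comp (continuous_polar_right r))).mul (by fun_prop)
  have hcont' : Continuous fun θ : ℝ =>
      ((fderiv ℝ w (polar r θ) (polar 1 θ) : ℝ) : ℂ) * exp (m * θ * I) :=
    (continuous_ofReal.comp ((hw'.1.continuous.comp (continuous_polar_right r)).clm_apply
      (continuous_polar_right 1))).mul (by fun_prop)
  have h := intervalIntegral.hasDerivAt_integral_of_dominated_loc_of_deriv_le
    (μ := volume) (F := fun (r θ : ℝ) => (w (polar r θ) : ℂ) * exp (m * θ * I))
    (F' := fun (r θ : ℝ) => ((fderiv ℝ w (polar r θ) (polar 1 θ) : ℝ) : ℂ) * exp (m * θ * I))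
    (a := -Real.pi) (b := Real.pi) (x₀ := r) (bound := fun _ => C)
    (Metric.ball_mem_nhds r one_pos)
    (Eventually.of_forall fun r => (hcont r).aestronglyMeasurable)
    ((hcont r).intervalIntegrable _ _) hcont'.aestronglyMeasurable ?_
    (continuous_const.intervalIntegrable _ _) ?_
  · refine h.2.congr_deriv ?_
    have hi := fun j m => intervalIntegrable_fourier (hp j) m r
    simp only [fourierInt]
    rw [← intervalIntegral.integral_add (hi 0 _) (hi 0 _),
      ← intervalIntegral.integral_sub (hi 1 _) (hi 1 _),
      ← intervalIntegral.integral_const_mul, ← intervalIntegral.integral_const_mul,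
      ← intervalIntegral.integral_sub (((hi 0 _).add (hi 0 _)).const_mul _)
        (((hi 1 _).sub (hi 1 _)).const_mul _)]
    congr 1
    ext θ
    have e1 : exp (((m + 1 : ℤ) : ℂ) * θ * I) = exp (m * θ * I) * exp (θ * I) := by
      rw [← exp_add]
      push_cast
      ring_nf
    have e2 : exp (((m - 1 : ℤ) : ℂ) * θ * I) = exp (m * θ * I) * exp (-θ * I) := by
      rw [← exp_add]
      push_cast
      ring_nf
    rw [fderiv_polar_one, e1, e2]
    push_cast
    rw [cos, sin]
    ring
  · refine Eventually.of_forall fun θ _ y _ => ?_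
    rw [norm_mul, norm_exp_int_mul, mul_one, norm_real]
    refine (ContinuousLinearMap.le_opNorm _ _).trans ?_
    rw [norm_polar zero_le_one, mul_one]
    simpa using hb (polar y θ)
  · refine Eventually.of_forall fun θ _ y _ => ?_
    have h1 := (hd (polar y θ)).hasFDerivAt.comp_hasDerivAt y (hasDerivAt_polar y θ)
    exact h1.ofReal_comp.mul_const _

/-- High angular Fourier modes of smooth functions vanish to high order at the origin. -/
theorem fourierInt_bound (n : ℕ) : ∀ (w : Plane → ℝ) (_ : ∀ k, RapidDecay k w) (m : ℤ)
    (_ : (n : ℤ) ≤ |m|), ∃ C : ℝ, 0 ≤ C ∧ ∀ r, 0 ≤ r → ‖fourierInt m w r‖ ≤ C * r ^ n := by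
  induction n with
  | zero =>
    intro w hw m _
    obtain ⟨C, hC, hb⟩ := (rapidDecay_zero_iff.1 (hw 0)).2 0
    refine ⟨C * |Real.pi - -Real.pi|, by positivity, fun r _ => ?_⟩
    rw [pow_zero, mul_one]
    refine intervalIntegral.norm_integral_le_of_norm_le_const fun θ _ => ?_
    rw [norm_mul, norm_exp_int_mul, mul_one, norm_real]
    simpa using hb (polar r θ)
  | succ n ih =>
    intro w hw m hm
    have hp : ∀ j k, RapidDecay k (partialDeriv j w) := fun j k => (hw (k + 1)).partialDeriv j
    have h1 : (n : ℤ) ≤ |m + 1| := by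
      push_cast at hm
      cases abs_cases m <;> cases abs_cases (m + 1) <;> omega
    have h2 : (n : ℤ) ≤ |m - 1| := by
      push_cast at hm
      cases abs_cases m <;> cases abs_cases (m - 1) <;> omega
    have hm0 : m ≠ 0 := by
      rintro rfl
      simp at hm
      omega
    obtain ⟨C₁, hC₁, b₁⟩ := ih _ (hp 0) _ h1
    obtain ⟨C₂, hC₂, b₂⟩ := ih _ (hp 0) _ h2
    obtain ⟨C₃, hC₃, b₃⟩ := ih _ (hp 1) _ h1
    obtain ⟨C₄, hC₄, b₄⟩ := ih _ (hp 1) _ h2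
    refine ⟨C₁ + C₂ + C₃ + C₄, by positivity, fun r hr => ?_⟩
    have hzero : fourierInt m w 0 = 0 := by
      have hp0 : ∀ θ, polar 0 θ = 0 := fun θ => by rw [polar_eq_smul, zero_smul]
      simp only [fourierInt, hp0]
      rw [intervalIntegral.integral_const_mul, integral_exp_int_mul hm0, mul_zero]
    have hb : ∀ s ∈ Set.Icc 0 r, ‖1 / 2 * (fourierInt (m + 1) (partialDeriv 0 w) s
          + fourierInt (m - 1) (partialDeriv 0 w) s)
        - I / 2 * (fourierInt (m + 1) (partialDeriv 1 w) s
          - fourierInt (m - 1) (partialDeriv 1 w) s)‖ ≤ (C₁ + C₂ + C₃ + C₄) * r ^ n := by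
      intro s hs
      have hsr : s ^ n ≤ r ^ n := pow_le_pow_left₀ hs.1 hs.2 n
      have k1 := (b₁ s hs.1).trans (mul_le_mul_of_nonneg_left hsr hC₁)
      have k2 := (b₂ s hs.1).trans (mul_le_mul_of_nonneg_left hsr hC₂)
      have k3 := (b₃ s hs.1).trans (mul_le_mul_of_nonneg_left hsr hC₃)
      have k4 := (b₄ s hs.1).trans (mul_le_mul_of_nonneg_left hsr hC₄)
      refine (norm_sub_le _ _).trans ?_
      rw [norm_mul, norm_mul]
      have e1 : ‖(1 / 2 : ℂ)‖ = 1 / 2 := by simp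
      have e2 : ‖(I / 2 : ℂ)‖ = 1 / 2 := by simp
      rw [e1, e2]
      have a1 := norm_add_le (fourierInt (m + 1) (partialDeriv 0 w) s)
        (fourierInt (m - 1) (partialDeriv 0 w) s)
      have a2 := norm_sub_le (fourierInt (m + 1) (partialDeriv 1 w) s)
        (fourierInt (m - 1) (partialDeriv 1 w) s)
      nlinarith [norm_nonneg (fourierInt (m + 1) (partialDeriv 0 w) s),
        norm_nonneg (fourierInt (m - 1) (partialDeriv 0 w) s),
        norm_nonneg (fourierInt (m + 1) (partialDeriv 1 w) s),
        norm_nonneg (fourierInt (m - 1) (partialDeriv 1 w) s)]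
    -- The mean value inequality on `[0, r]` supplies the extra factor `r`.
    have h := Convex.norm_image_sub_le_of_norm_hasDerivWithin_le
      (fun s _ => (hasDerivAt_fourierInt (hw 1) m s).hasDerivWithinAt) hb (convex_Icc 0 r)
      (Set.left_mem_Icc.2 hr) (Set.right_mem_Icc.2 hr)
    rw [hzero, sub_zero, sub_zero, Real.norm_of_nonneg hr] at h
    refine h.trans (le_of_eq ?_)
    ring

theorem fourierInt_mode {n : ℕ} (hn : 1 ≤ n) {w : Plane → ℝ} (hm : IsMode n w) {r : ℝ}
    (hr : 0 < r) : fourierInt (-n) w r = Real.pi * amp n w r := by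
  set W := amp n w r
  have e : ∀ θ : ℝ, (w (polar r θ) : ℂ) * exp (((-n : ℤ) : ℂ) * θ * I)
      = W / 2 + (starRingEnd ℂ) W / 2 * exp (((-(2 * n) : ℤ) : ℂ) * θ * I) := by
    intro θ
    have hE : exp (((-n : ℤ) : ℂ) * θ * I) = (exp (θ * I) ^ n)⁻¹ := by
      rw [← exp_nat_mul, ← exp_neg]
      push_cast
      ring_nf
    have hE2 : exp (((-(2 * n) : ℤ) : ℂ) * θ * I) = (exp (θ * I) ^ n)⁻¹ * (exp (θ * I) ^ n)⁻¹ := by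
      rw [← hE, ← exp_add]
      push_cast
      ring_nf
    have hconj : (starRingEnd ℂ) (exp (θ * I)) = (exp (θ * I))⁻¹ := by
      rw [← exp_conj, ← exp_neg]
      simp
    rw [hm r θ hr, ofReal_re_eq, map_mul, map_pow, hconj, inv_pow, hE, hE2]
    have he := exp_ne_zero (θ * I)
    field_simp
    ring
  rw [fourierInt]
  simp_rw [e]
  rw [intervalIntegral.integral_add (by simp)
    (Continuous.intervalIntegrable (by fun_prop) _ _), intervalIntegral.integral_const_mul,
    integral_exp_int_mul (by omega), intervalIntegral.integral_const, real_smul]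
  push_cast
  ring

/-- The amplitude of a smooth function of angular frequency `n` is `O(r^n)`. -/
theorem norm_amp_le {n : ℕ} (hn : 1 ≤ n) {w : Plane → ℝ} (hw : ∀ k, RapidDecay k w)
    (hm : IsMode n w) : ∃ C, ∀ s, 0 < s → ‖amp n w s‖ ≤ C * s ^ n := by
  obtain ⟨C, hC, h⟩ := fourierInt_bound n w hw (-n) (by simp)
  refine ⟨C / Real.pi, fun s hs => ?_⟩
  have h1 := h s hs.le
  rw [fourierInt_mode hn hm hs, norm_mul, norm_real, Real.norm_of_nonneg Real.pi_pos.le] at h1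
  rw [div_mul_eq_mul_div, le_div_iff₀ Real.pi_pos]
  linarith

end FourierCoefficients

/-! ### The spaces `Z` and `Y_n`, angular derivatives and modes. -/

section WeightedSchwartz

open Complex

theorem mem_Z_iff {w : Plane → ℝ} :
    w ∈ Z ↔ ∀ k, RapidDecay k (fun ξ => Real.exp (‖ξ‖ ^ 2 / 8) * w ξ) := by
  constructor
  · rintro ⟨f, hf⟩ k
    simp_rw [← hf]
    exact RapidDecay.of_schwartz f k
  · intro h
    exact ⟨schwartzOfRapidDecay _ h, fun ξ => rfl⟩

theorem rapidDecay_of_mem_Z {w : Plane → ℝ} (hw : w ∈ Z) (k : ℕ) : RapidDecay k w := by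
  have h := (mem_Z_iff.1 hw k).mul
    (rapidDecay_exp (H := Plane) (by norm_num : (0 : ℝ) < 1 / 8) k).tempGrowth
  refine (congrArg (RapidDecay k) ?_).mp h
  ext ξ
  rw [mul_right_comm, ← Real.exp_add]
  ring_nf
  simp

theorem mem_Y_of_mem_Z {w : Plane → ℝ} (hw : w ∈ Z) : w ∈ Y := by
  refine ⟨(schwartzOfRapidDecay w (rapidDecay_of_mem_Z hw)).memLp 2 (μ := volume), ?_⟩
  have h := ((schwartzOfRapidDecay _ (mem_Z_iff.1 hw)).memLp 2 (μ := volume)).integrable_sq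
  refine h.congr (Eventually.of_forall fun ξ => ?_)
  change (Real.exp (‖ξ‖ ^ 2 / 8) * w ξ) ^ 2 = |w ξ| ^ 2 * Real.exp (‖ξ‖ ^ 2 / 4)
  rw [mul_pow, sq_abs, ← Real.exp_nat_mul, mul_comm]
  congr 2
  push_cast
  ring

theorem mul_mem_Z {w q : Plane → ℝ} (hw : w ∈ Z) (hq : ∀ k, TempGrowth k q) :
    (fun ξ => q ξ * w ξ) ∈ Z := by
  refine mem_Z_iff.2 fun k => ?_
  refine (congrArg (RapidDecay k) ?_).mp ((mem_Z_iff.1 hw k).mul (hq k))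
  ext ξ
  ring

/-- The rotation by a right angle as a continuous linear map. -/
def perpL : Plane →L[ℝ] Plane :=
  (toC.symm.toContinuousLinearEquiv : ℂ →L[ℝ] Plane).comp
    ((I • (1 : ℂ →L[ℝ] ℂ)).comp (toC.toContinuousLinearEquiv : Plane →L[ℝ] ℂ))

theorem toC_perp (x : Plane) : toC (perp x) = I * toC x := by
  apply Complex.ext <;> simp [toC_re, toC_im, perp]

theorem perpL_apply (x : Plane) : perpL x = perp x := by
  apply toC.injective
  rw [toC_perp]
  simp [perpL]

theorem inner_perp_self (x : Plane) : inner ℝ x (perp x) = 0 := by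
  rw [inner_eq_toC, toC_perp, mul_assoc, mul_conj]
  simp

/-- The angular derivative `∂_θ w`. -/
def dTheta (w : Plane → ℝ) (ξ : Plane) : ℝ := fderiv ℝ w ξ (perp ξ)

theorem hasFDerivAt_G_exp (c : ℝ) (ξ : Plane) :
    HasFDerivAt (fun ξ : Plane => Real.exp (c * ‖ξ‖ ^ 2))
      ((2 * c * Real.exp (c * ‖ξ‖ ^ 2)) • innerSL ℝ ξ) ξ := by
  have h1 : HasFDerivAt (fun x : Plane => ‖x‖ ^ 2) (2 • innerSL ℝ ξ) ξ :=
    (hasStrictFDerivAt_norm_sq ξ).hasFDerivAt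
  refine ((h1.const_mul c).exp).congr_fderiv ?_
  ext u
  simp only [smul_apply, smul_eq_mul, nsmul_eq_mul]
  push_cast
  ring

/-- The weight `e^{|ξ|²/8}` is radial, hence commutes with `∂_θ`. -/
theorem dTheta_mem_Z {w : Plane → ℝ} (hw : w ∈ Z) : dTheta w ∈ Z := by
  refine mem_Z_iff.2 fun k => ?_
  have h := ((mem_Z_iff.1 hw (k + 1)).fderiv).bilin (tempGrowth_clm k perpL)
    (ContinuousLinearMap.id ℝ (Plane →L[ℝ] ℝ))
  refine (congrArg (RapidDecay k) ?_).mp h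
  ext ξ
  have hd : DifferentiableAt ℝ w ξ :=
    (rapidDecay_of_mem_Z hw 1).1.differentiable (by simp) ξ
  have h1 := (hasFDerivAt_G_exp (1 / 8) ξ).mul hd.hasFDerivAt
  have h2 : (fun ξ : Plane => Real.exp (‖ξ‖ ^ 2 / 8) * w ξ)
      = (fun ξ : Plane => Real.exp (1 / 8 * ‖ξ‖ ^ 2)) * w := by
    ext ξ
    simp only [Pi.mul_apply]
    ring_nf
  rw [h2, h1.fderiv, perpL_apply]
  simp only [ContinuousLinearMap.id_apply, add_apply, smul_apply, innerSL_apply_apply,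
    inner_perp_self, smul_eq_mul, mul_zero, add_zero, dTheta]
  ring_nf

theorem hasDerivAt_polar_angle (r θ : ℝ) :
    HasDerivAt (fun θ => polar r θ) (perp (polar r θ)) θ := by
  have h : HasDerivAt (fun θ : ℝ => (r : ℂ) * exp (θ * I)) (r * (exp (θ * I) * I)) θ := by
    have h1 : HasDerivAt (fun θ : ℝ => (θ : ℂ) * I) I θ := by
      simpa using (hasDerivAt_id (θ : ℂ)).comp_ofReal.mul_const I
    exact h1.cexp.const_mul _
  have h2 := (toC.symm.toContinuousLinearEquiv : ℂ →L[ℝ] Plane).hasFDerivAt.comp_hasDerivAt θ h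
  refine (h2.congr_deriv ?_).congr_of_eventuallyEq (Eventually.of_forall fun t => ?_)
  · apply toC.injective
    rw [toC_perp, toC_polar]
    simp
    ring
  · apply toC.injective
    simp [toC_polar]

/-- The angular derivative multiplies amplitudes by `i n`. -/
theorem dTheta_polar {n : ℕ} {w : Plane → ℝ} {W : ℂ} {r : ℝ}
    (h : ∀ θ : ℝ, w (polar r θ) = (W * exp (θ * I) ^ n).re) (θ : ℝ)
    (hd : DifferentiableAt ℝ w (polar r θ)) :
    dTheta w (polar r θ) = (n * I * W * exp (θ * I) ^ n).re := by
  have h1 := hd.hasFDerivAt.comp_hasDerivAt θ (hasDerivAt_polar_angle r θ)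
  have hE : HasDerivAt (fun θ : ℝ => exp (n * ((θ : ℂ) * I))) (exp (n * (θ * I)) * (n * I)) θ := by
    have h1 : HasDerivAt (fun θ : ℝ => (θ : ℂ) * I) I θ := by
      simpa using (hasDerivAt_id (θ : ℂ)).comp_ofReal.mul_const I
    exact (h1.const_mul (n : ℂ)).cexp
  have h2 := reCLM.hasFDerivAt.comp_hasDerivAt θ (hE.const_mul W)
  have h3 : (w ∘ fun θ => polar r θ)
      = (reCLM ∘ fun y : ℝ => W * exp (n * ((y : ℂ) * I))) := by
    ext t
    simp only [Function.comp_apply, h, reCLM_apply, ← exp_nat_mul]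
  rw [h3] at h1
  have h4 := h1.unique h2
  rw [dTheta, h4, reCLM_apply, exp_nat_mul]
  congr 1
  ring

theorem exp_angle (x : Plane) (hx : x ≠ 0) : exp (angle x * I) = toC x / ‖x‖ := by
  have hx' : (‖x‖ : ℂ) ≠ 0 := by exact_mod_cast norm_ne_zero_iff.2 hx
  rw [eq_div_iff hx', mul_comm, ← toC_polar, polar_norm_angle]

theorem polar_add_two_pi (r t : ℝ) : polar r (t + 2 * Real.pi) = polar r t := by
  simp [polar]

/-- As `cos(n(α - t)) = Re (e^{inα} e^{-int})`, the projection retains exactly the Fourier integral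
of index `-n`. -/
theorem angularProj_eq {n : ℕ} (hn : n ≠ 0) {w : Plane → ℝ} (hw : Continuous w) {x : Plane}
    (hx : x ≠ 0) :
    angularProj n w x = modeFun n (fun r => fourierInt (-n) w r / Real.pi) x := by
  have hper : Function.Periodic
      (fun t => w (polar ‖x‖ t) * Real.cos (n * (angle x - t))) (2 * Real.pi) := by
    intro t
    simp only [polar_add_two_pi]
    rw [show (n : ℝ) * (angle x - (t + 2 * Real.pi)) = n * (angle x - t) - n * (2 * Real.pi) by
      ring, Real.cos_sub_nat_mul_two_pi]
  have h1 := hper.intervalIntegral_add_eq (-Real.pi) 0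
  rw [show -Real.pi + 2 * Real.pi = Real.pi by ring, zero_add] at h1
  have h2 : ∀ t : ℝ, w (polar ‖x‖ t) * Real.cos (n * (angle x - t))
      = reCLM ((w (polar ‖x‖ t) : ℂ) * exp (((-n : ℤ) : ℂ) * t * I) * exp (angle x * I) ^ n) := by
    intro t
    rw [mul_assoc, ← exp_nat_mul, ← exp_add, reCLM_apply, re_ofReal_mul]
    congr 1
    rw [← exp_ofReal_mul_I_re]
    congr 2
    push_cast
    ring
  rw [angularProj, if_neg hn, ← h1]
  simp_rw [h2]
  rw [reCLM.intervalIntegral_comp_comm ((intervalIntegrable_fourier hw _ _).mul_const _),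
    intervalIntegral.integral_mul_const, modeFun, exp_angle x hx, reCLM_apply]
  rw [← re_ofReal_mul]
  congr 1
  have hF : ∫ θ in (-Real.pi)..Real.pi, (w (polar ‖x‖ θ) : ℂ) * exp (((-n : ℤ) : ℂ) * θ * I)
    = fourierInt (-n) w ‖x‖ := rfl
  rw [hF]
  have : (Real.pi : ℂ) ≠ 0 := by exact_mod_cast Real.pi_ne_zero
  push_cast
  field_simp

theorem continuous_fourierInt {w : Plane → ℝ} (hw : Continuous w) (m : ℤ) :
    Continuous (fourierInt m w) := by
  refine intervalIntegral.continuous_parametric_intervalIntegral_of_continuous' ?_ _ _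
  exact (continuous_ofReal.comp (hw.comp continuous_polar)).mul (by fun_prop)

/-- The projection fixes `w` only almost everywhere, but both sides are continuous off the origin,
so they agree there pointwise. -/
theorem isMode_of_mem_Yn {n : ℕ} (hn : n ≠ 0) {w : Plane → ℝ} (hw : Continuous w)
    (h : w ∈ Yn n) : IsMode n w := by
  set C : ℝ → ℂ := fun r => fourierInt (-n) w r / Real.pi with hC
  have hCc : Continuous C := (continuous_fourierInt hw _).div_const _
  have hcont : ContinuousOn (modeFun n C) {0}ᶜ := by
    refine continuous_re.comp_continuousOn ?_
    refine (hCc.comp continuous_norm).continuousOn.mul (ContinuousOn.pow ?_ n)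
    refine ContinuousOn.div toC.continuous.continuousOn
      (continuous_ofReal.comp continuous_norm).continuousOn fun x hx => ?_
    exact_mod_cast norm_ne_zero_iff.2 hx
  have hae : modeFun n C =ᵐ[volume.restrict {0}ᶜ] w := by
    have h1 := ae_restrict_of_ae (s := ({0}ᶜ : Set Plane)) h.2
    filter_upwards [h1, ae_restrict_mem (measurableSet_singleton (0 : Plane)).compl] with x h2 h3
    rw [← h2, angularProj_eq hn hw h3]
  have heq : Set.EqOn (modeFun n C) w {0}ᶜ :=
    Measure.eqOn_open_of_ae_eq hae isOpen_compl_singleton hcont hw.continuousOn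
  refine isMode_of hn (W := C) fun r θ hr => ?_
  rw [← modeFun_polar n C hr]
  refine (heq ?_).symm
  intro h0
  have := norm_polar hr.le θ
  rw [h0, norm_zero] at this
  exact hr.ne this

theorem mem_Yn_of_isMode {n : ℕ} (hn : 1 ≤ n) {w : Plane → ℝ} (hw : w ∈ Z) (hm : IsMode n w) :
    w ∈ Yn n := by
  refine ⟨mem_Y_of_mem_Z hw, ?_⟩
  have hc := (rapidDecay_of_mem_Z hw 0).1.continuous
  have h0 : ∀ᵐ x : Plane, x ≠ 0 := by
    simp [ae_iff]
  filter_upwards [h0] with x hx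
  rw [angularProj_eq (by omega) hc hx, hm.eq_modeFun hx, modeFun, modeFun,
    fourierInt_mode hn hm (norm_pos_iff.2 hx)]
  have : (Real.pi : ℂ) ≠ 0 := by exact_mod_cast Real.pi_ne_zero
  rw [mul_div_cancel_left₀ _ this]

/-- Rotation by `π/n` changes the sign of `w`; let the radius tend to zero. -/
theorem IsMode.zero {n : ℕ} (hn : n ≠ 0) {w : Plane → ℝ} (hw : Continuous w) (hm : IsMode n w) :
    w 0 = 0 := by
  have hlim : ∀ θ, Tendsto (fun r => w (polar r θ)) (𝓝[>] 0) (𝓝 (w 0)) := by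
    intro θ
    have hc : Continuous fun r => w (polar r θ) :=
      hw.comp (continuous_polar.comp (by fun_prop : Continuous fun r : ℝ => (r, θ)))
    have h := (hc.tendsto 0).mono_left (nhdsWithin_le_nhds (s := Set.Ioi 0))
    rwa [polar_eq_smul, zero_smul] at h
  have hneg : ∀ r, 0 < r → w (polar r (Real.pi / n)) = -w (polar r 0) := by
    intro r hr
    have hn' : (n : ℂ) ≠ 0 := by exact_mod_cast hn
    rw [hm r _ hr, hm r _ hr, ← exp_nat_mul, ← exp_nat_mul]
    rw [show (n : ℂ) * ((Real.pi / n : ℝ) * I) = Real.pi * I by push_cast; field_simp,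
      exp_pi_mul_I]
    simp
  have h1 : Tendsto (fun r => w (polar r (Real.pi / n))) (𝓝[>] 0) (𝓝 (-w 0)) := by
    refine (hlim 0).neg.congr' ?_
    filter_upwards [self_mem_nhdsWithin] with r hr using (hneg r hr).symm
  have := tendsto_nhds_unique h1 (hlim _)
  linarith

end WeightedSchwartz

/-! ### Reduction of `Λ w = z` to the radial equation, and its solution. -/

section Operator

open Complex

theorem advect_vG (w : Plane → ℝ) (ξ : Plane) : advect vG w ξ = phi ‖ξ‖ * dTheta w ξ := by
  rw [advect, vG, map_smul, smul_eq_mul, dTheta, phi]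
  ring

theorem dTheta_zero (w : Plane → ℝ) : dTheta w 0 = 0 := by
  rw [dTheta, ← perpL_apply, map_zero, map_zero]

theorem advect_vG_mem_Z {w : Plane → ℝ} (hw : w ∈ Z) : advect vG w ∈ Z := by
  have h := mul_mem_Z (dTheta_mem_Z hw)
    (fun k => (tempGrowth_profile k).mul (TempGrowth.const k (1 / (8 * Real.pi))))
  refine (congrArg (· ∈ Z) ?_).mp h
  ext ξ
  rw [advect_vG]
  -- At the origin `phi` has the default value `0`, not its limit; this is harmless because `∂_θ w`
  -- vanishes there.
  rcases eq_or_ne ξ 0 with rfl | hξ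
  · simp [dTheta_zero]
  · rw [phi_eq (norm_pos_iff.2 hξ)]
    ring

theorem mem_LamDomain {w : Plane → ℝ} (hw : w ∈ Z) : w ∈ LamDomain :=
  ⟨mem_Y_of_mem_Z hw, (rapidDecay_of_mem_Z hw 1).1, mem_Y_of_mem_Z (advect_vG_mem_Z hw)⟩

theorem advect_G (u : Plane → Plane) (ξ : Plane) :
    advect u G ξ = -(1 / 2) * G ξ * inner ℝ ξ (u ξ) := by
  have h1 := (hasFDerivAt_G_exp (-(1 / 4)) ξ).const_mul (1 / (4 * Real.pi))
  have h2 : G = fun ξ : Plane => 1 / (4 * Real.pi) * Real.exp (-(1 / 4) * ‖ξ‖ ^ 2) := by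
    ext ξ
    rw [G]
    ring_nf
  rw [advect, h2, h1.fderiv]
  simp only [smul_apply, smul_eq_mul, innerSL_apply_apply]
  ring

/-- The stream function of a vorticity of angular frequency `n`. -/
def stream (n : ℕ) (w : Plane → ℝ) : Plane → ℝ := modeFun n (radPot n (amp n w))

variable {n : ℕ} {w z : Plane → ℝ}

/-- Here `∇G = -(G/2) ξ`, and `v = ∇^⊥ψ` gives `ξ · v = -∂_θ ψ`. -/
theorem advect_biotSavart_G (hn : 2 ≤ n) (hw : RapidDecay 0 w) (hm : IsMode n w) (ξ : Plane) :
    advect (biotSavart w) G ξ = 1 / 2 * G ξ * dTheta (stream n w) ξ := by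
  rw [advect_G, dTheta, stream, (hasFDerivAt_stream hn hw hm ξ).fderiv, reMul_apply, toC_perp,
    biotSavart_eq hw, inner_eq_toC, toC_velOfC]
  have : ((I * (starRingEnd ℂ) (cauchyVel w ξ)) * (starRingEnd ℂ) (toC ξ)).re
      = -(cauchyVel w ξ * (I * toC ξ)).re := by
    simp
  rw [this]
  ring

theorem Lam_eq (hn : 2 ≤ n) (hw : RapidDecay 0 w) (hm : IsMode n w) (ξ : Plane) :
    Lam w ξ = phi ‖ξ‖ * dTheta w ξ + 1 / 2 * G ξ * dTheta (stream n w) ξ := by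
  rw [Lam, advect_vG, advect_biotSavart_G hn hw hm]

theorem Lam_polar (hn : 2 ≤ n) (hw : RapidDecay 1 w) (hm : IsMode n w) {r : ℝ} (hr : 0 < r)
    (θ : ℝ) : Lam w (polar r θ) = (n * I * (phi r * amp n w r + g r / 2 * radPot n (amp n w) r)
      * exp (θ * I) ^ n).re := by
  have hw0 := hw.mono (by simp : 0 ≤ 1)
  have hG : G (polar r θ) = g r := by rw [G, g, norm_polar hr.le]
  rw [Lam_eq hn hw0 hm, stream, hG, norm_polar hr.le,
    dTheta_polar (fun θ => hm r θ hr) θ (hw.1.differentiable (by simp) _),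
    dTheta_polar (fun θ => modeFun_polar n _ hr θ) θ
      (hasFDerivAt_stream hn hw0 hm _).differentiableAt, ← re_ofReal_mul, ← re_ofReal_mul, ← add_re]
  congr 1
  push_cast
  ring

/-- On amplitudes `∂_θ` is multiplication by `in`, so dividing by `inφ` solves for `W`. At the
origin both sides vanish automatically. -/
theorem Lam_eq_iff (hn : 2 ≤ n) (hw : RapidDecay 1 w) (hm : IsMode n w) (hz : Continuous z)
    (hzm : IsMode n z) : Lam w = z ↔ ∀ r, 0 < r →
      amp n w r = -(hReg r * radPot n (amp n w) r + I * amp n z r / (n * phi r)) := by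
  have hnC : (n : ℂ) ≠ 0 := by exact_mod_cast (by omega : n ≠ 0)
  have key : ∀ r, 0 < r →
      (amp n w r = -(hReg r * radPot n (amp n w) r + I * amp n z r / (n * phi r)) ↔
        amp n z r = n * I * (phi r * amp n w r + g r / 2 * radPot n (amp n w) r)) := by
    intro r hr
    have hphi : (phi r : ℂ) ≠ 0 := by exact_mod_cast (phi_pos hr).ne'
    have hh : (hReg r : ℂ) = g r / (2 * phi r) := by
      rw [← h_eq hr, h]
      push_cast
      rfl
    rw [hh]
    constructor
    · intro h
      rw [h]
      field_simp
      linear_combination (2 * amp n z r) * I_sq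
    · intro h
      rw [h]
      field_simp
      linear_combination 2 * (phi r * amp n w r + g r / 2 * radPot n (amp n w) r) * I_sq
  constructor
  · intro h r hr
    rw [key r hr]
    refine amp_eq (by omega) fun θ => ?_
    rw [← Lam_polar hn hw hm hr, h]
  · intro h
    ext ξ
    rcases eq_or_ne ξ 0 with rfl | hξ
    · rw [Lam_eq hn (hw.mono (by simp)) hm, dTheta_zero, dTheta_zero, hzm.zero (by omega) hz]
      simp
    · have hr : 0 < ‖ξ‖ := norm_pos_iff.2 hξ
      rw [← polar_norm_angle ξ, Lam_polar hn hw hm hr, ← (key _ hr).1 (h _ hr), hzm _ _ hr]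

theorem radPot_congr {W W' : ℝ → ℂ} (h : ∀ s, 0 < s → W s = W' s) {r : ℝ} (hr : 0 < r) :
    radPot n W r = radPot n W' r := by
  have h1 : innerInt n W r = innerInt n W' r := by
    rw [innerInt, innerInt, intervalIntegral.integral_of_le hr.le,
      intervalIntegral.integral_of_le hr.le]
    refine setIntegral_congr_fun measurableSet_Ioc fun s hs => ?_
    rw [h s hs.1]
  have h2 : outerInt n W r = outerInt n W' r := by
    refine setIntegral_congr_fun measurableSet_Ioi fun s hs => ?_
    rw [h s (hr.trans hs)]
  rw [radPot, radPot, potP, potP, potQ, potQ, h1, h2]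

theorem tempGrowth_cauchyVel {k : ℕ} (hw : RapidDecay k w) : TempGrowth k (cauchyVel w) := by
  have h0 : RapidDecay 0 w := hw.mono (by simp)
  have h1 := (isNewtonKernel_kerRe.tempGrowth hw).smul
    (TempGrowth.const k (1 / (2 * Real.pi) : ℂ))
  have h2 := (isNewtonKernel_kerIm.tempGrowth hw).smul
    (TempGrowth.const k (1 / (2 * Real.pi) * I : ℂ))
  refine (congrArg (TempGrowth k) ?_).mp (h1.add h2)
  ext x
  rw [cauchyVel_eq h0, real_smul, real_smul]
  ring

/-- The gain of one derivative: `∇ψ` is the velocity, which is as regular as `w`. -/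
theorem tempGrowth_stream {k : ℕ} (hn : 2 ≤ n) (hw : RapidDecay k w) (hm : IsMode n w)
    (h0 : TempGrowth 0 (stream n w)) : TempGrowth (k + 1) (stream n w) := by
  have hd := hasFDerivAt_stream hn (hw.mono (by simp : 0 ≤ k)) hm
  refine TempGrowth.succ h0 (fun x => (hd x).differentiableAt) ?_
  refine (congrArg (TempGrowth k) ?_).mp ((tempGrowth_cauchyVel hw).clm_comp reMul)
  ext1 x
  exact (hd x).fderiv.symm

theorem continuous_modeFun (hn : n ≠ 0) {Ω : ℝ → ℂ} (hΩ : Continuous Ω) (h0 : Ω 0 = 0) :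
    Continuous (modeFun n Ω) := by
  refine continuous_iff_continuousAt.2 fun x => ?_
  rcases eq_or_ne x 0 with rfl | hx
  · rw [ContinuousAt, modeFun_zero hn]
    refine squeeze_zero_norm (fun x => abs_modeFun_le n Ω x) ?_
    have : Continuous fun x : Plane => ‖Ω ‖x‖‖ := by fun_prop
    simpa [h0] using this.tendsto 0
  · refine continuous_re.continuousAt.comp ?_
    refine (hΩ.comp continuous_norm).continuousAt.mul (ContinuousAt.pow ?_ n)
    refine ContinuousAt.div toC.continuous.continuousAt
      (continuous_ofReal.comp continuous_norm).continuousAt ?_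
    exact_mod_cast norm_ne_zero_iff.2 hx

/-- The source term `∂_θ z / (n² φ)` of the equation for the stream function. -/
def source (n : ℕ) (z : Plane → ℝ) (ξ : Plane) : ℝ :=
  (profile ‖ξ‖)⁻¹ * (8 * Real.pi / n ^ 2) * dTheta z ξ

theorem source_mem_Z (hz : z ∈ Z) : source n z ∈ Z :=
  mul_mem_Z (dTheta_mem_Z hz)
    fun k => (tempGrowth_profile_inv k).mul (TempGrowth.const k (8 * Real.pi / n ^ 2))

theorem source_polar (hz : z ∈ Z) (hzm : IsMode n z) {r : ℝ} (hr : 0 < r) (θ : ℝ) :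
    source n z (polar r θ) = (I * amp n z r / (n * phi r) * exp (θ * I) ^ n).re := by
  rw [source, dTheta_polar (fun θ => hzm r θ hr) θ
    ((rapidDecay_of_mem_Z hz 1).1.differentiable (by simp) _), ← re_ofReal_mul, norm_polar hr.le,
    phi_eq hr]
  congr 1
  have h1 : (profile r : ℂ) ≠ 0 := by exact_mod_cast (profile_pos r).ne'
  have h2 : (Real.pi : ℂ) ≠ 0 := by exact_mod_cast Real.pi_ne_zero
  rcases eq_or_ne n 0 with rfl | hn
  · simp
  have hnC : (n : ℂ) ≠ 0 := by exact_mod_cast hn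
  push_cast
  field_simp

/-- The equation `Λ w = z` has a solution of angular frequency `n` in the weighted Schwartz
space. -/
theorem exists_Lam_eq (hn : 2 ≤ n) (hz : z ∈ Z) (hzm : IsMode n z) :
    ∃ w, w ∈ Z ∧ IsMode n w ∧ Lam w = z := by
  have hn0 : n ≠ 0 := by omega
  set f := source n z with hf
  have hfZ : f ∈ Z := source_mem_Z hz
  have hfR := rapidDecay_of_mem_Z hfZ
  have hF : RadialDecay (amp n f) := radialDecay_amp n (hfR 0)
  have hFamp : ∀ r, 0 < r → amp n f r = I * amp n z r / (n * phi r) := fun r hr =>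
    amp_eq hn0 fun θ => source_polar hz hzm hr θ
  obtain ⟨Ω, hΩc, ⟨C, hC⟩, hΩ0, hΩ⟩ := exists_radial_fixedPoint hn hF
  -- The only candidate, by `Lam_eq_iff`. By the fixed-point equation its stream function is the
  -- mode with amplitude `Ω`.
  set w : Plane → ℝ := fun ξ => (-1 : ℝ) * (hReg ‖ξ‖ * modeFun n Ω ξ + f ξ) with hw
  have hwpolar : ∀ r θ : ℝ, 0 < r →
      w (polar r θ) = (-(hReg r * Ω r + amp n f r) * exp (θ * I) ^ n).re := by
    intro r θ hr
    rw [hw]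
    beta_reduce
    rw [modeFun_polar n Ω hr, hf, source_polar hz hzm hr, hFamp r hr, norm_polar hr.le,
      ← re_ofReal_mul, ← add_re, ← re_ofReal_mul]
    congr 1
    push_cast
    ring
  have hwm : IsMode n w := isMode_of hn0 (W := fun r => -(hReg r * Ω r + amp n f r)) hwpolar
  have hwamp : ∀ r, 0 < r → amp n w r = -(hReg r * Ω r + amp n f r) := fun r hr =>
    amp_eq hn0 fun θ => hwpolar r θ hr
  have hpot : ∀ r, 0 < r → radPot n (amp n w) r = Ω r := fun r hr => by
    rw [hΩ r hr, radPot_congr hwamp hr]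
  have hstream : stream n w = modeFun n Ω := by
    ext ξ
    rcases eq_or_ne ξ 0 with rfl | hξ
    · rw [stream, modeFun_zero hn0, modeFun_zero hn0]
    · rw [stream, modeFun, modeFun, hpot _ (norm_pos_iff.2 hξ)]
  have hψ0 : TempGrowth 0 (stream n w) := by
    rw [hstream]
    refine tempGrowth_zero_iff.2 ⟨continuous_modeFun hn0 hΩc hΩ0, 0, C,
      (norm_nonneg _).trans (hC 0), fun x => ?_⟩
    simpa using (abs_modeFun_le n Ω x).trans (hC _)
  -- One half of the bootstrap; `tempGrowth_stream` is the other half. The start is the boundedness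
  -- and continuity of `Ω`.
  have hstep : ∀ k, TempGrowth k (stream n w) → RapidDecay k w := by
    intro k hk
    have h1 := (rapidDecay_exp_mul_hReg (by norm_num : (0 : ℝ) < 1 / 4) k).mul hk
    have h2 := (h1.add (hfR k)).smul (TempGrowth.const k (-1 : ℝ))
    refine (congrArg (RapidDecay k) ?_).mp h2
    ext ξ
    rw [hw, hstream]
    simp
  have hψ : ∀ k, TempGrowth k (stream n w) := by
    intro k
    induction k with
    | zero => exact hψ0
    | succ k ih => exact tempGrowth_stream hn (hstep k ih) hwm hψ0
  have hwZ : w ∈ Z := by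
    refine mem_Z_iff.2 fun k => ?_
    -- Since `1/8 < 1/4`, the Gaussian decay of `h` survives multiplication by the weight defining
    -- `Z`.
    have h1 := (rapidDecay_exp_mul_hReg (by norm_num : (1 / 8 : ℝ) < 1 / 4) k).mul (hψ k)
    have h2 := (h1.add (mem_Z_iff.1 hfZ k)).smul (TempGrowth.const k (-1 : ℝ))
    refine (congrArg (RapidDecay k) ?_).mp h2
    ext ξ
    rw [hw, hstream]
    simp only [smul_eq_mul]
    rw [show 1 / 8 * ‖ξ‖ ^ 2 = ‖ξ‖ ^ 2 / 8 by ring]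
    ring
  refine ⟨w, hwZ, hwm, ?_⟩
  rw [Lam_eq_iff hn (rapidDecay_of_mem_Z hwZ 1) hwm (rapidDecay_of_mem_Z hz 0).1.continuous hzm]
  intro r hr
  rw [hwamp r hr, hpot r hr, hFamp r hr]

/-- Real and imaginary parts of the stream amplitude of a solution of `Λ w = z` solve the
radial equation. -/
theorem solvesRadial_of_Lam_eq (hn : 2 ≤ n) (hw : w ∈ Z) (hm : IsMode n w) (hz : z ∈ Z)
    (hzm : IsMode n z) (h : Lam w = z) (L : ℂ →L[ℝ] ℝ) :
    ∃ u' u'', SolvesRadial n (fun r => L (I * amp n z r / (n * phi r)))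
      (fun r => L (radPot n (amp n w) r)) u' u'' := by
  have hR := rapidDecay_of_mem_Z hw
  have hW := (Lam_eq_iff hn (hR 1) hm (rapidDecay_of_mem_Z hz 0).1.continuous hzm).1 h
  have hs := solvesRadial_radPot (by omega : 1 ≤ n) (radialDecay_amp n (hR 0)) L
  refine ⟨_, _, fun r hr => ⟨(hs r hr).1, (hs r hr).2.1, (hs r hr).2.2.trans ?_⟩⟩
  beta_reduce
  rw [hW r hr, h_eq hr, map_neg, map_add, ← real_smul, map_smul, smul_eq_mul]
  ring

theorem isBigO_radPot (hn : 2 ≤ n) (hw : w ∈ Z) (hm : IsMode n w) (L : ℂ →L[ℝ] ℝ) :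
    (fun r => L (radPot n (amp n w) r)) =O[𝓝[>] (0 : ℝ)] (fun r : ℝ => r ^ n) ∧
      (fun r => L (radPot n (amp n w) r)) =O[atTop] (fun r : ℝ => (r ^ n)⁻¹) := by
  have hR := rapidDecay_of_mem_Z hw
  have hn1 : 1 ≤ n := by omega
  have hW := radialDecay_amp n (hR 0)
  have hL : ∀ l : Filter ℝ, (fun r => L (radPot n (amp n w) r)) =O[l] (radPot n (amp n w)) :=
    fun l => L.isBigO_comp _ _
  constructor
  · obtain ⟨C₀, hC₀⟩ := norm_amp_le hn1 hR hm
    obtain ⟨C, hC⟩ := norm_radPot_le_pow hn1 hW ⟨C₀, fun s hs _ => hC₀ s hs⟩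
    refine (hL _).trans (IsBigO.of_bound C ?_)
    filter_upwards [self_mem_nhdsWithin] with r hr
    have hr : 0 < r := hr
    rw [Real.norm_of_nonneg (by positivity)]
    exact hC r hr
  · obtain ⟨C, hC⟩ := norm_radPot_le_inv_pow hn1 hW
    refine (hL _).trans (IsBigO.of_bound C ?_)
    filter_upwards [eventually_gt_atTop 0] with r hr
    rw [Real.norm_of_nonneg (by positivity)]
    exact hC r hr

/-- The maximum principle is for real functions, so it is applied to real and imaginary parts
separately; both vanish at the two ends by the power bounds. -/
theorem radPot_unique (hn : 2 ≤ n) {w' : Plane → ℝ} (hw : w ∈ Z) (hm : IsMode n w)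
    (hw' : w' ∈ Z) (hm' : IsMode n w') (hz : z ∈ Z) (hzm : IsMode n z) (h : Lam w = z)
    (h' : Lam w' = z) {r : ℝ} (hr : 0 < r) :
    radPot n (amp n w') r = radPot n (amp n w) r := by
  have hn0 : n ≠ 0 := by omega
  have key : ∀ L : ℂ →L[ℝ] ℝ, L (radPot n (amp n w') r) = L (radPot n (amp n w) r) := by
    intro L
    obtain ⟨_, _, h1⟩ := solvesRadial_of_Lam_eq hn hw hm hz hzm h L
    obtain ⟨_, _, h2⟩ := solvesRadial_of_Lam_eq hn hw' hm' hz hzm h' L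
    obtain ⟨a1, a2⟩ := isBigO_radPot hn hw hm L
    obtain ⟨b1, b2⟩ := isBigO_radPot hn hw' hm' L
    exact h2.eq hn h1 (tendsto_zero_of_isBigO_pow hn0 b1) (tendsto_zero_of_isBigO_pow hn0 a1)
      (tendsto_zero_of_isBigO_inv_pow hn0 b2) (tendsto_zero_of_isBigO_inv_pow hn0 a2) hr
  exact Complex.ext (key reCLM) (key imCLM)

theorem Lam_injective (hn : 2 ≤ n) {w' : Plane → ℝ} (hw : w ∈ Z) (hm : IsMode n w)
    (hw' : w' ∈ Z) (hm' : IsMode n w') (hz : z ∈ Z) (hzm : IsMode n z) (h : Lam w = z)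
    (h' : Lam w' = z) : w' = w := by
  have hn0 : n ≠ 0 := by omega
  have hR := rapidDecay_of_mem_Z hw
  have hR' := rapidDecay_of_mem_Z hw'
  have hzc := (rapidDecay_of_mem_Z hz 0).1.continuous
  ext ξ
  rcases eq_or_ne ξ 0 with rfl | hξ
  · rw [hm.zero hn0 (hR 0).1.continuous, hm'.zero hn0 (hR' 0).1.continuous]
  · have hr : 0 < ‖ξ‖ := norm_pos_iff.2 hξ
    rw [hm.eq_modeFun hξ, hm'.eq_modeFun hξ, modeFun, modeFun,
      (Lam_eq_iff hn (hR 1) hm hzc hzm).1 h _ hr, (Lam_eq_iff hn (hR' 1) hm' hzc hzm).1 h' _ hr,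
      radPot_unique hn hw hm hw' hm' hz hzm h h' hr]

end Operator

/-! ### Sine data, and the proof of the lemma. -/

/-- The stream amplitude of the solution of `Λ w = a(r) sin(nθ)` is the radial solution. -/
theorem radialSolution_of_Lam_eq {n : ℕ} (hn : 2 ≤ n) {w z : Plane → ℝ} (hw : w ∈ Z)
    (hm : IsMode n w) (hz : z ∈ Z) (hzm : IsMode n z) (h : Lam w = z) {a : ℝ → ℝ}
    (ha : ∀ r θ : ℝ, 0 < r → z (polar r θ) = a r * Real.sin (n * θ)) :
    IsRadialSolution n a (fun r => (radPot n (amp n w) r).re) ∧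
      ∀ r, 0 < r → (radPot n (amp n w) r).im = 0 ∧
        amp n w r = -(hReg r * radPot n (amp n w) r + (a r / (n * phi r) : ℝ)) := by
  have hn0 : n ≠ 0 := by omega
  -- `a sin(nθ)` is the real part of `-i a e^{inθ}`.
  have hamp : ∀ r, 0 < r → amp n z r = -(Complex.I * a r) := fun r hr =>
    amp_eq hn0 fun θ => by
      rw [ha r θ hr, ← Complex.exp_nat_mul, ← mul_assoc, ← Complex.ofReal_natCast,
        ← Complex.ofReal_mul]
      rw [neg_mul, mul_comm Complex.I, mul_assoc, Complex.neg_re, Complex.re_ofReal_mul,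
        Complex.I_mul_re, Complex.exp_ofReal_mul_I_im]
      ring
  have hsrc : ∀ r, 0 < r → Complex.I * amp n z r / (n * phi r) = (a r / (n * phi r) : ℝ) := by
    intro r hr
    rw [hamp r hr]
    push_cast
    linear_combination (-(a r / (n * phi r)) : ℂ) * Complex.I_sq
  have hsol : ∀ L : ℂ →L[ℝ] ℝ, ∃ u' u'', SolvesRadial n
      (fun r => L (a r / (n * phi r) : ℝ)) (fun r => L (radPot n (amp n w) r)) u' u'' := by
    intro L
    obtain ⟨u', u'', hs⟩ := solvesRadial_of_Lam_eq hn hw hm hz hzm h L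
    refine ⟨u', u'', fun r hr => ⟨(hs r hr).1, (hs r hr).2.1, (hs r hr).2.2.trans ?_⟩⟩
    beta_reduce
    rw [hsrc r hr]
  refine ⟨?_, fun r hr => ⟨?_, ?_⟩⟩
  · obtain ⟨_, _, hs⟩ := hsol Complex.reCLM
    exact isRadialSolution_iff.2 ⟨hs.deriv, isBigO_radPot hn hw hm Complex.reCLM⟩
  · obtain ⟨_, _, hs⟩ := hsol Complex.imCLM
    obtain ⟨h1, h2⟩ := isBigO_radPot hn hw hm Complex.imCLM
    -- The source is real, so the imaginary part solves the homogeneous equation and must be zero.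
    have h0 : SolvesRadial n (fun r => Complex.imCLM (a r / (n * phi r) : ℝ)) 0 0 0 := fun s hs =>
      ⟨hasDerivAt_const s 0, hasDerivAt_const s 0, by
        simp only [Complex.imCLM_apply, Complex.ofReal_im, Pi.zero_apply]
        simp⟩
    exact hs.eq hn h0 (tendsto_zero_of_isBigO_pow hn0 h1) tendsto_const_nhds
      (tendsto_zero_of_isBigO_inv_pow hn0 h2) tendsto_const_nhds hr
  · rw [(Lam_eq_iff hn (rapidDecay_of_mem_Z hw 1) hm (rapidDecay_of_mem_Z hz 0).1.continuous
      hzm).1 h r hr, hsrc r hr]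

theorem IsRadialSolution.eqOn {n : ℕ} (hn : 2 ≤ n) {a Ω Ω' : ℝ → ℝ} (hΩ : IsRadialSolution n a Ω)
    (hΩ' : IsRadialSolution n a Ω') : Set.EqOn Ω' Ω (Set.Ioi 0) := by
  have hn0 : n ≠ 0 := by omega
  obtain ⟨h1, h2, h3⟩ := isRadialSolution_iff.1 hΩ
  obtain ⟨k1, k2, k3⟩ := isRadialSolution_iff.1 hΩ'
  exact fun r hr => k1.eq hn h1 (tendsto_zero_of_isBigO_pow hn0 k2)
    (tendsto_zero_of_isBigO_pow hn0 h2) (tendsto_zero_of_isBigO_inv_pow hn0 k3)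
    (tendsto_zero_of_isBigO_inv_pow hn0 h3) hr

end
end OseenVortex

open OseenVortex

theorem lemma3p3 (n : ℕ) (hn : 2 ≤ n) (z : Plane → ℝ) (hz : z ∈ Yn n ∩ Z) :
    ∃ w : Plane → ℝ,
      (w ∈ Yn n ∩ Z ∧ w ∈ LamDomain ∧ Lam w = z) ∧
      (∀ w' : Plane → ℝ, w' ∈ Yn n ∩ Z → Lam w' = z → w' = w) ∧
      (∀ a : ℝ → ℝ,
        (∀ r θ : ℝ, 0 < r → z (polar r θ) = a r * Real.sin (n * θ)) →
        ∃ Ω : ℝ → ℝ,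
          IsRadialSolution n a Ω ∧
          (∀ Ω' : ℝ → ℝ, IsRadialSolution n a Ω' → Set.EqOn Ω' Ω (Set.Ioi 0)) ∧
          (∀ r θ : ℝ, 0 < r →
            w (polar r θ) = -(h r * Ω r + a r / (n * phi r)) * Real.cos (n * θ))) := by
  have hn0 : n ≠ 0 := by omega
  have hmode : ∀ w ∈ Yn n ∩ Z, IsMode n w := fun w hw =>
    isMode_of_mem_Yn hn0 (rapidDecay_of_mem_Z hw.2 0).1.continuous hw.1
  have hzm := hmode z hz
  obtain ⟨w, hw, hm, hL⟩ := exists_Lam_eq hn hz.2 hzm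
  refine ⟨w, ⟨⟨mem_Yn_of_isMode (by omega) hw hm, hw⟩, mem_LamDomain hw, hL⟩,
    fun w' hw' hL' => Lam_injective hn hw hm hw'.2 (hmode w' hw') hz.2 hzm hL hL',
    fun a ha => ?_⟩
  obtain ⟨hsol, hformula⟩ := radialSolution_of_Lam_eq hn hw hm hz.2 hzm hL ha
  refine ⟨_, hsol, fun Ω' hΩ' => hsol.eqOn hn hΩ', fun r θ hr => ?_⟩
  obtain ⟨him, hamp⟩ := hformula r hr
  -- With a real stream amplitude the vorticity amplitude is real too, and only the cosine survives
  -- in the real part.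
  have hre : radPot n (amp n w) r = ((radPot n (amp n w) r).re : ℂ) := Complex.ext rfl him
  rw [hm r θ hr, hamp, hre, Complex.ofReal_re, h_eq hr, ← Complex.exp_nat_mul, ← mul_assoc,
    ← Complex.ofReal_natCast, ← Complex.ofReal_mul, ← Complex.ofReal_mul, ← Complex.ofReal_add,
    ← Complex.ofReal_neg, Complex.re_ofReal_mul, Complex.exp_ofReal_mul_I_re]
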